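/- Let $(M,g,J)$ be a Kähler surface: a smooth $4$-manifold $M$ with a Riemannian metric $g$ and an orthogonal almost complex structure $J$ that is parallel for the Levi-Civita connection, oriented by $\frac12\omega\wedge\omega$, $\omega(X,Y)=g(JX,Y)$. Let $R(X,Y)Z=([\nabla_X,\nabla_Y]-\nabla_{[X,Y]})Z$, $R(X,Y,Z,U)=g(R(X,Y)Z,U)$, let $\tau$ be the scalar curvature, $\mathrm{Ric}_0=\mathrm{Ric}-\frac{\tau}{4}g$, and let $W^-$ be the anti-self-dual part of the Weyl tensor, which acts on the anti-self-dual two-forms $\Lambda^-$ by $g(W^-\varphi,\psi)=-W^-(\varphi,\psi)$. It is called degenerate if at each point it has at most two distinct eigenvalues on $\Lambda^-$. For a smooth $J$-invariant $2$-dimensional distribution $D$ with orthogonal complement $E$, and orthogonal projections $p_D,p_E$, put $h(X,Y)=g(p_DX,p_DY)$, $m(X,Y)=g(p_EX,p_EY)$, and $$\Pi(X,Y,Z,U)=\tfrac14\big(g(Y,Z)g(X,U)-g(X,Z)g(Y,U)+g(JY,Z)g(JX,U)-g(JX,Z)g(JY,U)-2g(JX,Y)g(JZ,U)\big),$$ $$\begin{aligned}\Phi(X,Y,Z,U)=\tfrac18\big(&g(Y,Z)h(X,U)-g(X,Z)h(Y,U)+g(X,U)h(Y,Z)-g(Y,U)h(X,Z)\\&+g(JY,Z)h(JX,U)-g(JX,Z)h(JY,U)+g(JX,U)h(JY,Z)-g(JY,U)h(JX,Z)\\&-2g(JX,Y)h(JZ,U)-2g(JZ,U)h(JX,Y)\big),\end{aligned}$$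 $$\Psi(X,Y,Z,U)=-h(JX,Y)h(JZ,U).$$ The surface is called QCH (of quasi-constant holomorphic sectional curvature) with respect to $D$ if, for unit vectors $X\in T_xM$, $R(X,JX,JX,X)$ depends only on $x$ and on $|p_DX|$. A negative almost complex structure is a smooth orthogonal almost complex structure $\bar J$ that induces the orientation opposite to that of $J$; put $\bar\omega(X,Y)=g(\bar JX,Y)\in\Lambda^-$, and let $\kappa=3\,g(W^-\bar\omega,\bar\omega)$ be the conformal scalar curvature of $(M,g,\bar J)$, with the norm on two-forms for which $g(\bar\omega,\bar\omega)=2$. (1) Suppose that $(M,g,J)$ is QCH with respect to $D$, and let $\bar J=J$ on $D$, $\bar J=-J$ on $E$. Then there are smooth functions $a,b,c$ on $M$ with $R=a\Pi+b\Phi+c\Psi$ and $W^-=c(\frac16\Pi-\Phi+\Psi)$. Moreover $\bar J$ is a negative almost complex structure, $W^-$ is degenerate, $\bar\omega$ is at each point an eigenvector of $W^-$, its eigenvalue is simple at every point where $W^-\neq0$, and $\bar J$ preserves the Ricci tensor: $\mathrm{Ric}(\bar JX,\bar JY)=\mathrm{Ric}(X,Y)$. (2) Conversely, let $\bar J$ be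 a negative almost complex structure on $(M,g,J)$ that preserves the Ricci tensor, and let $D=\ker(J\bar J+\mathrm{Id})$, $E=\ker(J\bar J-\mathrm{Id})$. Then the following two conditions are equivalent: (i) $W^-$ is degenerate and $\bar\omega$ is at each point an eigenvector of $W^-$, with simple eigenvalue at every point where $W^-\ne0$; (ii) $W^-=\frac{\kappa}{2}(\frac16\Pi-\Phi+\Psi)$. If they hold, then $E=D^\perp$, $(M,g,J)$ is QCH with respect to $D$, the functions $\tau$ and $\kappa$ are smooth, and there is a smooth function $\delta$ with $\mathrm{Ric}_0=\delta(h-m)$ and $$R=\Big(\frac{\tau}{6}-\delta+\frac{\kappa}{12}\Big)\Pi+\Big(2\delta-\frac{\kappa}{2}\Big)\Phi+\frac{\kappa}{2}\Psi .$$ -/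

import Mathlib

open Bundle
open scoped Manifold ContDiff RealInnerProductSpace

noncomputable section

namespace QCH

/-! ### Linear algebra on a Euclidean space `V` with an orthogonal complex structure `J`

Four-tensors are written as functions `V → V → V → V → ℝ`.
The curvature convention is `R(X,Y,Z,U) = g(R(X,Y)Z,U)`, so that `R(X,Y,Y,X)` is the sectional
curvature of an orthonormal pair. Sums over an orthonormal basis do not depend on the basis. -/

section LinearAlgebra

variable {V : Type*} [NormedAddCommGroup V] [InnerProductSpace ℝ V] [FiniteDimensional ℝ V]

/-- The fundamental form `ω(X,Y) = g(JX,Y)`. -/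
def fundForm (J : V →L[ℝ] V) : LinearMap.BilinForm ℝ V :=
  (innerₗ V).comp J.toLinearMap

/-- The volume form `½ ω ∧ ω` of the orientation defined by `J` (for `dim V = 4`). -/
def volForm (J : V →L[ℝ] V) (X Y Z U : V) : ℝ :=
  fundForm J X Y * fundForm J Z U - fundForm J X Z * fundForm J Y U
    + fundForm J X U * fundForm J Y Z

/-- `h(X,Y) = g(p_D X, p_D Y)`, where `p_D` is the orthogonal projection on `D`. -/
def hForm (D : Submodule ℝ V) (X Y : V) : ℝ := ⟪D.starProjection X, D.starProjection Y⟫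

/-- The Kähler tensor `Π` of constant holomorphic sectional curvature one. -/
def tensorPi (J : V →L[ℝ] V) (X Y Z U : V) : ℝ :=
  (1 / 4) * (⟪Y, Z⟫ * ⟪X, U⟫ - ⟪X, Z⟫ * ⟪Y, U⟫
    + ⟪J Y, Z⟫ * ⟪J X, U⟫ - ⟪J X, Z⟫ * ⟪J Y, U⟫ - 2 * ⟪J X, Y⟫ * ⟪J Z, U⟫)

/-- The Kähler tensor `Φ` of the pair `(J, D)`. -/
def tensorPhi (J : V →L[ℝ] V) (D : Submodule ℝ V) (X Y Z U : V) : ℝ :=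
  (1 / 8) * (⟪Y, Z⟫ * hForm D X U - ⟪X, Z⟫ * hForm D Y U
    + ⟪X, U⟫ * hForm D Y Z - ⟪Y, U⟫ * hForm D X Z
    + ⟪J Y, Z⟫ * hForm D (J X) U - ⟪J X, Z⟫ * hForm D (J Y) U
    + ⟪J X, U⟫ * hForm D (J Y) Z - ⟪J Y, U⟫ * hForm D (J X) Z
    - 2 * ⟪J X, Y⟫ * hForm D (J Z) U - 2 * ⟪J Z, U⟫ * hForm D (J X) Y)

/-- The Kähler tensor `Ψ` of the pair `(J, D)`. -/
def tensorPsi (J : V →L[ℝ] V) (D : Submodule ℝ V) (X Y Z U : V) : ℝ :=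
  -(hForm D (J X) Y * hForm D (J Z) U)

/-- The tensor `K = Π/6 - Φ + Ψ`. -/
def tensorK (J : V →L[ℝ] V) (D : Submodule ℝ V) (X Y Z U : V) : ℝ :=
  (1 / 6) * tensorPi J X Y Z U - tensorPhi J D X Y Z U + tensorPsi J D X Y Z U

/-- The Ricci contraction `Ric(Y,Z) = ∑ R(eᵢ,Y,Z,eᵢ)`. -/
def ricciOf (R : V → V → V → V → ℝ) (Y Z : V) : ℝ :=
  ∑ i, R (stdOrthonormalBasis ℝ V i) Y Z (stdOrthonormalBasis ℝ V i)

/-- The scalar curvature `τ = ∑ Ric(eᵢ,eᵢ)`. -/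
def scalarOf (R : V → V → V → V → ℝ) : ℝ :=
  ∑ i, ricciOf R (stdOrthonormalBasis ℝ V i) (stdOrthonormalBasis ℝ V i)

/-- The trace-free part `Ric₀ = Ric - (τ/4) g` of the Ricci tensor in dimension four. -/
def ricciZeroOf (R : V → V → V → V → ℝ) (X Y : V) : ℝ :=
  ricciOf R X Y - scalarOf R / 4 * ⟪X, Y⟫

/-- The Schouten tensor `½ (Ric - (τ/6) g)` in dimension four. -/
def schoutenOf (R : V → V → V → V → ℝ) (X Y : V) : ℝ :=
  (1 / 2) * (ricciOf R X Y - scalarOf R / 6 * ⟪X, Y⟫)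

/-- The Kulkarni–Nomizu product of two symmetric bilinear forms. -/
def kulkarniNomizu (h k : V → V → ℝ) (X Y Z U : V) : ℝ :=
  h X Z * k Y U + h Y U * k X Z - h X U * k Y Z - h Y Z * k X U

/-- The Weyl tensor in dimension four; with the curvature convention above
`R = W - S ⊘ g`, where `S` is the Schouten tensor. -/
def weylOf (R : V → V → V → V → ℝ) (X Y Z U : V) : ℝ :=
  R X Y Z U + kulkarniNomizu (schoutenOf R) (fun A B => ⟪A, B⟫) X Y Z U

/-- The Hodge star on two-forms, for the orientation defined by `J`. -/
def hodgeStar (J : V →L[ℝ] V) (α : V → V → ℝ) (X Y : V) : ℝ :=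
  (1 / 2) * ∑ i, ∑ j, α (stdOrthonormalBasis ℝ V i) (stdOrthonormalBasis ℝ V j)
    * volForm J (stdOrthonormalBasis ℝ V i) (stdOrthonormalBasis ℝ V j) X Y

/-- The anti-self-dual part `W⁻ = ½ (W - W ∘ *)` of the Weyl tensor. -/
def weylMinusOf (J : V →L[ℝ] V) (R : V → V → V → V → ℝ) (X Y Z U : V) : ℝ :=
  (1 / 2) * (weylOf R X Y Z U - hodgeStar J (fun A B => weylOf R A B Z U) X Y)

/-- The space `Λ⁻` of anti-self-dual two-forms. -/
def asdForms (J : V →L[ℝ] V) : Submodule ℝ (LinearMap.BilinForm ℝ V) where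
  carrier := {α | (∀ X, α X X = 0) ∧ ∀ X Y, hodgeStar J (fun A B => α A B) X Y = -α X Y}
  zero_mem' := by simp [hodgeStar]
  add_mem' := by
    rintro α β ⟨hα, hα'⟩ ⟨hβ, hβ'⟩
    refine ⟨fun X => by simp [hα, hβ], fun X Y => ?_⟩
    have h1 := hα' X Y
    have h2 := hβ' X Y
    simp only [hodgeStar, LinearMap.add_apply, add_mul, Finset.sum_add_distrib, mul_add] at *
    linarith
  smul_mem' := by
    rintro c α ⟨hα, hα'⟩
    refine ⟨fun X => by simp [hα], fun X Y => ?_⟩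
    have h1 := hα' X Y
    simp only [hodgeStar, LinearMap.smul_apply, smul_eq_mul, mul_assoc, ← Finset.mul_sum] at *
    linear_combination c * h1

/-- The action of a curvature-type tensor `T` on two-forms: `g(Tφ,ψ) = -T(φ,ψ)`, that is
`(Tα)(Z,U) = -∑_{i<j} α(eᵢ,eⱼ) T(eᵢ,eⱼ,Z,U)`. -/
def formAction (T : V → V → V → V → ℝ) (α : V → V → ℝ) (Z U : V) : ℝ :=
  -(1 / 2) * ∑ i, ∑ j, α (stdOrthonormalBasis ℝ V i) (stdOrthonormalBasis ℝ V j)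
    * T (stdOrthonormalBasis ℝ V i) (stdOrthonormalBasis ℝ V j) Z U

/-- The inner product of two-forms, `g(α,β) = ∑_{i<j} α(eᵢ,eⱼ) β(eᵢ,eⱼ)`. -/
def formInner (α β : V → V → ℝ) : ℝ :=
  (1 / 2) * ∑ i, ∑ j, α (stdOrthonormalBasis ℝ V i) (stdOrthonormalBasis ℝ V j)
    * β (stdOrthonormalBasis ℝ V i) (stdOrthonormalBasis ℝ V j)

/-- The `μ`-eigenspace in `Λ⁻` of the endomorphism of `Λ⁻` given by `T`. -/
def asdEigenspace (J : V →L[ℝ] V) (T : V → V → V → V → ℝ) (μ : ℝ) :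
    Submodule ℝ (LinearMap.BilinForm ℝ V) where
  carrier := {α | α ∈ asdForms J ∧ ∀ Z U, formAction T (fun A B => α A B) Z U = μ * α Z U}
  zero_mem' := ⟨Submodule.zero_mem _, by simp [formAction]⟩
  add_mem' := by
    rintro α β ⟨hα, hα'⟩ ⟨hβ, hβ'⟩
    refine ⟨Submodule.add_mem _ hα hβ, fun X Y => ?_⟩
    have h1 := hα' X Y
    have h2 := hβ' X Y
    simp only [formAction, LinearMap.add_apply, add_mul, Finset.sum_add_distrib, mul_add] at *
    linarith
  smul_mem' := by
    rintro c α ⟨hα, hα'⟩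
    refine ⟨Submodule.smul_mem _ c hα, fun X Y => ?_⟩
    have h1 := hα' X Y
    simp only [formAction, LinearMap.smul_apply, smul_eq_mul, mul_assoc, ← Finset.mul_sum] at *
    linear_combination c * h1

/-- `T` is degenerate on `Λ⁻`: it has at most two distinct eigenvalues there. -/
def IsDegenerate (J : V →L[ℝ] V) (T : V → V → V → V → ℝ) : Prop :=
  {μ : ℝ | asdEigenspace J T μ ≠ ⊥}.encard ≤ 2

/-- `α` is an eigenvector of `T` on `Λ⁻`. The eigenvalue is simple at points where `T` does not
vanish. -/
def IsSimpleEigenform (J : V →L[ℝ] V) (T : V → V → V → V → ℝ)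
    (α : LinearMap.BilinForm ℝ V) : Prop :=
  α ≠ 0 ∧ ∃ μ : ℝ, α ∈ asdEigenspace J T μ ∧
    (T ≠ 0 → Module.finrank ℝ (asdEigenspace J T μ) = 1)

/-- The structure which equals `J` on `D` and `-J` on the orthogonal complement of `D`. -/
def oppositeOf (J : V →L[ℝ] V) (D : Submodule ℝ V) : V →L[ℝ] V :=
  J ∘L (D.starProjection - Dᗮ.starProjection)

end LinearAlgebra

/-! ### Riemannian geometry of four-manifolds -/

section Geometry

/-- The model space. -/
abbrev E4 : Type := EuclideanSpace ℝ (Fin 4)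

variable {M : Type*} [TopologicalSpace M] [ChartedSpace E4 M] [IsManifold (𝓡 4) ∞ M]
  [RiemannianBundle (fun x : M => TangentSpace (𝓡 4) x)]

instance finiteDimensionalTangentSpace (x : M) :
    FiniteDimensional ℝ (TangentSpace (𝓡 4) x) :=
  inferInstanceAs (FiniteDimensional ℝ E4)

/-- Half of the right-hand side of Koszul's formula, that is the value of `g(∇_X Y, Z)` at `x`. -/
def koszul (X Y Z : ∀ x : M, TangentSpace (𝓡 4) x) (x : M) : ℝ :=
  (1 / 2) * (mvfderiv (𝓡 4) (fun y : M => ⟪Y y, Z y⟫) x (X x)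
    + mvfderiv (𝓡 4) (fun y : M => ⟪X y, Z y⟫) x (Y x)
    - mvfderiv (𝓡 4) (fun y : M => ⟪X y, Y y⟫) x (Z x)
    + ⟪VectorField.mlieBracket (𝓡 4) X Y x, Z x⟫
    - ⟪VectorField.mlieBracket (𝓡 4) X Z x, Y x⟫
    - ⟪VectorField.mlieBracket (𝓡 4) Y Z x, X x⟫)

/-- The Levi-Civita derivative `∇_X Y`, given by Koszul's formula: at `x`, its components in an
orthonormal basis `eᵢ` of `T_xM` are `g(∇_X Y, eᵢ)`, each `eᵢ` being extended to a local
vector field. -/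
def leviCivita (X Y : ∀ x : M, TangentSpace (𝓡 4) x) (x : M) : TangentSpace (𝓡 4) x :=
  ∑ i, koszul X Y (FiberBundle.extend E4 (stdOrthonormalBasis ℝ (TangentSpace (𝓡 4) x) i)) x
    • stdOrthonormalBasis ℝ (TangentSpace (𝓡 4) x) i

/-- `R(X,Y)Z = [∇_X,∇_Y]Z - ∇_{[X,Y]}Z` for vector fields. -/
def curvatureField (X Y Z : ∀ x : M, TangentSpace (𝓡 4) x) (x : M) : TangentSpace (𝓡 4) x :=
  leviCivita X (leviCivita Y Z) x - leviCivita Y (leviCivita X Z) x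
    - leviCivita (VectorField.mlieBracket (𝓡 4) X Y) Z x

/-- The curvature tensor `R(u,v,w,z) = g(R(u,v)w,z)` at the point `x`, the vectors `u,v,w` being
extended to local smooth vector fields. -/
def riemann (x : M) (u v w z : TangentSpace (𝓡 4) x) : ℝ :=
  ⟪curvatureField (FiberBundle.extend E4 u) (FiberBundle.extend E4 v)
    (FiberBundle.extend E4 w) x, z⟫

/-- Smoothness of a field of endomorphisms of the tangent bundle. -/
def IsSmoothEndo (A : ∀ x : M, TangentSpace (𝓡 4) x →L[ℝ] TangentSpace (𝓡 4) x) : Prop :=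
  ContMDiff (𝓡 4) ((𝓡 4).prod 𝓘(ℝ, E4 →L[ℝ] E4)) ∞
    (fun x => Bundle.TotalSpace.mk' (E4 →L[ℝ] E4)
      (E := fun x : M => TangentSpace (𝓡 4) x →L[ℝ] TangentSpace (𝓡 4) x) x (A x))

/-- A smooth orthogonal almost complex structure on the Riemannian manifold `M`. -/
structure IsAlmostHermitian
    (J : ∀ x : M, TangentSpace (𝓡 4) x →L[ℝ] TangentSpace (𝓡 4) x) : Prop where
  smooth : IsSmoothEndo J
  sq : ∀ x v, J x (J x v) = -v
  orthogonal : ∀ x (v w : TangentSpace (𝓡 4) x), ⟪J x v, J x w⟫ = ⟪v, w⟫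

/-- `(M, g, J)` is a Kähler surface: `J` is an orthogonal almost complex structure which is
parallel for the Levi-Civita connection. -/
structure IsKahler
    (J : ∀ x : M, TangentSpace (𝓡 4) x →L[ℝ] TangentSpace (𝓡 4) x) : Prop
    extends IsAlmostHermitian J where
  parallel : ∀ (X Y : ∀ x : M, TangentSpace (𝓡 4) x) (x : M),
    MDifferentiableAt (𝓡 4) (𝓡 4).tangent (fun y => (⟨y, X y⟩ : TangentBundle (𝓡 4) M)) x →
    MDifferentiableAt (𝓡 4) (𝓡 4).tangent (fun y => (⟨y, Y y⟩ : TangentBundle (𝓡 4) M)) x →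
    leviCivita X (fun y => J y (Y y)) x = J x (leviCivita X Y x)

/-- `J'` is a negative almost complex structure on `(M, g, J)`: it is orthogonal, and it defines
the orientation opposite to that of `J`. -/
structure IsNegative
    (J J' : ∀ x : M, TangentSpace (𝓡 4) x →L[ℝ] TangentSpace (𝓡 4) x) : Prop
    extends IsAlmostHermitian J' where
  opposite : ∀ x (X Y Z U : TangentSpace (𝓡 4) x),
    volForm (J' x) X Y Z U = -volForm (J x) X Y Z U

/-- `D` is a smooth two-dimensional `J`-invariant distribution. -/
structure IsInvariantDistribution
    (J : ∀ x : M, TangentSpace (𝓡 4) x →L[ℝ] TangentSpace (𝓡 4) x)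
    (D : ∀ x : M, Submodule ℝ (TangentSpace (𝓡 4) x)) : Prop where
  finrank_eq : ∀ x, Module.finrank ℝ (D x) = 2
  invariant : ∀ x, ∀ v ∈ D x, J x v ∈ D x
  /-- every vector of `D` extends to a local smooth section of `D` -/
  smooth : ∀ x, ∀ v ∈ D x, ∃ (U : Set M) (X : ∀ y : M, TangentSpace (𝓡 4) y),
    IsOpen U ∧ x ∈ U ∧ X x = v ∧ (∀ y ∈ U, X y ∈ D y) ∧
    ContMDiffOn (𝓡 4) (𝓡 4).tangent ∞ (fun y => (⟨y, X y⟩ : TangentBundle (𝓡 4) M)) U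

/-- `(M, g, J)` has quasi-constant holomorphic sectional curvature with respect to the smooth
`J`-invariant two-dimensional distribution `D`: for unit vectors `X`, the holomorphic curvature
`R(X,JX,JX,X)` depends only on the point and on the length of the projection of `X` on `D`. -/
structure IsQCH
    (J : ∀ x : M, TangentSpace (𝓡 4) x →L[ℝ] TangentSpace (𝓡 4) x)
    (D : ∀ x : M, Submodule ℝ (TangentSpace (𝓡 4) x)) : Prop
    extends IsInvariantDistribution J D where
  holomorphic : ∃ φ : M → ℝ → ℝ, ∀ (x : M) (X : TangentSpace (𝓡 4) x), ‖X‖ = 1 →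
    riemann x X (J x X) (J x X) X = φ x ‖(D x).starProjection X‖

/-- The anti-self-dual Weyl tensor `W⁻` at `x`, for the orientation of `J`. -/
def weylMinus (J : ∀ x : M, TangentSpace (𝓡 4) x →L[ℝ] TangentSpace (𝓡 4) x) (x : M) :
    TangentSpace (𝓡 4) x → TangentSpace (𝓡 4) x → TangentSpace (𝓡 4) x →
      TangentSpace (𝓡 4) x → ℝ :=
  weylMinusOf (J x) (riemann x)

/-- `J'` preserves the Ricci tensor. -/
def PreservesRicci
    (J' : ∀ x : M, TangentSpace (𝓡 4) x →L[ℝ] TangentSpace (𝓡 4) x) : Prop :=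
  ∀ x (X Y : TangentSpace (𝓡 4) x),
    ricciOf (riemann x) (J' x X) (J' x Y) = ricciOf (riemann x) X Y

/-- The scalar curvature `τ` of `(M, g)`. -/
def scalarCurvature (x : M) : ℝ := scalarOf (riemann x)

/-- The conformal scalar curvature `κ` of `(M, g, J')`, where `J'` is negative on `(M, g, J)`:
the component of `W⁻` along the fundamental form `ω'` of `J'` is `κ/6`, and `g(ω',ω') = 2`, so that
`κ = 3 g(W⁻ω', ω')`. -/
def conformalScalar
    (J J' : ∀ x : M, TangentSpace (𝓡 4) x →L[ℝ] TangentSpace (𝓡 4) x) (x : M) : ℝ :=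
  3 * formInner (formAction (weylMinus J x) (fun A B => fundForm (J' x) A B))
    (fun A B => fundForm (J' x) A B)

/-- The distribution `ker (J J' + Id)`. -/
def kerPlus (J J' : ∀ x : M, TangentSpace (𝓡 4) x →L[ℝ] TangentSpace (𝓡 4) x) (x : M) :
    Submodule ℝ (TangentSpace (𝓡 4) x) :=
  LinearMap.ker ((J x ∘L J' x + ContinuousLinearMap.id ℝ _).toLinearMap)

/-- The distribution `ker (J J' - Id)`. -/
def kerMinus (J J' : ∀ x : M, TangentSpace (𝓡 4) x →L[ℝ] TangentSpace (𝓡 4) x) (x : M) :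
    Submodule ℝ (TangentSpace (𝓡 4) x) :=
  LinearMap.ker ((J x ∘L J' x - ContinuousLinearMap.id ℝ _).toLinearMap)

end Geometry

end QCH

end

/-! Apart from smoothness, everything is linear algebra at one point. Torsion-freeness, metric
compatibility and `∇J = 0` give `R` the symmetries of a Kähler curvature tensor
(`IsKahler.riemann_kahler`), and such a tensor is determined by its holomorphic sectional curvatures
(`IsKahlerTensor.eq_zero_of_holomorphic`).

For the direct part, the holomorphic curvatures of `Π`, `Φ`, `Ψ` are `|X|⁴`, `|X|²|p_D X|²`, `|p_D
X|⁴`. If the curvature of a unit vector depends only on `s = |p_D X|`, it can be computed on `s u ±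
t v` with unit `u ∈ D`, `v ∈ E`. Averaging over the sign gives a quadratic polynomial in `s²`, so
`R` lies in the span of the three tensors (`IsKahlerTensor.eq_of_quasiConstant`). If `Ric = p g + q
h`, then `W⁻` is `R` minus the combination of `Π` and `Φ` with the same Ricci contraction
(`IsAdapted.weylMinusOf_eq`); this turns `aΠ + bΦ + cΨ` into `cK`. On `Λ⁻` the tensor `K` acts with
eigenvalues `1/3, -1/6, -1/6`, the first on the form of the opposite structure.

For the converse, reversal of orientation forces `J` and `J'` to commute, and `JJ'` is a symmetric
trace-free involution whose eigenspaces are `D` and `E` (`IsOrthComplex.negative_structure`).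
Invariance of `Ric` under `J` and `J'` gives `Ric = p g + q h`. Then `W⁻` is a symmetric trace-free
operator on the three-dimensional `Λ⁻` with a known eigenvector. Degeneracy and simplicity make it
scalar on the complement of that vector, hence a multiple of `K` (`IsKahlerWeylTensor.eq_tensorK`),
and `R` is recovered from `W⁻` and `Ric`.

Smoothness of all coefficient functions follows by reading them off holomorphic curvatures along a
smooth local frame `u, Ju, v, Jv`. -/

noncomputable section

/-! ### Germs of smooth functions and vector fields -/

namespace QCH
section
open VectorField Filter
open scoped Topology

set_option linter.unusedSectionVars false

variable {M : Type*} [TopologicalSpace M] [ChartedSpace E4 M] [IsManifold (𝓡 4) ∞ M]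

/-- Smoothness of a vector field on a neighbourhood of a point. -/
def SmoothNear (X : ∀ x : M, TangentSpace (𝓡 4) x) (x : M) : Prop :=
  ∀ᶠ y in 𝓝 x, ContMDiffAt (𝓡 4) (𝓡 4).tangent ∞
    (fun z => (⟨z, X z⟩ : TangentBundle (𝓡 4) M)) y

/-- Smoothness of a function on a neighbourhood of a point. -/
def FunSmoothNear (f : M → ℝ) (x : M) : Prop :=
  ∀ᶠ y in 𝓝 x, ContMDiffAt (𝓡 4) 𝓘(ℝ, ℝ) ∞ f y

/-- Differentiability of a vector field at a point. -/
abbrev DiffAt (X : ∀ x : M, TangentSpace (𝓡 4) x) (x : M) : Prop :=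
  MDifferentiableAt (𝓡 4) (𝓡 4).tangent (fun z => (⟨z, X z⟩ : TangentBundle (𝓡 4) M)) x

/-- Differentiability of a function at a point. -/
abbrev FunDiffAt (f : M → ℝ) (x : M) : Prop := MDifferentiableAt (𝓡 4) 𝓘(ℝ, ℝ) f x

variable {X Y Z X' Y' Z' : ∀ x : M, TangentSpace (𝓡 4) x} {f g : M → ℝ} {x : M}

lemma SmoothNear.at (h : SmoothNear X x) : ContMDiffAt (𝓡 4) (𝓡 4).tangent ∞
    (fun z => (⟨z, X z⟩ : TangentBundle (𝓡 4) M)) x := h.self_of_nhds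

lemma FunSmoothNear.at (h : FunSmoothNear f x) : ContMDiffAt (𝓡 4) 𝓘(ℝ, ℝ) ∞ f x :=
  h.self_of_nhds

lemma SmoothNear.diffAt (h : SmoothNear X x) : DiffAt X x := h.at.mdifferentiableAt (by simp)

lemma FunSmoothNear.diffAt (h : FunSmoothNear f x) : FunDiffAt f x :=
  h.at.mdifferentiableAt (by simp)

lemma SmoothNear.eventually (h : SmoothNear X x) : ∀ᶠ y in 𝓝 x, SmoothNear X y :=
  eventually_eventually_nhds.2 h

lemma FunSmoothNear.eventually (h : FunSmoothNear f x) : ∀ᶠ y in 𝓝 x, FunSmoothNear f y :=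
  eventually_eventually_nhds.2 h

lemma SmoothNear.congr (h : SmoothNear X x) (h' : X' =ᶠ[𝓝 x] X) : SmoothNear X' x := by
  filter_upwards [h, h'.eventually_nhds] with y hy hy'
  exact hy.congr_of_eventuallyEq (hy'.mono fun z hz => by simp [hz])

lemma FunSmoothNear.congr (h : FunSmoothNear f x) (h' : g =ᶠ[𝓝 x] f) : FunSmoothNear g x := by
  filter_upwards [h, h'.eventually_nhds] with y hy hy'
  exact hy.congr_of_eventuallyEq hy'

lemma smoothNear_extend (v : TangentSpace (𝓡 4) x) :
    SmoothNear (FiberBundle.extend E4 v) x := by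
  obtain ⟨s, hs, h⟩ := FiberBundle.exists_contMDiffOn_extend (k := ∞) (𝓡 4) E4 v
  filter_upwards [eventually_mem_nhds_iff.2 hs] with y hy
  exact h.contMDiffAt hy

lemma DiffAt.add (hX : DiffAt X x) (hY : DiffAt Y x) : DiffAt (fun y => X y + Y y) x :=
  mdifferentiableAt_add_section hX hY

lemma DiffAt.smul (hf : FunDiffAt f x) (hY : DiffAt Y x) : DiffAt (fun y => f y • Y y) x :=
  hf.smul_section hY

lemma SmoothNear.add (hX : SmoothNear X x) (hY : SmoothNear Y x) :
    SmoothNear (fun y => X y + Y y) x := by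
  filter_upwards [hX, hY] with y h1 h2
  exact h1.add_section h2

lemma SmoothNear.sub (hX : SmoothNear X x) (hY : SmoothNear Y x) :
    SmoothNear (fun y => X y - Y y) x := by
  filter_upwards [hX, hY] with y h1 h2
  exact h1.sub_section h2

lemma SmoothNear.smul (hf : FunSmoothNear f x) (hY : SmoothNear Y x) :
    SmoothNear (fun y => f y • Y y) x := by
  filter_upwards [hf, hY] with y h1 h2
  exact h1.smul_section h2

lemma SmoothNear.sum {ι : Type*} {s : Finset ι} {X : ι → ∀ x : M, TangentSpace (𝓡 4) x}
    (h : ∀ i ∈ s, SmoothNear (X i) x) : SmoothNear (fun y => ∑ i ∈ s, X i y) x := by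
  filter_upwards [(s.eventually_all (l := 𝓝 x)).2 h] with y hy
  exact ContMDiffAt.sum_section hy

lemma FunSmoothNear.const (c : ℝ) : FunSmoothNear (fun _ : M => c) x :=
  Eventually.of_forall fun _ => contMDiffAt_const

lemma FunSmoothNear.add (hf : FunSmoothNear f x) (hg : FunSmoothNear g x) :
    FunSmoothNear (fun y => f y + g y) x := by
  filter_upwards [hf, hg] with y h1 h2
  exact h1.add h2

lemma FunSmoothNear.sub (hf : FunSmoothNear f x) (hg : FunSmoothNear g x) :
    FunSmoothNear (fun y => f y - g y) x := by
  filter_upwards [hf, hg] with y h1 h2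
  exact h1.sub h2

lemma FunSmoothNear.mul (hf : FunSmoothNear f x) (hg : FunSmoothNear g x) :
    FunSmoothNear (fun y => f y * g y) x := by
  filter_upwards [hf, hg] with y h1 h2
  exact h1.mul h2

lemma FunSmoothNear.inv (hf : FunSmoothNear f x) (h : f x ≠ 0) :
    FunSmoothNear (fun y => (f y)⁻¹) x := by
  filter_upwards [hf, hf.at.continuousAt.eventually_ne h] with y h1 h2
  exact h1.inv₀ h2

lemma FunSmoothNear.sqrt (hf : FunSmoothNear f x) (h : f x ≠ 0) :
    FunSmoothNear (fun y => Real.sqrt (f y)) x := by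
  filter_upwards [hf, hf.at.continuousAt.eventually_ne h] with y h1 h2
  exact (Real.contDiffAt_sqrt h2).contMDiffAt.comp y h1

lemma isManifold_minSmoothness_two : IsManifold (𝓡 4) (minSmoothness ℝ 2) M :=
  IsManifold.of_le (n := ∞) (by simpa using ENat.LEInfty.out)

lemma isManifold_minSmoothness_three : IsManifold (𝓡 4) (minSmoothness ℝ 3) M :=
  IsManifold.of_le (n := ∞) (by simpa using ENat.LEInfty.out)

attribute [local instance] isManifold_minSmoothness_two isManifold_minSmoothness_three

lemma SmoothNear.lie (hX : SmoothNear X x) (hY : SmoothNear Y x) :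
    SmoothNear (mlieBracket (𝓡 4) X Y) x := by
  have : IsManifold (𝓡 4) (((⊤ : ℕ∞) : WithTop ℕ∞) + 1) M := inferInstanceAs (IsManifold (𝓡 4) ∞ M)
  filter_upwards [hX, hY] with y h1 h2
  exact ContMDiffAt.mlieBracket_vectorField (n := ⊤) (m := ⊤) h1 h2 (by simp)

variable [RiemannianBundle (fun x : M => TangentSpace (𝓡 4) x)]
  [IsContMDiffRiemannianBundle (𝓡 4) ∞ E4 (fun x : M => TangentSpace (𝓡 4) x)]

lemma isContMDiffRiemannianBundle_one :
    IsContMDiffRiemannianBundle (𝓡 4) 1 E4 (fun x : M => TangentSpace (𝓡 4) x) :=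
  IsContMDiffRiemannianBundle.of_le (n := ∞) (by simp)

attribute [local instance] isContMDiffRiemannianBundle_one

lemma DiffAt.inner (hX : DiffAt X x) (hY : DiffAt Y x) : FunDiffAt (fun y => ⟪X y, Y y⟫) x :=
  MDifferentiableAt.inner_bundle hX hY

lemma SmoothNear.inner (hX : SmoothNear X x) (hY : SmoothNear Y x) :
    FunSmoothNear (fun y => ⟪X y, Y y⟫) x := by
  filter_upwards [hX, hY] with y h1 h2
  exact ContMDiffAt.inner_bundle h1 h2

end
end QCH

/-! ### Lie brackets, derivations and tensoriality -/

namespace QCH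
section
open VectorField Filter
open scoped Topology

set_option linter.unusedSectionVars false

attribute [local instance] isManifold_minSmoothness_two isManifold_minSmoothness_three
  isContMDiffRiemannianBundle_one

variable {M : Type*} [TopologicalSpace M] [ChartedSpace E4 M] [IsManifold (𝓡 4) ∞ M]
variable {X Y Z X' Y' Z' : ∀ x : M, TangentSpace (𝓡 4) x} {f g : M → ℝ} {x : M}

lemma lie_smul_right (hf : FunDiffAt f x) (hY : DiffAt Y x) :
    mlieBracket (𝓡 4) X (fun y => f y • Y y) x =
      mvfderiv (𝓡 4) f x (X x) • Y x + f x • mlieBracket (𝓡 4) X Y x :=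
  mlieBracket_smul_right hf hY

lemma lie_smul_left (hf : FunDiffAt f x) (hX : DiffAt X x) :
    mlieBracket (𝓡 4) (fun y => f y • X y) Y x =
      -(mvfderiv (𝓡 4) f x (Y x) • X x) + f x • mlieBracket (𝓡 4) X Y x := by
  have := mlieBracket_smul_left (W := Y) hf hX
  rw [neg_smul] at this
  exact this

lemma lie_add_right (hY : DiffAt Y x) (hZ : DiffAt Z x) :
    mlieBracket (𝓡 4) X (fun y => Y y + Z y) x =
      mlieBracket (𝓡 4) X Y x + mlieBracket (𝓡 4) X Z x :=
  mlieBracket_add_right hY hZ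

lemma lie_add_left (hX : DiffAt X x) (hY : DiffAt Y x) :
    mlieBracket (𝓡 4) (fun y => X y + Y y) Z x =
      mlieBracket (𝓡 4) X Z x + mlieBracket (𝓡 4) Y Z x :=
  mlieBracket_add_left hX hY

lemma lie_swap : mlieBracket (𝓡 4) X Y x = -mlieBracket (𝓡 4) Y X x :=
  mlieBracket_swap_apply

lemma mvfderiv_congr (h : f =ᶠ[𝓝 x] g) : mvfderiv (𝓡 4) f x = mvfderiv (𝓡 4) g x := by
  ext v
  simp only [mvfderiv, ContinuousLinearMap.comp_apply]
  rw [h.mfderiv_eq]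
  rfl

lemma exists_smoothNear_ne_zero (x : M) :
    ∃ Z : ∀ x : M, TangentSpace (𝓡 4) x, SmoothNear Z x ∧ Z x ≠ 0 := by
  have : Nontrivial (TangentSpace (𝓡 4) x) := inferInstanceAs (Nontrivial E4)
  obtain ⟨v, hv⟩ := exists_ne (0 : TangentSpace (𝓡 4) x)
  exact ⟨_, smoothNear_extend v, by simpa using hv⟩

/-- Vector fields act on functions compatibly with the Lie bracket. -/
lemma mvfderiv_lie (hf : FunSmoothNear f x) (hX : SmoothNear X x) (hY : SmoothNear Y x)
    (hXf : FunDiffAt (fun y => mvfderiv (𝓡 4) f y (X y)) x)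
    (hYf : FunDiffAt (fun y => mvfderiv (𝓡 4) f y (Y y)) x) :
    mvfderiv (𝓡 4) (fun y => mvfderiv (𝓡 4) f y (Y y)) x (X x)
      - mvfderiv (𝓡 4) (fun y => mvfderiv (𝓡 4) f y (X y)) x (Y x)
      = mvfderiv (𝓡 4) f x (mlieBracket (𝓡 4) X Y x) := by
  obtain ⟨Z, hZ, hZ0⟩ := exists_smoothNear_ne_zero x
  have two {W : ∀ x : M, TangentSpace (𝓡 4) x} (h : SmoothNear W x) :
      ContMDiffAt (𝓡 4) (𝓡 4).tangent (minSmoothness ℝ 2)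
        (fun z => (⟨z, W z⟩ : TangentBundle (𝓡 4) M)) x :=
    h.at.of_le (by simpa using ENat.LEInfty.out)
  -- Jacobi's identity for `X, Y, fZ`, reduced by the one for `X, Y, Z`, leaves exactly the claim as
  -- the coefficient of `Z`, which cancels because `Z x ≠ 0`.
  have J1 := leibniz_identity_mlieBracket_apply (two hX) (two hY) (two (SmoothNear.smul hf hZ))
  have J2 := leibniz_identity_mlieBracket_apply (two hX) (two hY) (two hZ)
  have e {W : ∀ x : M, TangentSpace (𝓡 4) x} :
      mlieBracket (𝓡 4) W (fun y => f y • Z y) =ᶠ[𝓝 x]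
      fun y => mvfderiv (𝓡 4) f y (W y) • Z y + f y • mlieBracket (𝓡 4) W Z y := by
    filter_upwards [hf.eventually, hZ.eventually] with y h1 h2
    exact lie_smul_right h1.diffAt h2.diffAt
  have hl {W : ∀ x : M, TangentSpace (𝓡 4) x} (hW : SmoothNear W x) := (hW.lie hZ).diffAt
  rw [(EventuallyEq.refl _ X).mlieBracket_vectorField_eq e,
    (EventuallyEq.refl _ Y).mlieBracket_vectorField_eq e,
    lie_add_right (DiffAt.smul hYf hZ.diffAt) (DiffAt.smul hf.diffAt (hl hY)),
    lie_add_right (DiffAt.smul hXf hZ.diffAt) (DiffAt.smul hf.diffAt (hl hX)),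
    lie_smul_right hYf hZ.diffAt, lie_smul_right hXf hZ.diffAt,
    lie_smul_right hf.diffAt (hl hY), lie_smul_right hf.diffAt (hl hX),
    lie_smul_right hf.diffAt hZ.diffAt, J2] at J1
  have key : (mvfderiv (𝓡 4) (fun y => mvfderiv (𝓡 4) f y (Y y)) x (X x)
      - mvfderiv (𝓡 4) (fun y => mvfderiv (𝓡 4) f y (X y)) x (Y x)
      - mvfderiv (𝓡 4) f x (mlieBracket (𝓡 4) X Y x)) • Z x = 0 := by
    rw [sub_smul, sub_smul]
    rw [← sub_eq_zero] at J1
    rw [← J1]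
    module
  have := (smul_eq_zero.1 key).resolve_right hZ0
  linarith

/-- An operation on vector fields which is additive and homogeneous for functions smooth near `x`
depends only on the value of the field at `x`. -/
lemma eq_of_eq_at {A : Type*} [AddCommGroup A] [Module ℝ A]
    (Φ : (∀ x : M, TangentSpace (𝓡 4) x) → A)
    (hadd : ∀ X Y, SmoothNear X x → SmoothNear Y x → Φ (fun y => X y + Y y) = Φ X + Φ Y)
    (hsmul : ∀ (f : M → ℝ) X, FunSmoothNear f x → SmoothNear X x →
      Φ (fun y => f y • X y) = f x • Φ X)
    (hX : SmoothNear X x) (hY : SmoothNear Y x) (h : X x = Y x) : Φ X = Φ Y := by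
  classical
  have hzero : Φ (fun _ => 0) = 0 := by
    have := hsmul (fun _ => 0) X (FunSmoothNear.const 0) hX
    simpa using this
  have hsum : ∀ (s : Finset (Fin 4)) (W : Fin 4 → ∀ x : M, TangentSpace (𝓡 4) x),
      (∀ i, SmoothNear (W i) x) → Φ (fun y => ∑ i ∈ s, W i y) = ∑ i ∈ s, Φ (W i) := by
    intro s W hW
    induction s using Finset.induction_on with
    | empty => simpa using hzero
    | insert a s ha ih =>
      simp only [Finset.sum_insert ha]
      rw [hadd _ _ (hW a) (SmoothNear.sum fun i _ => hW i), ih]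
  have hloc {X Y : ∀ x : M, TangentSpace (𝓡 4) x} (hX : SmoothNear X x) (hY : SmoothNear Y x)
      (e : X =ᶠ[𝓝 x] Y) : Φ X = Φ Y := by
    -- The indicator of the coincidence set is identically `1` near `x`. Homogeneity is required
    -- only for functions smooth near `x`, so no bump function is needed.
    let ψ : M → ℝ := fun y => if X y = Y y then 1 else 0
    have hψ : FunSmoothNear ψ x :=
      (FunSmoothNear.const 1).congr (e.mono fun y hy => by simp [ψ, hy])
    have h1 : ψ x = 1 := by simp [ψ, e.self_of_nhds]
    have h2 : (fun y => ψ y • X y) = fun y => ψ y • Y y := by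
      funext y
      by_cases hy : X y = Y y <;> simp [ψ, hy]
    have h3 := hsmul ψ X hψ hX
    have h4 := hsmul ψ Y hψ hY
    rw [h1, one_smul] at h3 h4
    rw [← h3, ← h4, h2]
  let t := trivializationAt E4 (TangentSpace (𝓡 4) (M := M)) x
  have hx : x ∈ t.baseSet := FiberBundle.mem_baseSet_trivializationAt' x
  let b := (EuclideanSpace.basisFun (Fin 4) ℝ).toBasis
  let s := t.localFrame b
  let c := t.localFrameCoeff (𝓡 4) b
  have hbs : ∀ᶠ y in 𝓝 x, y ∈ t.baseSet := t.open_baseSet.mem_nhds hx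
  have hs (i) : SmoothNear (s i) x := by
    filter_upwards [hbs] with y hy
    exact contMDiffAt_localFrame_of_mem ∞ t b i hy
  have hc {W : ∀ x : M, TangentSpace (𝓡 4) x} (hW : SmoothNear W x) (i) :
      FunSmoothNear (fun y => c i y (W y)) x := by
    filter_upwards [hbs, hW] with y hy hy'
    exact contMDiffAt_localFrameCoeff (k := ∞) b hy hy' i
  -- The frame expansion holds only on the base set, which is why locality came first. The
  -- coefficients at `x` see only `W x`.
  have expand {W : ∀ x : M, TangentSpace (𝓡 4) x} (hW : SmoothNear W x) :
      Φ W = ∑ i, c i x (W x) • Φ (s i) := by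
    rw [hloc hW (SmoothNear.sum (s := Finset.univ) fun i _ => SmoothNear.smul (hc hW i) (hs i))
      (t.eventually_eq_localFrame_sum_coeff_smul b hx), hsum _ _ fun i =>
        SmoothNear.smul (hc hW i) (hs i)]
    exact Finset.sum_congr rfl fun i _ => hsmul _ _ (hc hW i) (hs i)
  rw [expand hX, expand hY, h]

variable [RiemannianBundle (fun x : M => TangentSpace (𝓡 4) x)]
  [IsContMDiffRiemannianBundle (𝓡 4) ∞ E4 (fun x : M => TangentSpace (𝓡 4) x)]

/-- For an auxiliary field `Z` with `Z x ≠ 0`, the derivative of `f` along `X` equals `⟪[X, fZ] -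
f[X, Z], Z⟫ / ⟪Z, Z⟫` near `x`, so its smoothness is inherited from brackets and the metric. -/
lemma FunSmoothNear.mvfderiv (hf : FunSmoothNear f x) (hX : SmoothNear X x) :
    FunSmoothNear (fun y => mvfderiv (𝓡 4) f y (X y)) x := by
  obtain ⟨Z, hZ, hZ0⟩ := exists_smoothNear_ne_zero x
  have h1 := ((hX.lie (SmoothNear.smul hf hZ)).sub (SmoothNear.smul hf (hX.lie hZ))).inner hZ
  have hzz : ⟪Z x, Z x⟫ ≠ 0 := inner_self_ne_zero.2 hZ0
  refine (h1.mul ((hZ.inner hZ).inv hzz)).congr ?_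
  filter_upwards [hf.eventually, hZ.eventually,
    (hZ.inner hZ).at.continuousAt.eventually_ne hzz] with y h1 h2 h3
  rw [lie_smul_right h1.diffAt h2.diffAt, add_sub_cancel_right, inner_smul_left]
  simp only [conj_trivial]
  field_simp

/-- Vector fields act on functions compatibly with the Lie bracket. -/
lemma mvfderiv_commutator (hf : FunSmoothNear f x) (hX : SmoothNear X x) (hY : SmoothNear Y x) :
    mvfderiv (𝓡 4) (fun y => mvfderiv (𝓡 4) f y (Y y)) x (X x)
      - mvfderiv (𝓡 4) (fun y => mvfderiv (𝓡 4) f y (X y)) x (Y x)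
      = mvfderiv (𝓡 4) f x (mlieBracket (𝓡 4) X Y x) :=
  mvfderiv_lie hf hX hY (hf.mvfderiv hX).diffAt (hf.mvfderiv hY).diffAt

end
end QCH

/-! ### The Levi-Civita connection from Koszul's formula -/

namespace QCH
section
open VectorField Filter
open scoped Topology

set_option linter.unusedSectionVars false

attribute [local instance] isManifold_minSmoothness_two isManifold_minSmoothness_three
  isContMDiffRiemannianBundle_one

variable {M : Type*} [TopologicalSpace M] [ChartedSpace E4 M] [IsManifold (𝓡 4) ∞ M]
  [RiemannianBundle (fun x : M => TangentSpace (𝓡 4) x)]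
  [IsContMDiffRiemannianBundle (𝓡 4) ∞ E4 (fun x : M => TangentSpace (𝓡 4) x)]
variable {X Y Z X' Y' Z' : ∀ x : M, TangentSpace (𝓡 4) x} {f g : M → ℝ} {x : M}

lemma mvfderiv_mul_apply (hf : FunDiffAt f x) (hg : FunDiffAt g x) (v : TangentSpace (𝓡 4) x) :
    mvfderiv (𝓡 4) (fun y => f y * g y) x v =
      f x * mvfderiv (𝓡 4) g x v + g x * mvfderiv (𝓡 4) f x v := by
  simp [mvfderiv_fun_mul hf hg]

lemma mvfderiv_add_apply (hf : FunDiffAt f x) (hg : FunDiffAt g x) (v : TangentSpace (𝓡 4) x) :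
    mvfderiv (𝓡 4) (fun y => f y + g y) x v =
      mvfderiv (𝓡 4) f x v + mvfderiv (𝓡 4) g x v := by
  simp [mvfderiv_fun_add hf hg]

lemma koszul_congr (hX : X' =ᶠ[𝓝 x] X) (hY : Y' =ᶠ[𝓝 x] Y) (hZ : Z' =ᶠ[𝓝 x] Z) :
    koszul X' Y' Z' x = koszul X Y Z x := by
  have inner_eq {A A' B B' : ∀ x : M, TangentSpace (𝓡 4) x} (hA : A' =ᶠ[𝓝 x] A)
      (hB : B' =ᶠ[𝓝 x] B) : (fun y => ⟪A' y, B' y⟫) =ᶠ[𝓝 x] fun y => ⟪A y, B y⟫ := by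
    filter_upwards [hA, hB] with y h1 h2
    rw [h1, h2]
  simp only [koszul, mvfderiv_congr (inner_eq hY hZ), mvfderiv_congr (inner_eq hX hZ),
    mvfderiv_congr (inner_eq hX hY), hX.mlieBracket_vectorField_eq hY,
    hX.mlieBracket_vectorField_eq hZ, hY.mlieBracket_vectorField_eq hZ, hX.self_of_nhds,
    hY.self_of_nhds, hZ.self_of_nhds]

lemma koszul_add_third (hX : DiffAt X x) (hY : DiffAt Y x) (hZ : DiffAt Z x) (hZ' : DiffAt Z' x) :
    koszul X Y (fun y => Z y + Z' y) x = koszul X Y Z x + koszul X Y Z' x := by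
  simp only [koszul, inner_add_right, lie_add_right hZ hZ', map_add, inner_add_left,
    mvfderiv_add_apply (hY.inner hZ) (hY.inner hZ'), mvfderiv_add_apply (hX.inner hZ) (hX.inner hZ')]
  ring

lemma koszul_smul_third (hX : DiffAt X x) (hY : DiffAt Y x) (hf : FunDiffAt f x)
    (hZ : DiffAt Z x) : koszul X Y (fun y => f y • Z y) x = f x * koszul X Y Z x := by
  simp only [koszul, inner_smul_right, lie_smul_right hf hZ, map_smul, inner_smul_left,
    inner_add_left, smul_eq_mul, conj_trivial,
    mvfderiv_mul_apply hf (hY.inner hZ), mvfderiv_mul_apply hf (hX.inner hZ)]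
  rw [real_inner_comm (Z x) (Y x), real_inner_comm (Z x) (X x)]
  ring

/-- Koszul's formula. -/
lemma inner_leviCivita (hX : DiffAt X x) (hY : DiffAt Y x) (hZ : DiffAt Z x) :
    ⟪leviCivita X Y x, Z x⟫ = koszul X Y Z x := by
  -- `leviCivita` tests only against chosen extensions of basis vectors; tensoriality in the third
  -- slot replaces them by an arbitrary field `Z`.
  have T : TensorialAt (𝓡 4) E4 (fun W => koszul X Y W x) x :=
    ⟨fun hf hW => koszul_smul_third hX hY hf hW, fun hW hW' => koszul_add_third hX hY hW hW'⟩
  rw [← TensorialAt.mkHom_apply T hZ]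
  conv_rhs => rw [← (stdOrthonormalBasis ℝ (TangentSpace (𝓡 4) x)).sum_repr' (Z x)]
  rw [map_sum]
  simp only [leviCivita, sum_inner, map_smul, TensorialAt.mkHom_apply_eq_extend, inner_smul_left,
    conj_trivial, smul_eq_mul]
  exact Finset.sum_congr rfl fun i _ => mul_comm _ _

lemma ext_inner_extend {v w : TangentSpace (𝓡 4) x}
    (h : ∀ Z : ∀ x : M, TangentSpace (𝓡 4) x, SmoothNear Z x → ⟪v, Z x⟫ = ⟪w, Z x⟫) : v = w := by
  refine ext_inner_right ℝ fun u => ?_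
  simpa using h _ (smoothNear_extend u)

lemma leviCivita_congr (hX : X' =ᶠ[𝓝 x] X) (hY : Y' =ᶠ[𝓝 x] Y) :
    leviCivita X' Y' x = leviCivita X Y x := by
  simp only [leviCivita]
  exact Finset.sum_congr rfl fun i _ => congrArg (· • _) (koszul_congr hX hY (EventuallyEq.refl _ _))

lemma leviCivita_add_right (hX : DiffAt X x) (hY : DiffAt Y x) (hZ : DiffAt Z x) :
    leviCivita X (fun y => Y y + Z y) x = leviCivita X Y x + leviCivita X Z x := by
  refine ext_inner_extend fun W hW => ?_
  have hW := hW.diffAt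
  rw [inner_add_left, inner_leviCivita hX (hY.add hZ) hW, inner_leviCivita hX hY hW,
    inner_leviCivita hX hZ hW]
  simp only [koszul, inner_add_left, inner_add_right, lie_add_right hY hZ, lie_add_left hY hZ,
    mvfderiv_add_apply (hY.inner hW) (hZ.inner hW), mvfderiv_add_apply (hX.inner hY) (hX.inner hZ),
    map_add]
  ring

lemma leviCivita_add_left (hX : DiffAt X x) (hY : DiffAt Y x) (hZ : DiffAt Z x) :
    leviCivita (fun y => X y + Y y) Z x = leviCivita X Z x + leviCivita Y Z x := by
  refine ext_inner_extend fun W hW => ?_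
  have hW := hW.diffAt
  rw [inner_add_left, inner_leviCivita (hX.add hY) hZ hW, inner_leviCivita hX hZ hW,
    inner_leviCivita hY hZ hW]
  simp only [koszul, inner_add_left, inner_add_right, lie_add_left hX hY,
    mvfderiv_add_apply (hX.inner hW) (hY.inner hW), mvfderiv_add_apply (hX.inner hZ) (hY.inner hZ),
    map_add]
  ring

lemma leviCivita_smul_left (hf : FunDiffAt f x) (hX : DiffAt X x) (hY : DiffAt Y x) :
    leviCivita (fun y => f y • X y) Y x = f x • leviCivita X Y x := by
  refine ext_inner_extend fun W hW => ?_
  have hW := hW.diffAt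
  rw [real_inner_smul_left, inner_leviCivita (hX.smul hf) hY hW, inner_leviCivita hX hY hW]
  simp only [koszul, real_inner_smul_left, real_inner_smul_right, lie_smul_left hf hX,
    mvfderiv_mul_apply hf (hX.inner hW), mvfderiv_mul_apply hf (hX.inner hY),
    map_smul, inner_add_left, inner_neg_left, smul_eq_mul]
  ring

lemma leviCivita_smul_right (hf : FunDiffAt f x) (hX : DiffAt X x) (hY : DiffAt Y x) :
    leviCivita X (fun y => f y • Y y) x
      = mvfderiv (𝓡 4) f x (X x) • Y x + f x • leviCivita X Y x := by
  refine ext_inner_extend fun W hW => ?_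
  have hW := hW.diffAt
  rw [inner_add_left, real_inner_smul_left, real_inner_smul_left, inner_leviCivita hX (hY.smul hf) hW,
    inner_leviCivita hX hY hW]
  simp only [koszul, real_inner_smul_left, real_inner_smul_right, lie_smul_left hf hY,
    lie_smul_right hf hY,
    mvfderiv_mul_apply hf (hX.inner hY), mvfderiv_mul_apply hf (hY.inner hW),
    map_smul, inner_add_left, inner_neg_left, smul_eq_mul]
  rw [real_inner_comm (X x) (Y x)]
  ring

/-- The Levi-Civita connection is torsion-free. -/
lemma leviCivita_sub_swap (hX : DiffAt X x) (hY : DiffAt Y x) :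
    leviCivita X Y x - leviCivita Y X x = mlieBracket (𝓡 4) X Y x := by
  refine ext_inner_extend fun W hW => ?_
  have hW := hW.diffAt
  rw [inner_sub_left, inner_leviCivita hX hY hW, inner_leviCivita hY hX hW]
  have h : (fun y => ⟪Y y, X y⟫) = fun y => ⟪X y, Y y⟫ := by
    funext y; exact real_inner_comm _ _
  simp only [koszul, lie_swap (X := Y) (Y := X), inner_neg_left, h]
  ring

/-- The Levi-Civita connection is compatible with the metric. -/
lemma mvfderiv_inner (hX : DiffAt X x) (hY : DiffAt Y x) (hZ : DiffAt Z x) :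
    mvfderiv (𝓡 4) (fun y => ⟪Y y, Z y⟫) x (X x)
      = ⟪leviCivita X Y x, Z x⟫ + ⟪Y x, leviCivita X Z x⟫ := by
  rw [real_inner_comm _ (Y x), inner_leviCivita hX hY hZ, inner_leviCivita hX hZ hY]
  have h : (fun y => ⟪Z y, Y y⟫) = fun y => ⟪Y y, Z y⟫ := by
    funext y; exact real_inner_comm _ _
  simp only [koszul, lie_swap (X := Z) (Y := Y), inner_neg_left, h]
  ring

lemma FunSmoothNear.koszul (hX : SmoothNear X x) (hY : SmoothNear Y x) (hZ : SmoothNear Z x) :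
    FunSmoothNear (koszul X Y Z) x := by
  have h1 := (hY.inner hZ).mvfderiv hX
  have h2 := (hX.inner hZ).mvfderiv hY
  have h3 := (hX.inner hY).mvfderiv hZ
  have h4 := (hX.lie hY).inner hZ
  have h5 := (hX.lie hZ).inner hY
  have h6 := (hY.lie hZ).inner hX
  exact (FunSmoothNear.const (1 / 2)).mul (((((h1.add h2).sub h3).add h4).sub h5).sub h6)

open InnerProductSpace in
/-- Every point has a neighbourhood with a smooth orthonormal frame. -/
lemma exists_orthonormal_frame (x : M) :
    ∃ F : Fin 4 → ∀ x : M, TangentSpace (𝓡 4) x, (∀ i, SmoothNear (F i) x) ∧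
      ∀ᶠ y in 𝓝 x, Orthonormal ℝ (fun i => F i y) := by
  let t := trivializationAt E4 (TangentSpace (𝓡 4) (M := M)) x
  have hx : x ∈ t.baseSet := FiberBundle.mem_baseSet_trivializationAt' x
  let b := (EuclideanSpace.basisFun (Fin 4) ℝ).toBasis
  let s := t.localFrame b
  have hbs : ∀ᶠ y in 𝓝 x, y ∈ t.baseSet := t.open_baseSet.mem_nhds hx
  have hs (i) : SmoothNear (s i) x := by
    filter_upwards [hbs] with y hy
    exact contMDiffAt_localFrame_of_mem ∞ t b i hy
  have hli (y : M) (hy : y ∈ t.baseSet) : LinearIndependent ℝ (fun i => s i y) :=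
    (t.isLocalFrameOn_localFrame_baseSet (𝓡 4) 1 b).linearIndependent hy
  let G : Fin 4 → ∀ x : M, TangentSpace (𝓡 4) x := fun i y => gramSchmidt ℝ (fun i => s i y) i
  have hne (i) (y : M) (hy : y ∈ t.baseSet) : G i y ≠ 0 := gramSchmidt_ne_zero i (hli y hy)
  have hinv {i} (hi : SmoothNear (G i) x) : FunSmoothNear (fun y => (⟪G i y, G i y⟫)⁻¹) x :=
    (hi.inner hi).inv (inner_self_ne_zero.2 (hne i x hx))
  have hG (i) : SmoothNear (G i) x := by
    -- Each Gram–Schmidt vector is a smooth expression in the local frame and the earlier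
    -- Gram–Schmidt vectors; the denominators do not vanish on the base set.
    induction i using WellFoundedLT.induction with
    | ind i ih =>
      refine ((hs i).sub (SmoothNear.sum (s := Finset.Iio i) (X := fun j y =>
        (⟪G j y, s i y⟫ * (⟪G j y, G j y⟫)⁻¹) • G j y) fun j hj => ?_)).congr ?_
      · have hj := ih j (Finset.mem_Iio.1 hj)
        exact SmoothNear.smul ((hj.inner (hs i)).mul (hinv hj)) hj
      · refine Eventually.of_forall fun y => ?_
        simp only [G]
        rw [gramSchmidt_def]
        simp only [Submodule.starProjection_singleton, real_inner_self_eq_norm_sq]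
        rfl
  refine ⟨fun i y => (Real.sqrt (⟪G i y, G i y⟫))⁻¹ • G i y, fun i => ?_, ?_⟩
  · have h0 : ⟪G i x, G i x⟫ ≠ 0 := inner_self_ne_zero.2 (hne i x hx)
    refine SmoothNear.smul ((((hG i).inner (hG i)).sqrt h0).inv ?_) (hG i)
    rw [← norm_eq_sqrt_real_inner]
    exact norm_ne_zero_iff.2 (hne i x hx)
  · filter_upwards [hbs] with y hy
    have := gramSchmidtNormed_orthonormal (hli y hy)
    convert this using 2 with i
    simp [G, gramSchmidtNormed]

lemma finrank_tangentSpace (x : M) : Module.finrank ℝ (TangentSpace (𝓡 4) x) = 4 := by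
  change Module.finrank ℝ E4 = 4
  simp

lemma exists_orthonormalBasis_eq {y : M} {F : Fin 4 → TangentSpace (𝓡 4) y}
    (h : Orthonormal ℝ F) : ∃ b : OrthonormalBasis (Fin 4) ℝ (TangentSpace (𝓡 4) y), ⇑b = F :=
  ⟨OrthonormalBasis.mk h (by
    rw [(linearIndependent_of_ne_zero_of_inner_eq_zero (𝕜 := ℝ) (fun i => h.ne_zero i)
      h.2).span_eq_top_of_card_eq_finrank (by simp [finrank_tangentSpace])]), by simp⟩

/-- The orthonormal basis in the definition of `leviCivita` is chosen point by point, without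
continuity. Near `x` it can be traded for a smooth orthonormal frame, in which the components are
Koszul expressions. -/
lemma SmoothNear.leviCivita (hX : SmoothNear X x) (hY : SmoothNear Y x) :
    SmoothNear (leviCivita X Y) x := by
  obtain ⟨F, hF, ho⟩ := exists_orthonormal_frame x
  refine (SmoothNear.sum (s := Finset.univ) fun i _ =>
    SmoothNear.smul (FunSmoothNear.koszul hX hY (hF i)) (hF i)).congr ?_
  filter_upwards [ho, hX.eventually, hY.eventually, eventually_all.2 fun i => (hF i).eventually]
    with y hy h1 h2 h3
  obtain ⟨b, hb⟩ := exists_orthonormalBasis_eq hy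
  rw [← b.sum_repr' (QCH.leviCivita X Y y)]
  refine Finset.sum_congr rfl fun i _ => ?_
  rw [real_inner_comm, hb]
  congr 1
  exact inner_leviCivita h1.diffAt h2.diffAt (h3 i).diffAt

end
end QCH

/-! ### Symmetries of the Riemann tensor -/

namespace QCH
section
open VectorField Filter
open scoped Topology

set_option linter.unusedSectionVars false

attribute [local instance] isManifold_minSmoothness_two isManifold_minSmoothness_three
  isContMDiffRiemannianBundle_one

variable {M : Type*} [TopologicalSpace M] [ChartedSpace E4 M] [IsManifold (𝓡 4) ∞ M]
  [RiemannianBundle (fun x : M => TangentSpace (𝓡 4) x)]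
  [IsContMDiffRiemannianBundle (𝓡 4) ∞ E4 (fun x : M => TangentSpace (𝓡 4) x)]
variable {X Y Z W X' Y' Z' : ∀ x : M, TangentSpace (𝓡 4) x} {f g : M → ℝ} {x : M}

lemma leviCivita_sub_right (hX : DiffAt X x) (hY : DiffAt Y x) (hZ : DiffAt Z x) :
    leviCivita X (fun y => Y y - Z y) x = leviCivita X Y x - leviCivita X Z x := by
  have h : DiffAt (fun y => Y y - Z y) x := mdifferentiableAt_sub_section hY hZ
  rw [eq_sub_iff_add_eq, ← leviCivita_add_right hX h hZ]
  simp

lemma leviCivita_sub_left (hX : DiffAt X x) (hY : DiffAt Y x) (hZ : DiffAt Z x) :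
    leviCivita (fun y => X y - Y y) Z x = leviCivita X Z x - leviCivita Y Z x := by
  have h : DiffAt (fun y => X y - Y y) x := mdifferentiableAt_sub_section hX hY
  rw [eq_sub_iff_add_eq, ← leviCivita_add_left h hY hZ]
  simp

lemma curvatureField_swap (hX : SmoothNear X x) (hY : SmoothNear Y x) (hZ : SmoothNear Z x) :
    curvatureField X Y Z x = -curvatureField Y X Z x := by
  have h : mlieBracket (𝓡 4) X Y = fun y => (-1 : ℝ) • mlieBracket (𝓡 4) Y X y := by
    funext y
    rw [lie_swap, neg_one_smul]
  rw [curvatureField, curvatureField, h, leviCivita_smul_left mdifferentiableAt_const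
    (hY.lie hX).diffAt hZ.diffAt]
  module

lemma curvatureField_add_first (hX : SmoothNear X x) (hX' : SmoothNear X' x)
    (hY : SmoothNear Y x) (hZ : SmoothNear Z x) :
    curvatureField (fun y => X y + X' y) Y Z x =
      curvatureField X Y Z x + curvatureField X' Y Z x := by
  have h1 : leviCivita (fun y => X y + X' y) Z =ᶠ[𝓝 x]
      fun y => leviCivita X Z y + leviCivita X' Z y := by
    filter_upwards [hX.eventually, hX'.eventually, hZ.eventually] with y h1 h2 h3
    exact leviCivita_add_left h1.diffAt h2.diffAt h3.diffAt
  have h2 : mlieBracket (𝓡 4) (fun y => X y + X' y) Y =ᶠ[𝓝 x]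
      fun y => mlieBracket (𝓡 4) X Y y + mlieBracket (𝓡 4) X' Y y := by
    filter_upwards [hX.eventually, hX'.eventually] with y h1 h2
    exact lie_add_left h1.diffAt h2.diffAt
  simp only [curvatureField]
  rw [leviCivita_congr (EventuallyEq.refl _ Y) h1, leviCivita_congr h2 (EventuallyEq.refl _ Z),
    leviCivita_add_left hX.diffAt hX'.diffAt (hY.leviCivita hZ).diffAt,
    leviCivita_add_right hY.diffAt (hX.leviCivita hZ).diffAt (hX'.leviCivita hZ).diffAt,
    leviCivita_add_left (hX.lie hY).diffAt (hX'.lie hY).diffAt hZ.diffAt]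
  module

/-- The derivative of `f` along `Y` enters through `∇_Y (f ∇_X Z)` and through `[fX, Y]`, and the
two contributions cancel. -/
lemma curvatureField_smul_first (hf : FunSmoothNear f x) (hX : SmoothNear X x)
    (hY : SmoothNear Y x) (hZ : SmoothNear Z x) :
    curvatureField (fun y => f y • X y) Y Z x = f x • curvatureField X Y Z x := by
  have h1 : leviCivita (fun y => f y • X y) Z =ᶠ[𝓝 x] fun y => f y • leviCivita X Z y := by
    filter_upwards [hf.eventually, hX.eventually, hZ.eventually] with y h1 h2 h3
    exact leviCivita_smul_left h1.diffAt h2.diffAt h3.diffAt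
  have h2 : mlieBracket (𝓡 4) (fun y => f y • X y) Y =ᶠ[𝓝 x]
      fun y => f y • mlieBracket (𝓡 4) X Y y - mvfderiv (𝓡 4) f y (Y y) • X y := by
    filter_upwards [hf.eventually, hX.eventually] with y h1 h2
    rw [lie_smul_left h1.diffAt h2.diffAt]
    exact neg_add_eq_sub _ _
  simp only [curvatureField]
  rw [leviCivita_congr (EventuallyEq.refl _ Y) h1, leviCivita_congr h2 (EventuallyEq.refl _ Z),
    leviCivita_smul_left hf.diffAt hX.diffAt (hY.leviCivita hZ).diffAt,
    leviCivita_smul_right hf.diffAt hY.diffAt (hX.leviCivita hZ).diffAt,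
    leviCivita_sub_left ((hX.lie hY).diffAt.smul hf.diffAt)
      (hX.diffAt.smul (hf.mvfderiv hY).diffAt) hZ.diffAt,
    leviCivita_smul_left hf.diffAt (hX.lie hY).diffAt hZ.diffAt,
    leviCivita_smul_left (hf.mvfderiv hY).diffAt hX.diffAt hZ.diffAt]
  module

lemma curvatureField_add_third (hX : SmoothNear X x) (hY : SmoothNear Y x)
    (hZ : SmoothNear Z x) (hZ' : SmoothNear Z' x) :
    curvatureField X Y (fun y => Z y + Z' y) x =
      curvatureField X Y Z x + curvatureField X Y Z' x := by
  have e {A : ∀ x : M, TangentSpace (𝓡 4) x} (hA : SmoothNear A x) :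
      leviCivita A (fun y => Z y + Z' y) =ᶠ[𝓝 x]
        fun y => leviCivita A Z y + leviCivita A Z' y := by
    filter_upwards [hA.eventually, hZ.eventually, hZ'.eventually] with y h1 h2 h3
    exact leviCivita_add_right h1.diffAt h2.diffAt h3.diffAt
  simp only [curvatureField]
  rw [leviCivita_congr (EventuallyEq.refl _ X) (e hY), leviCivita_congr (EventuallyEq.refl _ Y) (e hX),
    leviCivita_add_right hX.diffAt (hY.leviCivita hZ).diffAt (hY.leviCivita hZ').diffAt,
    leviCivita_add_right hY.diffAt (hX.leviCivita hZ).diffAt (hX.leviCivita hZ').diffAt,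
    leviCivita_add_right (hX.lie hY).diffAt hZ.diffAt hZ'.diffAt]
  module

/-- First-order terms in `f` cancel in pairs, and the second-order ones combine to `XYf - YXf -
[X,Y]f = 0`, which is `mvfderiv_commutator`. -/
lemma curvatureField_smul_third (hf : FunSmoothNear f x) (hX : SmoothNear X x)
    (hY : SmoothNear Y x) (hZ : SmoothNear Z x) :
    curvatureField X Y (fun y => f y • Z y) x = f x • curvatureField X Y Z x := by
  have e {A : ∀ x : M, TangentSpace (𝓡 4) x} (hA : SmoothNear A x) :
      leviCivita A (fun y => f y • Z y) =ᶠ[𝓝 x]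
        fun y => mvfderiv (𝓡 4) f y (A y) • Z y + f y • leviCivita A Z y := by
    filter_upwards [hA.eventually, hf.eventually, hZ.eventually] with y h1 h2 h3
    exact leviCivita_smul_right h2.diffAt h1.diffAt h3.diffAt
  simp only [curvatureField]
  rw [leviCivita_congr (EventuallyEq.refl _ X) (e hY), leviCivita_congr (EventuallyEq.refl _ Y) (e hX),
    leviCivita_add_right hX.diffAt (hZ.diffAt.smul (hf.mvfderiv hY).diffAt)
      ((hY.leviCivita hZ).diffAt.smul hf.diffAt),
    leviCivita_add_right hY.diffAt (hZ.diffAt.smul (hf.mvfderiv hX).diffAt)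
      ((hX.leviCivita hZ).diffAt.smul hf.diffAt),
    leviCivita_smul_right (hf.mvfderiv hY).diffAt hX.diffAt hZ.diffAt,
    leviCivita_smul_right (hf.mvfderiv hX).diffAt hY.diffAt hZ.diffAt,
    leviCivita_smul_right hf.diffAt hX.diffAt (hY.leviCivita hZ).diffAt,
    leviCivita_smul_right hf.diffAt hY.diffAt (hX.leviCivita hZ).diffAt,
    leviCivita_smul_right hf.diffAt (hX.lie hY).diffAt hZ.diffAt,
    ← mvfderiv_commutator hf hX hY]
  module

/-- The curvature at a point depends only on the values of the vector fields at that point. -/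
lemma curvatureField_congr (hX : SmoothNear X x) (hX' : SmoothNear X' x) (hY : SmoothNear Y x)
    (hY' : SmoothNear Y' x) (hZ : SmoothNear Z x) (hZ' : SmoothNear Z' x)
    (eX : X x = X' x) (eY : Y x = Y' x) (eZ : Z x = Z' x) :
    curvatureField X Y Z x = curvatureField X' Y' Z' x := by
  have first {X X' Y : ∀ x : M, TangentSpace (𝓡 4) x} (hX : SmoothNear X x)
      (hX' : SmoothNear X' x) (hY : SmoothNear Y x) (eX : X x = X' x) :
      curvatureField X Y Z x = curvatureField X' Y Z x :=
    eq_of_eq_at (fun A => curvatureField A Y Z x)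
      (fun A B hA hB => curvatureField_add_first hA hB hY hZ)
      (fun f A hf hA => curvatureField_smul_first hf hA hY hZ) hX hX' eX
  calc curvatureField X Y Z x = curvatureField X' Y Z x := first hX hX' hY eX
    _ = curvatureField X' Y' Z x := by
      -- The second slot reduces to the first by antisymmetry.
      rw [curvatureField_swap hX' hY hZ, first hY hY' hX' eY, ← curvatureField_swap hX' hY' hZ]
    _ = curvatureField X' Y' Z' x :=
      eq_of_eq_at (fun A => curvatureField X' Y' A x)
        (fun A B hA hB => curvatureField_add_third hX' hY' hA hB)
        (fun f A hf hA => curvatureField_smul_third hf hX' hY' hA) hZ hZ' eZ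

lemma riemann_apply (hX : SmoothNear X x) (hY : SmoothNear Y x) (hZ : SmoothNear Z x)
    (w : TangentSpace (𝓡 4) x) :
    riemann x (X x) (Y x) (Z x) w = ⟪curvatureField X Y Z x, w⟫ := by
  rw [riemann, curvatureField_congr (smoothNear_extend _) hX (smoothNear_extend _) hY
    (smoothNear_extend _) hZ (by simp) (by simp) (by simp)]

/-- The first Bianchi identity. -/
lemma curvatureField_bianchi (hX : SmoothNear X x) (hY : SmoothNear Y x) (hZ : SmoothNear Z x) :
    curvatureField X Y Z x + curvatureField Y Z X x + curvatureField Z X Y x = 0 := by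
  have two {W : ∀ x : M, TangentSpace (𝓡 4) x} (h : SmoothNear W x) :
      ContMDiffAt (𝓡 4) (𝓡 4).tangent (minSmoothness ℝ 2)
        (fun z => (⟨z, W z⟩ : TangentBundle (𝓡 4) M)) x :=
    h.at.of_le (by simpa using ENat.LEInfty.out)
  -- Torsion-freeness, used twice, collapses these three terms to an iterated bracket. The cyclic
  -- sum of curvatures thereby becomes Jacobi's identity.
  have e {A B C : ∀ x : M, TangentSpace (𝓡 4) x} (hA : SmoothNear A x) (hB : SmoothNear B x)
      (hC : SmoothNear C x) :
      leviCivita A (leviCivita B C) x - leviCivita A (leviCivita C B) x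
        - leviCivita (mlieBracket (𝓡 4) B C) A x
        = mlieBracket (𝓡 4) A (mlieBracket (𝓡 4) B C) x := by
    rw [← leviCivita_sub_right hA.diffAt (hB.leviCivita hC).diffAt (hC.leviCivita hB).diffAt,
      ← leviCivita_sub_swap hA.diffAt (hB.lie hC).diffAt]
    congr 1
    refine leviCivita_congr (EventuallyEq.refl _ A) ?_
    filter_upwards [hB.eventually, hC.eventually] with y h1 h2
    exact leviCivita_sub_swap h1.diffAt h2.diffAt
  have h1 := e hX hY hZ
  have h2 := e hY hZ hX
  have h3 := e hZ hX hY
  have J := leibniz_identity_mlieBracket_apply (two hX) (two hY) (two hZ)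
  have s1 : mlieBracket (𝓡 4) (mlieBracket (𝓡 4) X Y) Z x
      = -mlieBracket (𝓡 4) Z (mlieBracket (𝓡 4) X Y) x := lie_swap
  have s2 : mlieBracket (𝓡 4) Y (mlieBracket (𝓡 4) X Z) x
      = -mlieBracket (𝓡 4) Y (mlieBracket (𝓡 4) Z X) x := by
    have h : mlieBracket (𝓡 4) X Z = fun y => (-1 : ℝ) • mlieBracket (𝓡 4) Z X y := by
      funext y
      rw [lie_swap, neg_one_smul]
    rw [h, lie_smul_right mdifferentiableAt_const (hZ.lie hX).diffAt]
    simp [mvfderiv_const]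
  rw [s1, s2] at J
  simp only [curvatureField]
  have : mlieBracket (𝓡 4) X (mlieBracket (𝓡 4) Y Z) x
    + mlieBracket (𝓡 4) Y (mlieBracket (𝓡 4) Z X) x
    + mlieBracket (𝓡 4) Z (mlieBracket (𝓡 4) X Y) x = 0 := by
    rw [J]; module
  rw [← h1, ← h2, ← h3] at this
  rw [← this]
  module

/-- The function `⟪Z, W⟫` is differentiated by the commutator of `X` and `Y` and by `[X, Y]`. Metric
compatibility expands both; the mixed products of first derivatives cancel. -/
lemma inner_curvatureField_antisymm (hX : SmoothNear X x) (hY : SmoothNear Y x)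
    (hZ : SmoothNear Z x) (hW : SmoothNear W x) :
    ⟪curvatureField X Y Z x, W x⟫ = -⟪Z x, curvatureField X Y W x⟫ := by
  have e {A : ∀ x : M, TangentSpace (𝓡 4) x} (hA : SmoothNear A x) :
      (fun y => mvfderiv (𝓡 4) (fun z => ⟪Z z, W z⟫) y (A y)) =ᶠ[𝓝 x]
        fun y => ⟪leviCivita A Z y, W y⟫ + ⟪Z y, leviCivita A W y⟫ := by
    filter_upwards [hA.eventually, hZ.eventually, hW.eventually] with y h1 h2 h3
    exact mvfderiv_inner h1.diffAt h2.diffAt h3.diffAt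
  have h := mvfderiv_commutator (hZ.inner hW) hX hY
  rw [mvfderiv_congr (e hX), mvfderiv_congr (e hY),
    mvfderiv_add_apply ((hX.leviCivita hZ).inner hW).diffAt (hZ.inner (hX.leviCivita hW)).diffAt,
    mvfderiv_add_apply ((hY.leviCivita hZ).inner hW).diffAt (hZ.inner (hY.leviCivita hW)).diffAt,
    mvfderiv_inner (hX := hX.diffAt) (hY.leviCivita hZ).diffAt hW.diffAt,
    mvfderiv_inner (hX := hX.diffAt) hZ.diffAt (hY.leviCivita hW).diffAt,
    mvfderiv_inner (hX := hY.diffAt) (hX.leviCivita hZ).diffAt hW.diffAt,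
    mvfderiv_inner (hX := hY.diffAt) hZ.diffAt (hX.leviCivita hW).diffAt,
    mvfderiv_inner (hX := (hX.lie hY).diffAt) hZ.diffAt hW.diffAt] at h
  simp only [curvatureField, inner_sub_left, inner_sub_right]
  linarith

lemma SmoothNear.curvatureField (hX : SmoothNear X x) (hY : SmoothNear Y x)
    (hZ : SmoothNear Z x) : SmoothNear (curvatureField X Y Z) x :=
  ((hX.leviCivita (hY.leviCivita hZ)).sub (hY.leviCivita (hX.leviCivita hZ))).sub
    ((hX.lie hY).leviCivita hZ)

lemma SmoothNear.endo {J : ∀ x : M, TangentSpace (𝓡 4) x →L[ℝ] TangentSpace (𝓡 4) x}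
    (hJ : IsSmoothEndo J) (hX : SmoothNear X x) : SmoothNear (fun y => J y (X y)) x := by
  filter_upwards [hX] with y hy
  exact ContMDiffAt.clm_bundle_apply (hJ y) hy

lemma curvatureField_complex {J : ∀ x : M, TangentSpace (𝓡 4) x →L[ℝ] TangentSpace (𝓡 4) x}
    (hJ : IsKahler J) (hX : SmoothNear X x) (hY : SmoothNear Y x) (hZ : SmoothNear Z x) :
    curvatureField X Y (fun y => J y (Z y)) x = J x (curvatureField X Y Z x) := by
  have e {A : ∀ x : M, TangentSpace (𝓡 4) x} (hA : SmoothNear A x) :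
      leviCivita A (fun y => J y (Z y)) =ᶠ[𝓝 x] fun y => J y (leviCivita A Z y) := by
    filter_upwards [hA.eventually, hZ.eventually] with y h1 h2
    exact hJ.parallel A Z y h1.diffAt h2.diffAt
  simp only [curvatureField]
  rw [leviCivita_congr (EventuallyEq.refl _ X) (e hY), leviCivita_congr (EventuallyEq.refl _ Y) (e hX),
    hJ.parallel _ _ x hX.diffAt (hY.leviCivita hZ).diffAt,
    hJ.parallel _ _ x hY.diffAt (hX.leviCivita hZ).diffAt,
    hJ.parallel _ _ x (hX.lie hY).diffAt hZ.diffAt, map_sub, map_sub]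

lemma riemann_smooth (hX : SmoothNear X x) (hY : SmoothNear Y x) (hZ : SmoothNear Z x)
    (hW : SmoothNear W x) : FunSmoothNear (fun y => riemann y (X y) (Y y) (Z y) (W y)) x := by
  refine ((hX.curvatureField hY hZ).inner hW).congr ?_
  filter_upwards [hX.eventually, hY.eventually, hZ.eventually] with y h1 h2 h3
  exact riemann_apply h1 h2 h3 _

end
end QCH

/-! ### Algebra of Kähler curvature tensors -/

namespace QCH
section

variable {V : Type*} [NormedAddCommGroup V] [InnerProductSpace ℝ V]

/-- `J` is an orthogonal complex structure on the Euclidean space `V`. -/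
structure IsOrthComplex (J : V →L[ℝ] V) : Prop where
  sq : ∀ v, J (J v) = -v
  orth : ∀ v w, ⟪J v, J w⟫ = ⟪v, w⟫

lemma IsOrthComplex.inner_left {J : V →L[ℝ] V} (hJ : IsOrthComplex J) (v w : V) :
    ⟪J v, w⟫ = -⟪v, J w⟫ := by
  rw [← hJ.orth, hJ.sq, inner_neg_left]

lemma IsOrthComplex.inner_self {J : V →L[ℝ] V} (hJ : IsOrthComplex J) (v : V) :
    ⟪v, J v⟫ = 0 := by
  have h1 := hJ.inner_left v v
  rw [real_inner_comm] at h1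
  linarith

/-- The symmetries of the curvature tensor of a Kähler manifold. -/
structure IsKahlerTensor (J : V →L[ℝ] V) (R : V → V → V → V → ℝ) : Prop where
  add₁ : ∀ X X' Y Z U, R (X + X') Y Z U = R X Y Z U + R X' Y Z U
  smul₁ : ∀ (c : ℝ) X Y Z U, R (c • X) Y Z U = c * R X Y Z U
  swap₁₂ : ∀ X Y Z U, R Y X Z U = -R X Y Z U
  swap₃₄ : ∀ X Y Z U, R X Y U Z = -R X Y Z U
  bianchi : ∀ X Y Z U, R X Y Z U + R Y Z X U + R Z X Y U = 0
  inv₃₄ : ∀ X Y Z U, R X Y (J Z) (J U) = R X Y Z U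

namespace IsKahlerTensor

variable {J : V →L[ℝ] V} {R T : V → V → V → V → ℝ}

/-- The octahedron argument: four Bianchi identities combined through the two antisymmetries, with
no use of `J`. -/
lemma pair (h : IsKahlerTensor J R) (X Y Z U : V) : R X Y Z U = R Z U X Y := by
  have h1 := h.bianchi X Y Z U
  have h2 := h.bianchi Y Z U X
  have h3 := h.bianchi Z U X Y
  have h4 := h.bianchi U X Y Z
  have a := h.swap₁₂
  have b := h.swap₃₄
  linarith [a X Y Z U, a X Z Y U, a X U Y Z, a Y Z X U, a Y U X Z, a Z U X Y,
    b X Y Z U, b X Z Y U, b X U Y Z, b Y Z X U, b Y U X Z, b Z U X Y,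
    a X Y U Z, a X Z U Y, a X U Z Y, a Y Z U X, a Y U Z X, a Z U Y X,
    b Y X Z U, b Z X Y U, b U X Y Z, b Z Y X U, b U Y X Z, b U Z X Y]

lemma add₂ (h : IsKahlerTensor J R) (X Y Y' Z U : V) :
    R X (Y + Y') Z U = R X Y Z U + R X Y' Z U := by
  rw [h.swap₁₂, h.add₁, h.swap₁₂ X Y, h.swap₁₂ X Y']; ring

lemma smul₂ (h : IsKahlerTensor J R) (c : ℝ) (X Y Z U : V) :
    R X (c • Y) Z U = c * R X Y Z U := by
  rw [h.swap₁₂, h.smul₁, h.swap₁₂ X Y]; ring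

lemma add₃ (h : IsKahlerTensor J R) (X Y Z Z' U : V) :
    R X Y (Z + Z') U = R X Y Z U + R X Y Z' U := by
  rw [h.pair, h.add₁, h.pair Z, h.pair Z']

lemma smul₃ (h : IsKahlerTensor J R) (c : ℝ) (X Y Z U : V) :
    R X Y (c • Z) U = c * R X Y Z U := by
  rw [h.pair, h.smul₁, h.pair Z]

lemma add₄ (h : IsKahlerTensor J R) (X Y Z U U' : V) :
    R X Y Z (U + U') = R X Y Z U + R X Y Z U' := by
  rw [h.pair, h.add₂, h.pair Z U, h.pair Z U']

lemma smul₄ (h : IsKahlerTensor J R) (c : ℝ) (X Y Z U : V) :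
    R X Y Z (c • U) = c * R X Y Z U := by
  rw [h.pair, h.smul₂, h.pair Z U]

lemma inv₁₂ (h : IsKahlerTensor J R) (X Y Z U : V) : R (J X) (J Y) Z U = R X Y Z U := by
  rw [h.pair, h.inv₃₄, h.pair]

lemma neg₁ (h : IsKahlerTensor J R) (X Y Z U : V) : R (-X) Y Z U = -R X Y Z U := by
  rw [← neg_one_smul ℝ, h.smul₁]; ring

lemma neg₂ (h : IsKahlerTensor J R) (X Y Z U : V) : R X (-Y) Z U = -R X Y Z U := by
  rw [← neg_one_smul ℝ, h.smul₂]; ring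

lemma neg₃ (h : IsKahlerTensor J R) (X Y Z U : V) : R X Y (-Z) U = -R X Y Z U := by
  rw [← neg_one_smul ℝ, h.smul₃]; ring

lemma neg₄ (h : IsKahlerTensor J R) (X Y Z U : V) : R X Y Z (-U) = -R X Y Z U := by
  rw [← neg_one_smul ℝ, h.smul₄]; ring

lemma add (h : IsKahlerTensor J R) (h' : IsKahlerTensor J T) :
    IsKahlerTensor J (fun X Y Z U => R X Y Z U + T X Y Z U) where
  add₁ X X' Y Z U := by rw [h.add₁, h'.add₁]; ring
  smul₁ c X Y Z U := by rw [h.smul₁, h'.smul₁]; ring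
  swap₁₂ X Y Z U := by rw [h.swap₁₂ X Y, h'.swap₁₂ X Y]; ring
  swap₃₄ X Y Z U := by rw [h.swap₃₄ X Y Z, h'.swap₃₄ X Y Z]; ring
  bianchi X Y Z U := by linarith [h.bianchi X Y Z U, h'.bianchi X Y Z U]
  inv₃₄ X Y Z U := by rw [h.inv₃₄, h'.inv₃₄]

lemma smul (h : IsKahlerTensor J R) (c : ℝ) :
    IsKahlerTensor J (fun X Y Z U => c * R X Y Z U) where
  add₁ X X' Y Z U := by rw [h.add₁]; ring
  smul₁ k X Y Z U := by rw [h.smul₁]; ring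
  swap₁₂ X Y Z U := by rw [h.swap₁₂ X Y]; ring
  swap₃₄ X Y Z U := by rw [h.swap₃₄ X Y Z]; ring
  bianchi X Y Z U := by linear_combination c * h.bianchi X Y Z U
  inv₃₄ X Y Z U := by rw [h.inv₃₄]

lemma sub (h : IsKahlerTensor J R) (h' : IsKahlerTensor J T) :
    IsKahlerTensor J (fun X Y Z U => R X Y Z U - T X Y Z U) := by
  have := h.add (h'.smul (-1))
  simpa only [neg_one_mul, ← sub_eq_add_neg] using this

/-- The sectional curvatures determine the tensor. -/
lemma eq_zero_of_sectional (h : IsKahlerTensor J R) (h0 : ∀ X Y, R X Y Y X = 0) (X Y Z U : V) :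
    R X Y Z U = 0 := by
  -- Polarization in the outer pair; the next step polarizes in the inner pair.
  have h1 (X Y Z : V) : R X Y Y Z = 0 := by
    have e := h0 (X + Z) Y
    have p : R Z Y Y X = R X Y Y Z := by rw [h.pair, h.swap₁₂, h.swap₃₄]; ring
    rw [h.add₁, h.add₄, h.add₄, h0, h0, p] at e
    linarith
  have h2 (X Y Z U : V) : R X Y Z U = -R X Z Y U := by
    have e := h1 X (Y + Z) U
    rw [h.add₂, h.add₃, h.add₃, h1, h1] at e
    linarith
  -- Antisymmetry in the first two and in the middle two arguments makes the three Bianchi terms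
  -- equal.
  have e := h.bianchi X Y Z U
  have e1 := h2 X Y Z U
  have e2 := h2 Y X Z U
  have e3 := h.swap₁₂ X Y Z U
  have e4 := h.swap₁₂ X Z Y U
  linarith

/-- The part of `R(X+Y,J(X+Y),J(X+Y),X+Y)` which is quadratic in both `X` and `Y`. -/
def mixed (J : V →L[ℝ] V) (R : V → V → V → V → ℝ) (X Y : V) : ℝ :=
  2 * R X (J X) (J Y) Y + 4 * R X (J Y) (J Y) X

lemma inv₃ (h : IsKahlerTensor J R) (hJ : IsOrthComplex J) (X Y Z U : V) :
    R X Y (J Z) U = -R X Y Z (J U) := by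
  rw [← h.inv₃₄, hJ.sq, h.neg₃]

lemma inv₁ (h : IsKahlerTensor J R) (hJ : IsOrthComplex J) (X Y Z U : V) :
    R (J X) Y Z U = -R X (J Y) Z U := by
  rw [← h.inv₁₂, hJ.sq, h.neg₁]

/-- Adding the values at `X + Y` and `X - Y` removes the odd terms. Of the six terms quadratic in
both vectors, two equal `R(X,JX,JY,Y)` and four equal `R(X,JY,JY,X)`. -/
lemma holomorphic_add_sub (h : IsKahlerTensor J R) (hJ : IsOrthComplex J) (X Y : V) :
    R (X + Y) (J (X + Y)) (J (X + Y)) (X + Y)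
      + R (X + -Y) (J (X + -Y)) (J (X + -Y)) (X + -Y)
      = 2 * (R X (J X) (J X) X + mixed J R X Y + R Y (J Y) (J Y) Y) := by
  have p1 : R Y (J Y) (J X) X = R X (J X) (J Y) Y := by
    rw [h.pair, h.swap₁₂, h.swap₃₄]; ring
  have p2 : R X (J Y) (J X) Y = R X (J Y) (J Y) X := by
    rw [h.inv₃ hJ, h.swap₃₄]; ring
  have p3 : R Y (J X) (J Y) X = R X (J Y) (J Y) X := by
    rw [h.pair, h.swap₁₂, h.swap₃₄, neg_neg, p2]
  have p4 : R Y (J X) (J X) Y = R X (J Y) (J Y) X := by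
    rw [h.swap₁₂, h.inv₁ hJ, neg_neg, p2]
  simp only [map_add, map_neg, h.add₁, h.add₂, h.add₃, h.add₄, h.neg₁, h.neg₂, h.neg₃, h.neg₄,
    mixed, p1, p2, p3, p4]
  ring

/-- The holomorphic sectional curvatures determine the tensor. -/
lemma eq_zero_of_holomorphic (h : IsKahlerTensor J R) (hJ : IsOrthComplex J)
    (h0 : ∀ X, R X (J X) (J X) X = 0) (X Y Z U : V) : R X Y Z U = 0 := by
  refine h.eq_zero_of_sectional (fun X Y => ?_) X Y Z U
  -- Vanishing of `mixed` and Bianchi's `R(X,JX,JY,Y) = R(X,Y,Y,X) + R(X,JY,JY,X)` give this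
  -- relation. Replacing `Y` by `JY` exchanges its two terms, so both vanish.
  have key (X Y : V) : R X Y Y X + 3 * R X (J Y) (J Y) X = 0 := by
    have e := h.holomorphic_add_sub hJ X Y
    have b := h.bianchi X (J X) (J Y) Y
    rw [h.inv₁₂, h.swap₃₄ X Y Y X, h.swap₁₂ X (J Y), h.inv₃ hJ X (J Y), h.swap₃₄ X (J Y) (J Y) X] at b
    rw [h0, h0, h0, h0, mixed] at e
    linarith
  have e1 := key X Y
  have e2 := key X (J Y)
  rw [hJ.sq, h.neg₂, h.neg₃] at e2
  linarith

/-- A Kähler tensor as a bilinear form in the first two arguments. -/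
def form₁₂ (h : IsKahlerTensor J R) (Z U : V) : LinearMap.BilinForm ℝ V :=
  LinearMap.mk₂ ℝ (fun X Y => R X Y Z U) (fun _ _ _ => h.add₁ _ _ _ _ _)
    (fun _ _ _ => h.smul₁ _ _ _ _ _) (fun _ _ _ => h.add₂ _ _ _ _ _)
    (fun _ _ _ => h.smul₂ _ _ _ _ _)

/-- A Kähler tensor as a bilinear form in the outer arguments. -/
def form₁₄ (h : IsKahlerTensor J R) (Y Z : V) : LinearMap.BilinForm ℝ V :=
  LinearMap.mk₂ ℝ (fun X U => R X Y Z U) (fun _ _ _ => h.add₁ _ _ _ _ _)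
    (fun _ _ _ => h.smul₁ _ _ _ _ _) (fun _ _ _ => h.add₄ _ _ _ _ _)
    (fun _ _ _ => h.smul₄ _ _ _ _ _)

@[simp] lemma form₁₂_apply (h : IsKahlerTensor J R) (X Y Z U : V) :
    h.form₁₂ Z U X Y = R X Y Z U := rfl

end IsKahlerTensor

section Traces

variable {ι κ : Type*} [Fintype ι] [Fintype κ]

lemma sum_inner_inner (b : OrthonormalBasis ι ℝ V) (B : LinearMap.BilinForm ℝ V) (u v : V) :
    ∑ i, ∑ j, B (b i) (b j) * ⟪b i, u⟫ * ⟪b j, v⟫ = B u v := by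
  conv_rhs => rw [← b.sum_repr' u, ← b.sum_repr' v]
  simp only [map_sum, map_smul, LinearMap.sum_apply, LinearMap.smul_apply, smul_eq_mul,
    Finset.mul_sum]
  rw [Finset.sum_comm]
  exact Finset.sum_congr rfl fun i _ => Finset.sum_congr rfl fun j _ => by ring

lemma sum_inner_right (b : OrthonormalBasis ι ℝ V) (f : V →ₗ[ℝ] ℝ) (u : V) :
    ∑ i, f (b i) * ⟪b i, u⟫ = f u := by
  conv_rhs => rw [← b.sum_repr' u]
  simp only [map_sum, map_smul, smul_eq_mul]
  exact Finset.sum_congr rfl fun i _ => mul_comm _ _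

/-- The trace of a bilinear form does not depend on the orthonormal basis. -/
lemma sum_bilin_eq (b : OrthonormalBasis ι ℝ V) (b' : OrthonormalBasis κ ℝ V)
    (B : LinearMap.BilinForm ℝ V) : ∑ i, B (b i) (b i) = ∑ k, B (b' k) (b' k) := by
  have h1 (k : κ) : B (b' k) (b' k)
      = ∑ i, ∑ j, B (b i) (b j) * ⟪b i, b' k⟫ * ⟪b j, b' k⟫ := (sum_inner_inner b B _ _).symm
  simp only [h1]
  rw [Finset.sum_comm]
  refine Finset.sum_congr rfl fun i _ => ?_
  rw [Finset.sum_comm]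
  have h2 (j : ι) : ∑ k, B (b i) (b j) * ⟪b i, b' k⟫ * ⟪b j, b' k⟫
      = B (b i) (b j) * ⟪b j, b i⟫ := by
    rw [← b'.sum_inner_mul_inner (b j) (b i), Finset.mul_sum]
    refine Finset.sum_congr rfl fun k _ => ?_
    rw [real_inner_comm (b i) (b' k)]
    ring
  simp only [h2]
  exact (sum_inner_right b (B (b i)) (b i)).symm

/-- The inner product of two bilinear forms does not depend on the orthonormal basis. -/
lemma sum_sum_bilin_eq (b : OrthonormalBasis ι ℝ V) (b' : OrthonormalBasis κ ℝ V)
    (A B : LinearMap.BilinForm ℝ V) :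
    ∑ i, ∑ j, A (b i) (b j) * B (b i) (b j) = ∑ k, ∑ l, A (b' k) (b' l) * B (b' k) (b' l) := by
  have h1 (j : V) : ∑ i, A (b i) j * B (b i) j = ∑ k, A (b' k) j * B (b' k) j :=
    sum_bilin_eq b b' ((LinearMap.mul ℝ ℝ).compl₁₂ (A.flip j) (B.flip j))
  have h2 (i : V) : ∑ j, A i (b j) * B i (b j) = ∑ l, A i (b' l) * B i (b' l) :=
    sum_bilin_eq b b' ((LinearMap.mul ℝ ℝ).compl₁₂ (A i) (B i))
  rw [Finset.sum_comm]
  simp only [h1]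
  rw [Finset.sum_comm]
  simp only [h2]

end Traces

section FiniteDimensional

variable [FiniteDimensional ℝ V] {J : V →L[ℝ] V} {R : V → V → V → V → ℝ}
  {ι : Type*} [Fintype ι]

lemma IsKahlerTensor.ricciOf_eq (h : IsKahlerTensor J R) (b : OrthonormalBasis ι ℝ V) (Y Z : V) :
    ricciOf R Y Z = ∑ i, R (b i) Y Z (b i) :=
  sum_bilin_eq _ b (h.form₁₄ Y Z)

/-- The Ricci tensor of a Kähler tensor as a bilinear form. -/
def IsKahlerTensor.ricciForm (h : IsKahlerTensor J R) : LinearMap.BilinForm ℝ V :=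
  LinearMap.mk₂ ℝ (ricciOf R)
    (fun Y Y' Z => by simp only [ricciOf, h.add₂, Finset.sum_add_distrib])
    (fun c Y Z => by simp only [ricciOf, h.smul₂, Finset.mul_sum, smul_eq_mul])
    (fun Y Z Z' => by simp only [ricciOf, h.add₃, Finset.sum_add_distrib])
    (fun c Y Z => by simp only [ricciOf, h.smul₃, Finset.mul_sum, smul_eq_mul])

@[simp] lemma IsKahlerTensor.ricciForm_apply (h : IsKahlerTensor J R) (Y Z : V) :
    h.ricciForm Y Z = ricciOf R Y Z := rfl

lemma IsKahlerTensor.scalarOf_eq (h : IsKahlerTensor J R) (b : OrthonormalBasis ι ℝ V) :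
    scalarOf R = ∑ i, ricciOf R (b i) (b i) :=
  sum_bilin_eq _ b h.ricciForm

lemma IsKahlerTensor.ricciOf_symm (h : IsKahlerTensor J R) (Y Z : V) :
    ricciOf R Y Z = ricciOf R Z Y := by
  refine Finset.sum_congr rfl fun i _ => ?_
  rw [h.pair, h.swap₁₂, h.swap₃₄, neg_neg]

lemma IsOrthComplex.exists_basis (hJ : IsOrthComplex J) (b : OrthonormalBasis ι ℝ V) :
    ∃ b' : OrthonormalBasis ι ℝ V, ∀ i, b' i = J (b i) := by
  have ho : Orthonormal ℝ (fun i => J (b i)) :=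
    ⟨fun i => by rw [norm_eq_sqrt_real_inner, hJ.orth, ← norm_eq_sqrt_real_inner, b.orthonormal.1],
      fun i j hij => (hJ.orth _ _).trans (b.orthonormal.2 hij)⟩
  have hs : ⊤ ≤ Submodule.span ℝ (Set.range fun i => J (b i)) := by
    rw [(linearIndependent_of_ne_zero_of_inner_eq_zero (𝕜 := ℝ) (fun i => ho.ne_zero i)
      ho.2).span_eq_top_of_card_eq_finrank' (Module.finrank_eq_card_basis b.toBasis).symm]
  exact ⟨OrthonormalBasis.mk ho hs, fun i => by simp⟩

lemma IsKahlerTensor.ricciOf_inv (h : IsKahlerTensor J R) (hJ : IsOrthComplex J) (Y Z : V) :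
    ricciOf R (J Y) (J Z) = ricciOf R Y Z := by
  obtain ⟨b, hb⟩ := hJ.exists_basis (stdOrthonormalBasis ℝ V)
  rw [h.ricciOf_eq b, ricciOf]
  refine Finset.sum_congr rfl fun i _ => ?_
  rw [hb, h.inv₁₂, h.inv₃₄]

/-- Bianchi and `J`-invariance split each summand into two Ricci summands with equal traces.
Consequently a Kähler tensor with zero Ricci contraction has no `ω`-component in its first pair. -/
lemma IsKahlerTensor.sum_complex (h : IsKahlerTensor J R) (hJ : IsOrthComplex J)
    (b : OrthonormalBasis ι ℝ V) (Z U : V) :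
    ∑ i, R (b i) (J (b i)) Z U = -(2 * ricciOf R (J Z) U) := by
  have e : ricciOf R Z (J U) = -ricciOf R (J Z) U := by
    rw [← h.ricciOf_inv hJ, hJ.sq, ← h.ricciForm_apply, map_neg, h.ricciForm_apply]
  have h1 (i : ι) : R (b i) (J (b i)) Z U
      = -R (b i) (J Z) U (b i) + R (b i) Z (J U) (b i) := by
    have e1 := h.bianchi (b i) (J (b i)) Z U
    have e2 := h.inv₁ hJ (b i) Z (b i) U
    have e3 := h.inv₃ hJ (b i) Z (b i) U
    have e4 := h.swap₁₂ Z (b i) (J (b i)) U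
    have e5 := h.swap₃₄ (b i) Z (b i) (J U)
    have e6 := h.swap₃₄ (b i) (J Z) (b i) U
    linarith
  simp only [h1, Finset.sum_add_distrib, Finset.sum_neg_distrib]
  rw [← h.ricciOf_eq b, ← h.ricciOf_eq b, e]
  ring

end FiniteDimensional
end
end QCH

/-! ### Adapted bases, the three model tensors and `W⁻` -/

namespace QCH
section

set_option linter.unusedSectionVars false

variable {V : Type*} [NormedAddCommGroup V] [InnerProductSpace ℝ V] [FiniteDimensional ℝ V]
  {J : V →L[ℝ] V} {D : Submodule ℝ V} {b : OrthonormalBasis (Fin 4) ℝ V}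

/-- An orthonormal basis of the form `u, Ju, v, Jv` with `u ∈ D` and `v` orthogonal to `D`. -/
structure IsAdapted (J : V →L[ℝ] V) (D : Submodule ℝ V) (b : OrthonormalBasis (Fin 4) ℝ V) :
    Prop where
  complex : IsOrthComplex J
  J₀ : J (b 0) = b 1
  J₂ : J (b 2) = b 3
  mem₀ : b 0 ∈ D
  mem₁ : b 1 ∈ D
  mem₂ : b 2 ∈ Dᗮ
  mem₃ : b 3 ∈ Dᗮ

lemma inner_repr (b : OrthonormalBasis (Fin 4) ℝ V) (X Y : V) :
    ⟪X, Y⟫ = b.repr X 0 * b.repr Y 0 + b.repr X 1 * b.repr Y 1 + b.repr X 2 * b.repr Y 2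
      + b.repr X 3 * b.repr Y 3 := by
  rw [← b.sum_inner_mul_inner X Y, Fin.sum_univ_four]
  simp only [b.repr_apply_apply, real_inner_comm X]

lemma repr_basis (b : OrthonormalBasis (Fin 4) ℝ V) (i j : Fin 4) :
    b.repr (b i) j = if j = i then 1 else 0 := by
  simp [b.repr_self]

lemma sum_repr_four (b : OrthonormalBasis (Fin 4) ℝ V) (X : V) :
    X = b.repr X 0 • b 0 + b.repr X 1 • b 1 + b.repr X 2 • b 2 + b.repr X 3 • b 3 := by
  conv_lhs => rw [← b.sum_repr X, Fin.sum_univ_four]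

namespace IsAdapted

lemma J₁ (A : IsAdapted J D b) : J (b 1) = -b 0 := by rw [← A.J₀, A.complex.sq]

lemma J₃ (A : IsAdapted J D b) : J (b 3) = -b 2 := by rw [← A.J₂, A.complex.sq]

lemma repr_J₀ (A : IsAdapted J D b) (X : V) : b.repr (J X) 0 = -b.repr X 1 := by
  have := A.complex.inner_left (b 0) X
  rw [A.J₀] at this
  rw [b.repr_apply_apply, b.repr_apply_apply, this, neg_neg]

lemma repr_J₁ (A : IsAdapted J D b) (X : V) : b.repr (J X) 1 = b.repr X 0 := by
  have := A.complex.inner_left (b 1) X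
  rw [A.J₁, inner_neg_left] at this
  rw [b.repr_apply_apply, b.repr_apply_apply]
  linarith

lemma repr_J₂ (A : IsAdapted J D b) (X : V) : b.repr (J X) 2 = -b.repr X 3 := by
  have := A.complex.inner_left (b 2) X
  rw [A.J₂] at this
  rw [b.repr_apply_apply, b.repr_apply_apply, this, neg_neg]

lemma repr_J₃ (A : IsAdapted J D b) (X : V) : b.repr (J X) 3 = b.repr X 2 := by
  have := A.complex.inner_left (b 3) X
  rw [A.J₃, inner_neg_left] at this
  rw [b.repr_apply_apply, b.repr_apply_apply]
  linarith

lemma proj_eq (A : IsAdapted J D b) (X : V) :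
    D.starProjection X = b.repr X 0 • b 0 + b.repr X 1 • b 1 := by
  conv_lhs => rw [sum_repr_four b X]
  simp only [map_add, map_smul, Submodule.starProjection_eq_self_iff.2 A.mem₀,
    Submodule.starProjection_eq_self_iff.2 A.mem₁,
    (Submodule.starProjection_apply_eq_zero_iff D).2 A.mem₂,
    (Submodule.starProjection_apply_eq_zero_iff D).2 A.mem₃, smul_zero, add_zero]

lemma orthProj_eq (A : IsAdapted J D b) (X : V) :
    Dᗮ.starProjection X = b.repr X 2 • b 2 + b.repr X 3 • b 3 := by
  have h : Dᗮ.starProjection X = X - D.starProjection X := by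
    rw [Submodule.starProjection_orthogonal]; rfl
  rw [h, A.proj_eq]
  conv_lhs => rw [sum_repr_four b X]
  simp only [map_add, map_smul, PiLp.add_apply, PiLp.smul_apply, repr_basis]
  simp
  abel

lemma hForm_eq (A : IsAdapted J D b) (X Y : V) :
    hForm D X Y = b.repr X 0 * b.repr Y 0 + b.repr X 1 * b.repr Y 1 := by
  rw [hForm, A.proj_eq, A.proj_eq, inner_repr b]
  simp

lemma norm_proj (A : IsAdapted J D b) (X : V) :
    ‖D.starProjection X‖ ^ 2 = b.repr X 0 ^ 2 + b.repr X 1 ^ 2 := by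
  have := A.hForm_eq X X
  rw [hForm, real_inner_self_eq_norm_sq] at this
  rw [this]; ring

lemma opposite_apply (A : IsAdapted J D b) (X : V) :
    oppositeOf J D X = b.repr X 0 • b 1 - b.repr X 1 • b 0 - b.repr X 2 • b 3
      + b.repr X 3 • b 2 := by
  change J (D.starProjection X - Dᗮ.starProjection X) = _
  rw [A.proj_eq, A.orthProj_eq]
  simp only [map_add, map_sub, map_smul, A.J₀, A.J₁, A.J₂, A.J₃]
  module

lemma tensorPi_kahler (A : IsAdapted J D b) : IsKahlerTensor J (tensorPi J) := by
  constructor <;> intros <;>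
  simp only [tensorPi, inner_repr b, A.repr_J₀, A.repr_J₁, A.repr_J₂, A.repr_J₃, map_add, map_smul,
    PiLp.add_apply, PiLp.smul_apply, smul_eq_mul] <;> ring

lemma tensorPhi_kahler (A : IsAdapted J D b) : IsKahlerTensor J (tensorPhi J D) := by
  constructor <;> intros <;>
  simp only [tensorPhi, A.hForm_eq, inner_repr b, A.repr_J₀, A.repr_J₁, A.repr_J₂, A.repr_J₃, map_add,
    map_smul, PiLp.add_apply, PiLp.smul_apply, smul_eq_mul] <;> ring

lemma tensorPsi_kahler (A : IsAdapted J D b) : IsKahlerTensor J (tensorPsi J D) := by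
  constructor <;> intros <;>
  simp only [tensorPsi, A.hForm_eq, A.repr_J₀, A.repr_J₁, map_add, map_smul,
    PiLp.add_apply, PiLp.smul_apply, smul_eq_mul] <;> ring

lemma tensorPi_ricci (A : IsAdapted J D b) (Y Z : V) :
    ricciOf (tensorPi J) Y Z = 3 / 2 * ⟪Y, Z⟫ := by
  rw [A.tensorPi_kahler.ricciOf_eq b, Fin.sum_univ_four]
  simp only [tensorPi, inner_repr b, A.repr_J₀, A.repr_J₁, A.repr_J₂, A.repr_J₃, repr_basis]
  simp
  ring

lemma tensorPhi_ricci (A : IsAdapted J D b) (Y Z : V) :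
    ricciOf (tensorPhi J D) Y Z = 1 / 4 * ⟪Y, Z⟫ + hForm D Y Z := by
  rw [A.tensorPhi_kahler.ricciOf_eq b, Fin.sum_univ_four]
  simp only [tensorPhi, A.hForm_eq, inner_repr b, A.repr_J₀, A.repr_J₁, A.repr_J₂, A.repr_J₃, repr_basis]
  simp
  ring

lemma tensorPsi_ricci (A : IsAdapted J D b) (Y Z : V) :
    ricciOf (tensorPsi J D) Y Z = hForm D Y Z := by
  rw [A.tensorPsi_kahler.ricciOf_eq b, Fin.sum_univ_four]
  simp only [tensorPsi, A.hForm_eq, A.repr_J₀, A.repr_J₁, repr_basis]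
  simp
  ring

end IsAdapted

/-- The Hodge star for the orientation of an orthogonal complex structure. -/
lemma hodgeStar_eq (hJ : IsOrthComplex J) (α : LinearMap.BilinForm ℝ V) (hα : ∀ X Y, α Y X = -α X Y)
    (b : OrthonormalBasis (Fin 4) ℝ V) (X Y : V) :
    hodgeStar J (fun A B => α A B) X Y
      = (1 / 2) * (∑ i, α (b i) (J (b i))) * ⟪J X, Y⟫ - α (J X) (J Y) := by
  have ht : ∑ i, α (b i) (J (b i)) = ∑ i, α (stdOrthonormalBasis ℝ V i)
      (J (stdOrthonormalBasis ℝ V i)) :=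
    sum_bilin_eq b (stdOrthonormalBasis ℝ V) (α.compl₂ J.toLinearMap)
  rw [ht]
  -- Of the three products in `½ ω ∧ ω`, the first contracts `α` to its trace against `ω`; the other
  -- two evaluate `α` on `JX, JY`, with the same sign once antisymmetry is used.
  have e (u v : V) : α u v * volForm J u v X Y
      = α u v * ⟪v, J u⟫ * ⟪J X, Y⟫ - α u v * ⟪u, J X⟫ * ⟪v, J Y⟫
        + α u v * ⟪u, J Y⟫ * ⟪v, J X⟫ := by
    simp only [volForm, fundForm, LinearMap.comp_apply, ContinuousLinearMap.coe_coe,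
      innerₗ_apply_apply]
    rw [real_inner_comm v (J u), hJ.inner_left u X, hJ.inner_left v X, hJ.inner_left u Y,
      hJ.inner_left v Y]
    ring
  simp only [hodgeStar, e, Finset.sum_add_distrib, Finset.sum_sub_distrib, sum_inner_inner,
    ← Finset.sum_mul, sum_inner_right (stdOrthonormalBasis ℝ V) (α _)]
  rw [hα (J X) (J Y)]
  ring

/-- The subtracted combination has the same Ricci contraction as `R`, since `(3/2)(2/3)(p - q/4) +
q/4 = p`. Explicitly, `hodgeStar_eq` and `sum_complex` express `*W` through `R` itself and its Ricci
tensor, so `½(W - *W)` is `R` plus terms in `g`, `h` and `J`. -/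
lemma IsAdapted.weylMinusOf_eq {R : V → V → V → V → ℝ} (A : IsAdapted J D b)
    (h : IsKahlerTensor J R) {p q : ℝ}
    (hr : ∀ Y Z, ricciOf R Y Z = p * ⟪Y, Z⟫ + q * hForm D Y Z) (X Y Z U : V) :
    weylMinusOf J R X Y Z U
      = R X Y Z U - (2 / 3 * (p - q / 4) * tensorPi J X Y Z U + q * tensorPhi J D X Y Z U) := by
  have ht : scalarOf R = 4 * p + 2 * q := by
    rw [h.scalarOf_eq b, Fin.sum_univ_four]
    simp only [hr, A.hForm_eq, inner_repr b, repr_basis]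
    simp
    ring
  have hW (X Y : V) : weylOf R X Y Z U = R X Y Z U
      + kulkarniNomizu (fun A B => 1 / 2 * (p * ⟪A, B⟫ + q * hForm D A B
        - (4 * p + 2 * q) / 6 * ⟪A, B⟫)) (fun A B => ⟪A, B⟫) X Y Z U := by
    simp only [weylOf, kulkarniNomizu, schoutenOf, hr, ht]
  let α : LinearMap.BilinForm ℝ V := LinearMap.mk₂ ℝ (fun X Y => weylOf R X Y Z U)
    (fun _ _ _ => by
      simp only [hW, h.add₁, kulkarniNomizu, A.hForm_eq, inner_repr b, map_add, PiLp.add_apply]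
      ring)
    (fun _ _ _ => by
      simp only [hW, h.smul₁, kulkarniNomizu, A.hForm_eq, inner_repr b, map_smul, PiLp.smul_apply,
        smul_eq_mul]
      ring)
    (fun _ _ _ => by
      simp only [hW, h.add₂, kulkarniNomizu, A.hForm_eq, inner_repr b, map_add, PiLp.add_apply]
      ring)
    (fun _ _ _ => by
      simp only [hW, h.smul₂, kulkarniNomizu, A.hForm_eq, inner_repr b, map_smul, PiLp.smul_apply,
        smul_eq_mul]
      ring)
  have hα (X Y : V) : α Y X = -α X Y := by
    simp only [α, LinearMap.mk₂_apply, hW, h.swap₁₂ X Y, kulkarniNomizu]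
    ring
  have hs : hodgeStar J (fun A B => weylOf R A B Z U) X Y = _ :=
    hodgeStar_eq A.complex α hα b X Y
  rw [weylMinusOf, hs]
  simp only [α, LinearMap.mk₂_apply, hW, h.inv₁₂, Finset.sum_add_distrib,
    h.sum_complex A.complex, hr]
  rw [Fin.sum_univ_four]
  simp only [kulkarniNomizu, tensorPi, tensorPhi, A.hForm_eq, inner_repr b, A.repr_J₀, A.repr_J₁,
    A.repr_J₂, A.repr_J₃, repr_basis]
  simp
  ring

end
end QCH

/-! ### Anti-self-dual forms and Ricci-flat Kähler tensors -/

namespace QCH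
section

set_option linter.unusedSectionVars false

variable {V : Type*} [NormedAddCommGroup V] [InnerProductSpace ℝ V] [FiniteDimensional ℝ V]
  {J : V →L[ℝ] V} {D : Submodule ℝ V} {b : OrthonormalBasis (Fin 4) ℝ V}
  {T : V → V → V → V → ℝ}

/-- The anti-self-dual form with the given components in an adapted basis. -/
def asdForm (b : OrthonormalBasis (Fin 4) ℝ V) (p q r : ℝ) : LinearMap.BilinForm ℝ V :=
  LinearMap.mk₂ ℝ (fun X Y =>
      p * (b.repr X 0 * b.repr Y 1 - b.repr X 1 * b.repr Y 0
        - (b.repr X 2 * b.repr Y 3 - b.repr X 3 * b.repr Y 2))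
      + q * (b.repr X 0 * b.repr Y 2 - b.repr X 2 * b.repr Y 0
        + (b.repr X 1 * b.repr Y 3 - b.repr X 3 * b.repr Y 1))
      + r * (b.repr X 0 * b.repr Y 3 - b.repr X 3 * b.repr Y 0
        - (b.repr X 1 * b.repr Y 2 - b.repr X 2 * b.repr Y 1)))
    (fun _ _ _ => by simp only [map_add, PiLp.add_apply]; ring)
    (fun _ _ _ => by simp only [map_smul, PiLp.smul_apply, smul_eq_mul]; ring)
    (fun _ _ _ => by simp only [map_add, PiLp.add_apply]; ring)
    (fun _ _ _ => by simp only [map_smul, PiLp.smul_apply, smul_eq_mul]; ring)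

lemma asdForm_apply (p q r : ℝ) (X Y : V) : asdForm b p q r X Y =
      p * (b.repr X 0 * b.repr Y 1 - b.repr X 1 * b.repr Y 0
        - (b.repr X 2 * b.repr Y 3 - b.repr X 3 * b.repr Y 2))
      + q * (b.repr X 0 * b.repr Y 2 - b.repr X 2 * b.repr Y 0
        + (b.repr X 1 * b.repr Y 3 - b.repr X 3 * b.repr Y 1))
      + r * (b.repr X 0 * b.repr Y 3 - b.repr X 3 * b.repr Y 0
        - (b.repr X 1 * b.repr Y 2 - b.repr X 2 * b.repr Y 1)) := rfl

lemma asdForm_basis_one (p q r : ℝ) : asdForm b p q r (b 0) (b 1) = p := by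
  simp [asdForm_apply]

lemma asdForm_basis_two (p q r : ℝ) : asdForm b p q r (b 0) (b 2) = q := by
  simp [asdForm_apply]

lemma asdForm_basis_three (p q r : ℝ) : asdForm b p q r (b 0) (b 3) = r := by
  simp [asdForm_apply]

lemma bilin_eq_repr (b : OrthonormalBasis (Fin 4) ℝ V) (α : LinearMap.BilinForm ℝ V) (X Y : V) :
    α X Y = ∑ i, ∑ j, b.repr X i * b.repr Y j * α (b i) (b j) := by
  conv_lhs => rw [← b.sum_repr X, ← b.sum_repr Y]
  simp only [map_sum, map_smul, LinearMap.sum_apply, LinearMap.smul_apply, smul_eq_mul,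
    Finset.mul_sum]
  rw [Finset.sum_comm]
  exact Finset.sum_congr rfl fun i _ => Finset.sum_congr rfl fun j _ => by ring

lemma antisymm_of_alternating {α : LinearMap.BilinForm ℝ V} (h : ∀ X, α X X = 0) (X Y : V) :
    α Y X = -α X Y := by
  have e := h (X + Y)
  simp only [map_add, LinearMap.add_apply, h] at e
  linarith

namespace IsAdapted

/-- By `hodgeStar_eq`, the star of a form is half its `ω`-trace times `ω`, minus its pullback by
`J`. Invariance and vanishing trace leave `-α`. -/
lemma mem_asdForms (A : IsAdapted J D b) {α : LinearMap.BilinForm ℝ V} (h : ∀ X, α X X = 0)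
    (hinv : ∀ X Y, α (J X) (J Y) = α X Y) (htr : ∑ i, α (b i) (J (b i)) = 0) :
    α ∈ asdForms J := by
  refine ⟨h, fun X Y => ?_⟩
  rw [hodgeStar_eq A.complex α (antisymm_of_alternating h) b, htr, hinv]
  ring

lemma asdForm_mem (A : IsAdapted J D b) (p q r : ℝ) : asdForm b p q r ∈ asdForms J := by
  refine A.mem_asdForms (fun X => ?_) (fun X Y => ?_) ?_
  · rw [asdForm_apply]; ring
  · simp only [asdForm_apply, A.repr_J₀, A.repr_J₁, A.repr_J₂, A.repr_J₃]; ring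
  · rw [Fin.sum_univ_four]
    simp [asdForm_apply, A.J₀, A.J₁, A.J₂, A.J₃]

/-- The equation `*α = -α`, evaluated on `b 0` with the other basis vectors, determines the
remaining three components. -/
lemma eq_asdForm (A : IsAdapted J D b) {α : LinearMap.BilinForm ℝ V} (h : α ∈ asdForms J) :
    α = asdForm b (α (b 0) (b 1)) (α (b 0) (b 2)) (α (b 0) (b 3)) := by
  obtain ⟨h0, h1⟩ := h
  have sw := antisymm_of_alternating h0
  have st (X Y : V) := (hodgeStar_eq A.complex α sw b X Y).symm.trans (h1 X Y)
  have e1 := st (b 0) (b 1)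
  have e2 := st (b 0) (b 2)
  have e3 := st (b 0) (b 3)
  rw [Fin.sum_univ_four] at e1 e2 e3
  simp only [A.J₀, A.J₁, A.J₂, A.J₃, map_neg, inner_repr b, repr_basis] at e1 e2 e3
  simp [sw (b 0) (b 1), sw (b 2) (b 3)] at e1 e2 e3
  ext X Y
  rw [bilin_eq_repr b, asdForm_apply]
  simp only [Fin.sum_univ_four, h0, sw (b 0) (b 1), sw (b 2) (b 3), sw (b 0) (b 2),
    sw (b 0) (b 3), sw (b 1) (b 2), sw (b 1) (b 3)]
  have e4 : α (b 2) (b 3) = -α (b 0) (b 1) := by linarith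
  have e5 : α (b 1) (b 2) = -α (b 0) (b 3) := by linarith
  have e6 : α (b 1) (b 3) = α (b 0) (b 2) := by linarith
  rw [e4, e5, e6]
  ring

lemma fundForm_opposite (A : IsAdapted J D b) :
    fundForm (oppositeOf J D) = asdForm b 1 0 0 := by
  ext X Y
  change ⟪oppositeOf J D X, Y⟫ = _
  rw [A.opposite_apply, inner_repr b, asdForm_apply]
  simp
  ring

end IsAdapted

/-- Kähler tensors with vanishing Ricci contraction. -/
structure IsKahlerWeylTensor (J : V →L[ℝ] V) (T : V → V → V → V → ℝ) : Prop
    extends IsKahlerTensor J T where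
  ricci_zero : ∀ Y Z, ricciOf T Y Z = 0

namespace IsKahlerWeylTensor

lemma form_mem (h : IsKahlerWeylTensor J T) (A : IsAdapted J D b) (Z U : V) :
    h.form₁₂ Z U ∈ asdForms J := by
  refine A.mem_asdForms (fun X => ?_) (fun X Y => h.inv₁₂ X Y Z U) ?_
  · have := h.swap₁₂ X X Z U
    simp only [IsKahlerTensor.form₁₂_apply]
    linarith
  · simp only [IsKahlerTensor.form₁₂_apply]
    rw [h.sum_complex A.complex, h.ricci_zero]
    simp

lemma eq_asdForm (h : IsKahlerWeylTensor J T) (A : IsAdapted J D b) (X Y Z U : V) :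
    T X Y Z U = asdForm b (T (b 0) (b 1) Z U) (T (b 0) (b 2) Z U) (T (b 0) (b 3) Z U) X Y :=
  congrArg (fun α : LinearMap.BilinForm ℝ V => α X Y) (A.eq_asdForm (h.form_mem A Z U))

/-- This is `Ric(b 0, b 0) = 0`; it says that the operator induced on `Λ⁻` is trace-free. -/
lemma trace_eq_zero (h : IsKahlerWeylTensor J T) (b : OrthonormalBasis (Fin 4) ℝ V) :
    T (b 0) (b 1) (b 0) (b 1) + T (b 0) (b 2) (b 0) (b 2) + T (b 0) (b 3) (b 0) (b 3) = 0 := by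
  have e := h.ricci_zero (b 0) (b 0)
  rw [h.ricciOf_eq b, Fin.sum_univ_four] at e
  have e0 := h.swap₁₂ (b 0) (b 0) (b 0) (b 0)
  have e1 := h.swap₁₂ (b 0) (b 1) (b 0) (b 1)
  have e2 := h.swap₁₂ (b 0) (b 2) (b 0) (b 2)
  have e3 := h.swap₁₂ (b 0) (b 3) (b 0) (b 3)
  linarith

/-- The factor is `-2` because each anti-self-dual component occurs on two complementary index
pairs, and the signs in `T` match those in the form. -/
lemma formAction_asdForm (h : IsKahlerWeylTensor J T) (A : IsAdapted J D b) (p q r : ℝ) (Z U : V) :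
    formAction T (fun X Y => asdForm b p q r X Y) Z U
      = -2 * (p * T (b 0) (b 1) Z U + q * T (b 0) (b 2) Z U + r * T (b 0) (b 3) Z U) := by
  have e := sum_sum_bilin_eq (stdOrthonormalBasis ℝ V) b (asdForm b p q r) (h.form₁₂ Z U)
  simp only [IsKahlerTensor.form₁₂_apply] at e
  rw [formAction, e]
  have e12 := h.eq_asdForm A (b 1) (b 2) Z U
  have e13 := h.eq_asdForm A (b 1) (b 3) Z U
  have e23 := h.eq_asdForm A (b 2) (b 3) Z U
  simp [asdForm_apply] at e12 e13 e23
  simp only [Fin.sum_univ_four, h.swap₁₂ (b 0) (b 1), h.swap₁₂ (b 0) (b 2), h.swap₁₂ (b 0) (b 3),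
    h.swap₁₂ (b 1) (b 2), h.swap₁₂ (b 1) (b 3), h.swap₁₂ (b 2) (b 3), e12, e13, e23]
  simp [asdForm_apply]
  ring

/-- On the components `p, q, r` the operator is the symmetric matrix `-2 T(b 0, b i, b 0, b j)`.
Three equations suffice since, by pair symmetry, `T` is anti-self-dual in its last two arguments as
well. -/
lemma mem_eigenspace_iff (h : IsKahlerWeylTensor J T) (A : IsAdapted J D b) (p q r μ : ℝ) :
    asdForm b p q r ∈ asdEigenspace J T μ ↔
      -2 * (p * T (b 0) (b 1) (b 0) (b 1) + q * T (b 0) (b 1) (b 0) (b 2)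
        + r * T (b 0) (b 1) (b 0) (b 3)) = μ * p ∧
      -2 * (p * T (b 0) (b 1) (b 0) (b 2) + q * T (b 0) (b 2) (b 0) (b 2)
        + r * T (b 0) (b 2) (b 0) (b 3)) = μ * q ∧
      -2 * (p * T (b 0) (b 1) (b 0) (b 3) + q * T (b 0) (b 2) (b 0) (b 3)
        + r * T (b 0) (b 3) (b 0) (b 3)) = μ * r := by
  have s1 : T (b 0) (b 2) (b 0) (b 1) = T (b 0) (b 1) (b 0) (b 2) := h.pair _ _ _ _
  have s2 : T (b 0) (b 3) (b 0) (b 1) = T (b 0) (b 1) (b 0) (b 3) := h.pair _ _ _ _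
  have s3 : T (b 0) (b 3) (b 0) (b 2) = T (b 0) (b 2) (b 0) (b 3) := h.pair _ _ _ _
  constructor
  · rintro ⟨-, e⟩
    have e1 := e (b 0) (b 1)
    have e2 := e (b 0) (b 2)
    have e3 := e (b 0) (b 3)
    rw [h.formAction_asdForm A] at e1 e2 e3
    rw [asdForm_basis_one, s1, s2] at e1
    rw [asdForm_basis_two, s3] at e2
    rw [asdForm_basis_three] at e3
    exact ⟨e1, e2, e3⟩
  · rintro ⟨e1, e2, e3⟩
    refine ⟨A.asdForm_mem p q r, fun Z U => ?_⟩
    rw [h.formAction_asdForm A, h.pair (b 0) (b 1), h.pair (b 0) (b 2), h.pair (b 0) (b 3),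
      h.eq_asdForm A Z U (b 0) (b 1), h.eq_asdForm A Z U (b 0) (b 2), h.eq_asdForm A Z U (b 0) (b 3),
      s1, s2, s3]
    simp only [asdForm_apply]
    linear_combination (b.repr Z 0 * b.repr U 1 - b.repr Z 1 * b.repr U 0
        - (b.repr Z 2 * b.repr U 3 - b.repr Z 3 * b.repr U 2)) * e1
      + (b.repr Z 0 * b.repr U 2 - b.repr Z 2 * b.repr U 0
        + (b.repr Z 1 * b.repr U 3 - b.repr Z 3 * b.repr U 1)) * e2
      + (b.repr Z 0 * b.repr U 3 - b.repr Z 3 * b.repr U 0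
        - (b.repr Z 1 * b.repr U 2 - b.repr Z 2 * b.repr U 1)) * e3

/-- The tensor is determined by its components in an adapted basis. -/
lemma eq_of_components {S : V → V → V → V → ℝ} (h : IsKahlerWeylTensor J T)
    (h' : IsKahlerWeylTensor J S) (A : IsAdapted J D b)
    (e₁ : T (b 0) (b 1) (b 0) (b 1) = S (b 0) (b 1) (b 0) (b 1))
    (e₂ : T (b 0) (b 1) (b 0) (b 2) = S (b 0) (b 1) (b 0) (b 2))
    (e₃ : T (b 0) (b 1) (b 0) (b 3) = S (b 0) (b 1) (b 0) (b 3))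
    (e₄ : T (b 0) (b 2) (b 0) (b 2) = S (b 0) (b 2) (b 0) (b 2))
    (e₅ : T (b 0) (b 2) (b 0) (b 3) = S (b 0) (b 2) (b 0) (b 3))
    (e₆ : T (b 0) (b 3) (b 0) (b 3) = S (b 0) (b 3) (b 0) (b 3)) (X Y Z U : V) :
    T X Y Z U = S X Y Z U := by
  rw [h.eq_asdForm A X Y, h'.eq_asdForm A X Y, h.pair (b 0) (b 1), h.pair (b 0) (b 2),
    h.pair (b 0) (b 3), h'.pair (b 0) (b 1), h'.pair (b 0) (b 2), h'.pair (b 0) (b 3)]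
  simp only [h.eq_asdForm A Z U, h'.eq_asdForm A Z U]
  rw [e₁, e₂, e₃, e₄, e₅, e₆, h.pair (b 0) (b 2) (b 0) (b 1), h.pair (b 0) (b 3) (b 0) (b 1),
    h.pair (b 0) (b 3) (b 0) (b 2), e₂, e₃, e₅, h'.pair (b 0) (b 2) (b 0) (b 1),
    h'.pair (b 0) (b 3) (b 0) (b 1), h'.pair (b 0) (b 3) (b 0) (b 2)]

end IsKahlerWeylTensor

/-- The weights in `K` are those that kill the Ricci contraction: `(1/6)(3/2) - 1/4 = 0` on `g` and
`-1 + 1 = 0` on `h`. -/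
lemma IsAdapted.tensorK_weyl (A : IsAdapted J D b) (c : ℝ) :
    IsKahlerWeylTensor J (fun X Y Z U => c * tensorK J D X Y Z U) := by
  refine ⟨(((A.tensorPi_kahler.smul (1 / 6)).sub A.tensorPhi_kahler).add
    A.tensorPsi_kahler).smul c, fun Y Z => ?_⟩
  have e1 := A.tensorPi_ricci Y Z
  have e2 := A.tensorPhi_ricci Y Z
  have e3 := A.tensorPsi_ricci Y Z
  simp only [ricciOf, tensorK, ← Finset.mul_sum, Finset.sum_add_distrib, Finset.sum_sub_distrib] at *
  rw [e1, e2, e3]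
  ring

/-- After multiplication by `-2`, the operator of `K` on `Λ⁻` is `diag(1/3, -1/6, -1/6)`. -/
lemma IsAdapted.tensorK_components (A : IsAdapted J D b) :
    tensorK J D (b 0) (b 1) (b 0) (b 1) = -1 / 6 ∧ tensorK J D (b 0) (b 1) (b 0) (b 2) = 0 ∧
    tensorK J D (b 0) (b 1) (b 0) (b 3) = 0 ∧ tensorK J D (b 0) (b 2) (b 0) (b 2) = 1 / 12 ∧
    tensorK J D (b 0) (b 2) (b 0) (b 3) = 0 ∧ tensorK J D (b 0) (b 3) (b 0) (b 3) = 1 / 12 := by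
  simp only [tensorK, tensorPi, tensorPhi, tensorPsi, A.hForm_eq, inner_repr b, A.repr_J₀,
    A.repr_J₁, A.repr_J₂, A.repr_J₃, repr_basis]
  simp
  norm_num

end
end QCH

/-! ### Eigenvalues on `Λ⁻` and the characterization of `K` -/

namespace QCH
section

set_option linter.unusedSectionVars false

variable {V : Type*} [NormedAddCommGroup V] [InnerProductSpace ℝ V] [FiniteDimensional ℝ V]
  {J : V →L[ℝ] V} {D : Submodule ℝ V} {b : OrthonormalBasis (Fin 4) ℝ V}
  {T : V → V → V → V → ℝ}

lemma asdForm_eq_zero_iff {p q r : ℝ} : asdForm b p q r = 0 ↔ p = 0 ∧ q = 0 ∧ r = 0 := by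
  constructor
  · intro h
    exact ⟨by rw [← asdForm_basis_one (b := b) p q r, h]; rfl,
      by rw [← asdForm_basis_two (b := b) p q r, h]; rfl,
      by rw [← asdForm_basis_three (b := b) p q r, h]; rfl⟩
  · rintro ⟨rfl, rfl, rfl⟩
    ext X Y
    simp [asdForm_apply]

lemma smul_asdForm (c p q r : ℝ) : c • asdForm b p q r = asdForm b (c * p) (c * q) (c * r) := by
  ext X Y
  simp only [LinearMap.smul_apply, asdForm_apply, smul_eq_mul]
  ring

lemma IsAdapted.mem_eigenspace_tensorK_iff (A : IsAdapted J D b) (c p q r μ : ℝ) :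
    asdForm b p q r ∈ asdEigenspace J (fun X Y Z U => c * tensorK J D X Y Z U) μ ↔
      (μ - c / 3) * p = 0 ∧ (μ + c / 6) * q = 0 ∧ (μ + c / 6) * r = 0 := by
  obtain ⟨k1, k2, k3, k4, k5, k6⟩ := A.tensorK_components
  rw [(A.tensorK_weyl c).mem_eigenspace_iff A, k1, k2, k3, k4, k5, k6]
  constructor
  · rintro ⟨h1, h2, h3⟩
    exact ⟨by linarith, by linarith, by linarith⟩
  · rintro ⟨h1, h2, h3⟩
    exact ⟨by linarith, by linarith, by linarith⟩

lemma IsAdapted.isDegenerate_tensorK (A : IsAdapted J D b) (c : ℝ) :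
    IsDegenerate J (fun X Y Z U => c * tensorK J D X Y Z U) := by
  refine (Set.encard_le_encard (t := {c / 3, -(c / 6)}) fun μ hμ => ?_).trans
    ((Set.encard_insert_le _ _).trans (by rw [Set.encard_singleton]; norm_num))
  obtain ⟨α, hα, hα0⟩ := (Submodule.ne_bot_iff _).1 hμ
  have e := A.eq_asdForm hα.1
  rw [e] at hα hα0
  obtain ⟨h1, h2, h3⟩ := (A.mem_eigenspace_tensorK_iff _ _ _ _ _).1 hα
  by_contra hc
  simp only [Set.mem_insert_iff, Set.mem_singleton_iff, not_or] at hc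
  have n1 : μ - c / 3 ≠ 0 := sub_ne_zero.2 hc.1
  have n2 : μ + c / 6 ≠ 0 := fun h => hc.2 (by linarith)
  exact hα0 (asdForm_eq_zero_iff.2 ⟨(mul_eq_zero.1 h1).resolve_left n1,
    (mul_eq_zero.1 h2).resolve_left n2, (mul_eq_zero.1 h3).resolve_left n2⟩)

lemma IsAdapted.isSimpleEigenform_tensorK (A : IsAdapted J D b) (c : ℝ) :
    IsSimpleEigenform J (fun X Y Z U => c * tensorK J D X Y Z U)
      (fundForm (oppositeOf J D)) := by
  rw [A.fundForm_opposite]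
  have h0 : asdForm b 1 0 0 ≠ 0 := by simp [asdForm_eq_zero_iff]
  refine ⟨h0, c / 3, (A.mem_eigenspace_tensorK_iff _ _ _ _ _).2 (by simp), fun hT => ?_⟩
  have hc : c ≠ 0 := by
    rintro rfl
    exact hT (by funext X Y Z U; simp)
  let := Module.addCommMonoidToAddCommGroup ℝ
    (M := asdEigenspace J (fun X Y Z U => c * tensorK J D X Y Z U) (c / 3))
  rw [finrank_eq_one_iff']
  refine ⟨⟨_, (A.mem_eigenspace_tensorK_iff c 1 0 0 (c / 3)).2 (by simp)⟩,
    fun h => h0 (congrArg Subtype.val h), ?_⟩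
  rintro ⟨α, hα⟩
  have e := A.eq_asdForm hα.1
  rw [e] at hα
  obtain ⟨-, h2, h3⟩ := (A.mem_eigenspace_tensorK_iff _ _ _ _ _).1 hα
  -- The eigenvalues `c/3` and `-c/6` are distinct for `c ≠ 0`, so the last two components vanish.
  have n : c / 3 + c / 6 ≠ 0 := fun h => hc (by linarith)
  refine ⟨α (b 0) (b 1), Subtype.ext ?_⟩
  change _ • asdForm b 1 0 0 = α
  rw [smul_asdForm, e, asdForm_basis_one, (mul_eq_zero.1 h2).resolve_left n,
    (mul_eq_zero.1 h3).resolve_left n]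
  simp

/-- The hypothesis is the characteristic equation of a symmetric `2 × 2` matrix. Off the diagonal
case, `(Q, l - P)` solves the first row identically and the second by that equation. -/
lemma exists_eigenvector_two {P Q S l : ℝ} (h : l ^ 2 - (P + S) * l + (P * S - Q ^ 2) = 0) :
    ∃ q r : ℝ, (q ≠ 0 ∨ r ≠ 0) ∧ P * q + Q * r = l * q ∧ Q * q + S * r = l * r := by
  by_cases hQ : Q = 0
  · subst hQ
    have : (l - P) * (l - S) = 0 := by linarith
    rcases mul_eq_zero.1 this with h | h
    · exact ⟨1, 0, by simp, by linarith, by ring⟩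
    · exact ⟨0, 1, by simp, by ring, by linarith⟩
  · exact ⟨Q, l - P, Or.inl hQ, by ring, by linarith⟩

/-- A degenerate trace-free operator for which the fundamental form of the opposite structure is an
eigenvector with simple eigenvalue is a multiple of `K`. -/
lemma IsKahlerWeylTensor.eq_tensorK (h : IsKahlerWeylTensor J T) (A : IsAdapted J D b)
    (hd : IsDegenerate J T) (hs : IsSimpleEigenform J T (fundForm (oppositeOf J D))) :
    ∃ μ : ℝ, fundForm (oppositeOf J D) ∈ asdEigenspace J T μ ∧
      ∀ X Y Z U, T X Y Z U = 3 * μ * tensorK J D X Y Z U := by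
  obtain ⟨-, μ, hμ, hsimple⟩ := hs
  refine ⟨μ, hμ, ?_⟩
  rw [A.fundForm_opposite] at hμ
  obtain ⟨m1, m2, m3⟩ := (h.mem_eigenspace_iff A _ _ _ _).1 hμ
  have t12 : T (b 0) (b 1) (b 0) (b 2) = 0 := by linarith
  have t13 : T (b 0) (b 1) (b 0) (b 3) = 0 := by linarith
  have tr := h.trace_eq_zero b
  -- The block of `T` complementary to the given eigenform must be scalar. Otherwise its
  -- discriminant is positive and it has two distinct real eigenvalues; simplicity of `μ` keeps them
  -- away from `μ`, and three eigenvalues contradict degeneracy.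
  have key : T (b 0) (b 2) (b 0) (b 3) = 0 ∧
      T (b 0) (b 2) (b 0) (b 2) = T (b 0) (b 3) (b 0) (b 3) := by
    by_contra hne
    have hT : T ≠ 0 := by
      rintro rfl
      simp at hne
    set P := -2 * T (b 0) (b 2) (b 0) (b 2) with hP
    set Q := -2 * T (b 0) (b 2) (b 0) (b 3) with hQ
    set S := -2 * T (b 0) (b 3) (b 0) (b 3) with hS
    have hdisc : 0 < (P - S) ^ 2 + 4 * Q ^ 2 := by
      rcases (by positivity : 0 ≤ (P - S) ^ 2 + 4 * Q ^ 2).lt_or_eq with h | h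
      · exact h
      · have a1 : Q ^ 2 = 0 := by nlinarith [sq_nonneg (P - S), sq_nonneg Q]
        have a2 : (P - S) ^ 2 = 0 := by nlinarith [sq_nonneg (P - S), sq_nonneg Q]
        have a1 := pow_eq_zero_iff (two_ne_zero) |>.1 a1
        have a2 := pow_eq_zero_iff (two_ne_zero) |>.1 a2
        exact absurd ⟨by linarith, by linarith⟩ hne
    set s := Real.sqrt ((P - S) ^ 2 + 4 * Q ^ 2) with hsdef
    have hs0 : 0 < s := Real.sqrt_pos.2 hdisc
    have hs2 : s ^ 2 = (P - S) ^ 2 + 4 * Q ^ 2 := Real.sq_sqrt hdisc.le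
    have eig (l : ℝ) (hl : l ^ 2 - (P + S) * l + (P * S - Q ^ 2) = 0) :
        ∃ q r : ℝ, (q ≠ 0 ∨ r ≠ 0) ∧ asdForm b 0 q r ∈ asdEigenspace J T l := by
      obtain ⟨q, r, hqr, e1, e2⟩ := exists_eigenvector_two hl
      refine ⟨q, r, hqr, (h.mem_eigenspace_iff A _ _ _ _).2 ⟨?_, ?_, ?_⟩⟩
      · rw [t12, t13]; ring
      · rw [← e1, hP, hQ]; ring
      · rw [← e2, hQ, hS]; ring
    have ne (l : ℝ) (hl : l ^ 2 - (P + S) * l + (P * S - Q ^ 2) = 0) : l ≠ μ := by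
      rintro rfl
      obtain ⟨q, r, hqr, hm⟩ := eig l hl
      have h1 := hsimple hT
      let := Module.addCommMonoidToAddCommGroup ℝ (M := asdEigenspace J T l)
      rw [finrank_eq_one_iff'] at h1
      obtain ⟨⟨v, hv⟩, -, hall⟩ := h1
      obtain ⟨c1, hc1⟩ := hall ⟨_, hμ⟩
      obtain ⟨c2, hc2⟩ := hall ⟨_, hm⟩
      have hc1 : c1 • v = asdForm b 1 0 0 := congrArg Subtype.val hc1
      have hc2 : c2 • v = asdForm b 0 q r := congrArg Subtype.val hc2
      -- Both eigenforms are multiples of `v`; cross-multiplying exposes their independence and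
      -- contradicts dimension one.
      have hz : c2 • asdForm b 1 0 0 = c1 • asdForm b 0 q r := by
        rw [← hc1, ← hc2, smul_comm]
      have f1 := congrArg (fun α : LinearMap.BilinForm ℝ V => α (b 0) (b 1)) hz
      have f2 := congrArg (fun α : LinearMap.BilinForm ℝ V => α (b 0) (b 2)) hz
      have f3 := congrArg (fun α : LinearMap.BilinForm ℝ V => α (b 0) (b 3)) hz
      simp only [smul_asdForm, asdForm_basis_one, asdForm_basis_two, asdForm_basis_three] at f1 f2 f3
      have hc2 : c2 = 0 := by linarith
      have hc1' : c1 ≠ 0 := by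
        rintro rfl
        rw [zero_smul] at hc1
        exact one_ne_zero (asdForm_eq_zero_iff.1 hc1.symm).1
      rcases hqr with hq | hr
      · exact (mul_ne_zero hc1' hq) (by linarith)
      · exact (mul_ne_zero hc1' hr) (by linarith)
    have r1 : ((P + S + s) / 2) ^ 2 - (P + S) * ((P + S + s) / 2) + (P * S - Q ^ 2) = 0 := by
      linear_combination hs2 / 4
    have r2 : ((P + S - s) / 2) ^ 2 - (P + S) * ((P + S - s) / 2) + (P * S - Q ^ 2) = 0 := by
      linear_combination hs2 / 4
    have mem (l : ℝ) (hl : l ^ 2 - (P + S) * l + (P * S - Q ^ 2) = 0) :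
        asdEigenspace J T l ≠ ⊥ := by
      obtain ⟨q, r, hqr, hm⟩ := eig l hl
      refine (Submodule.ne_bot_iff _).2 ⟨_, hm, fun h => ?_⟩
      obtain ⟨-, hq, hr⟩ := asdForm_eq_zero_iff.1 h
      rcases hqr with h' | h' <;> contradiction
    have sub : ({μ, (P + S + s) / 2, (P + S - s) / 2} : Set ℝ) ⊆ {μ | asdEigenspace J T μ ≠ ⊥} := by
      rintro l (rfl | rfl | rfl)
      · exact (Submodule.ne_bot_iff _).2 ⟨_, hμ, by simp [asdForm_eq_zero_iff]⟩
      · exact mem _ r1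
      · exact mem _ r2
    have card : ({μ, (P + S + s) / 2, (P + S - s) / 2} : Set ℝ).encard = 3 := by
      refine Set.encard_eq_three.2 ⟨_, _, _, (ne _ r1).symm, (ne _ r2).symm, fun h => ?_, rfl⟩
      linarith
    have := (Set.encard_le_encard sub).trans hd
    rw [card] at this
    norm_num at this
  obtain ⟨k1, k2, k3, k4, k5, k6⟩ := A.tensorK_components
  -- The eigenvalue equation gives `T(b 0, b 1, b 0, b 1) = -μ/2 = 3μ(-1/6)`; the two other diagonal
  -- entries are equal and, by zero trace, are `μ/4 = 3μ/12`.
  exact h.eq_of_components (A.tensorK_weyl (3 * μ)) A (by rw [k1]; linarith) (by rw [k2, t12]; ring)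
    (by rw [k3, t13]; ring) (by rw [k4]; linarith [key.2]) (by rw [k5, key.1]; ring)
    (by rw [k6]; linarith [key.2])

end
end QCH

/-! ### Existence of adapted bases and quasi-constant holomorphic curvature -/

namespace QCH
section

set_option linter.unusedSectionVars false

variable {V : Type*} [NormedAddCommGroup V] [InnerProductSpace ℝ V] [FiniteDimensional ℝ V]
  {J J' : V →L[ℝ] V} {D : Submodule ℝ V} {b : OrthonormalBasis (Fin 4) ℝ V}
  {R T : V → V → V → V → ℝ}

lemma IsOrthComplex.mem_orthogonal (hJ : IsOrthComplex J) (hD : ∀ v ∈ D, J v ∈ D) {v : V}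
    (hv : v ∈ Dᗮ) : J v ∈ Dᗮ := fun d hd => by
  have e := hJ.inner_left d v
  have e' : ⟪J d, v⟫ = 0 := hv _ (hD d hd)
  linarith

lemma exists_adapted_of_unit (hJ : IsOrthComplex J) (hV : Module.finrank ℝ V = 4)
    (hD : ∀ v ∈ D, J v ∈ D) {u v : V} (hu : u ∈ D) (hv : v ∈ Dᗮ) (hu1 : ‖u‖ = 1)
    (hv1 : ‖v‖ = 1) :
    ∃ b : OrthonormalBasis (Fin 4) ℝ V, IsAdapted J D b ∧
      b 0 = u ∧ b 1 = J u ∧ b 2 = v ∧ b 3 = J v := by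
  have hJu := hD u hu
  have hJv := hJ.mem_orthogonal hD hv
  have huu : ⟪u, u⟫ = 1 := by rw [real_inner_self_eq_norm_sq, hu1]; norm_num
  have hvv : ⟪v, v⟫ = 1 := by rw [real_inner_self_eq_norm_sq, hv1]; norm_num
  have o {x y : V} (hx : x ∈ D) (hy : y ∈ Dᗮ) : ⟪x, y⟫ = 0 := hy x hx
  have o' {x y : V} (hx : x ∈ D) (hy : y ∈ Dᗮ) : ⟪y, x⟫ = 0 := by
    rw [real_inner_comm]; exact hy x hx
  have ju : ⟪J u, u⟫ = 0 := by rw [real_inner_comm, hJ.inner_self]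
  have jv : ⟪J v, v⟫ = 0 := by rw [real_inner_comm, hJ.inner_self]
  have ho : Orthonormal ℝ ![u, J u, v, J v] := by
    rw [orthonormal_iff_ite]
    intro i j
    fin_cases i <;> fin_cases j <;>
    simp [hJ.orth, hJ.inner_self, ju, jv, huu, hvv, o hu hv, o hu hJv, o hJu hv,
      o' hu hv, o' hu hJv, o' hJu hv, -inner_self_eq_norm_sq_to_K]
  have hs : ⊤ ≤ Submodule.span ℝ (Set.range ![u, J u, v, J v]) := by
    rw [(linearIndependent_of_ne_zero_of_inner_eq_zero (𝕜 := ℝ) (fun i => ho.ne_zero i)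
      ho.2).span_eq_top_of_card_eq_finrank (by simp [hV])]
  refine ⟨OrthonormalBasis.mk ho hs, ⟨hJ, by simp, by simp, ?_, ?_, ?_, ?_⟩, by simp, by simp,
    by simp, by simp⟩ <;> simpa

lemma exists_unit_mem {D : Submodule ℝ V} (hD : Module.finrank ℝ D ≠ 0) : ∃ u ∈ D, ‖u‖ = 1 := by
  have : Nontrivial D := Module.nontrivial_of_finrank_pos (R := ℝ) (Nat.pos_of_ne_zero hD)
  obtain ⟨u, hu⟩ := exists_norm_eq D (zero_le_one' ℝ)
  exact ⟨u, u.2, hu⟩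

lemma exists_adapted (hJ : IsOrthComplex J) (hV : Module.finrank ℝ V = 4)
    (hD : ∀ v ∈ D, J v ∈ D) (h2 : Module.finrank ℝ D = 2) :
    ∃ b : OrthonormalBasis (Fin 4) ℝ V, IsAdapted J D b := by
  obtain ⟨u, hu, hu1⟩ := exists_unit_mem (D := D) (by omega)
  obtain ⟨v, hv, hv1⟩ := exists_unit_mem (D := Dᗮ)
    (by have := D.finrank_add_finrank_orthogonal; omega)
  obtain ⟨b, A, -⟩ := exists_adapted_of_unit hJ hV hD hu hv hu1 hv1
  exact ⟨b, A⟩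

namespace IsAdapted

lemma opposite_complex (A : IsAdapted J D b) : IsOrthComplex (oppositeOf J D) := by
  constructor
  · intro v
    rw [A.opposite_apply]
    conv_rhs => rw [sum_repr_four b v]
    simp only [A.opposite_apply, repr_basis, map_add, map_sub, map_smul, PiLp.add_apply,
      PiLp.sub_apply, PiLp.smul_apply, smul_eq_mul]
    simp
    abel
  · intro v w
    simp only [A.opposite_apply, inner_repr b, repr_basis, map_add, map_sub, map_smul,
      PiLp.add_apply, PiLp.sub_apply, PiLp.smul_apply, smul_eq_mul]
    simp
    ring

lemma opposite_volForm (A : IsAdapted J D b) (X Y Z U : V) :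
    volForm (oppositeOf J D) X Y Z U = -volForm J X Y Z U := by
  have e (X Y : V) : fundForm J X Y = b.repr X 0 * b.repr Y 1 - b.repr X 1 * b.repr Y 0
      + (b.repr X 2 * b.repr Y 3 - b.repr X 3 * b.repr Y 2) := by
    change ⟪J X, Y⟫ = _
    rw [inner_repr b, A.repr_J₀, A.repr_J₁, A.repr_J₂, A.repr_J₃]
    ring
  simp only [volForm, A.fundForm_opposite, asdForm_apply, e]
  ring

lemma ricci_eq (A : IsAdapted J D b) {p q r : ℝ}
    (h : ∀ X Y Z U, R X Y Z U = p * tensorPi J X Y Z U + q * tensorPhi J D X Y Z U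
      + r * tensorPsi J D X Y Z U) (Y Z : V) :
    ricciOf R Y Z = (3 / 2 * p + q / 4) * ⟪Y, Z⟫ + (q + r) * hForm D Y Z := by
  have e1 := A.tensorPi_ricci Y Z
  have e2 := A.tensorPhi_ricci Y Z
  have e3 := A.tensorPsi_ricci Y Z
  simp only [ricciOf] at e1 e2 e3 ⊢
  simp only [h, Finset.sum_add_distrib, ← Finset.mul_sum, e1, e2, e3]
  ring

lemma kahler_of_eq (A : IsAdapted J D b) (p q r : ℝ) :
    IsKahlerTensor J (fun X Y Z U => p * tensorPi J X Y Z U + q * tensorPhi J D X Y Z U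
      + r * tensorPsi J D X Y Z U) :=
  ((A.tensorPi_kahler.smul p).add (A.tensorPhi_kahler.smul q)).add (A.tensorPsi_kahler.smul r)

/-- Only `Ψ` contributes to `W⁻`: with the Ricci tensor from `ricci_eq`, the subtracted tensor is
`(p - r/6)Π + (q + r)Φ`. -/
lemma weylMinusOf_eq_tensorK (A : IsAdapted J D b) {p q r : ℝ}
    (h : ∀ X Y Z U, R X Y Z U = p * tensorPi J X Y Z U + q * tensorPhi J D X Y Z U
      + r * tensorPsi J D X Y Z U) (X Y Z U : V) :
    weylMinusOf J R X Y Z U = r * tensorK J D X Y Z U := by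
  obtain rfl : R = _ := funext fun X => funext fun Y => funext fun Z => funext fun U => h X Y Z U
  rw [A.weylMinusOf_eq (A.kahler_of_eq p q r) (A.ricci_eq fun _ _ _ _ => rfl), tensorK]
  ring

lemma hForm_opposite (A : IsAdapted J D b) (X Y : V) :
    hForm D (oppositeOf J D X) (oppositeOf J D Y) = hForm D X Y := by
  simp only [A.hForm_eq, A.opposite_apply, repr_basis, map_add, map_sub, map_smul,
      PiLp.add_apply, PiLp.sub_apply, PiLp.smul_apply, smul_eq_mul]
  simp
  ring

lemma holomorphic_eq (A : IsAdapted J D b) {p q r : ℝ}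
    (h : ∀ X Y Z U, R X Y Z U = p * tensorPi J X Y Z U + q * tensorPhi J D X Y Z U
      + r * tensorPsi J D X Y Z U) (X : V) :
    R X (J X) (J X) X = p * ⟪X, X⟫ ^ 2 + q * (⟪X, X⟫ * ‖D.starProjection X‖ ^ 2)
      + r * ‖D.starProjection X‖ ^ 4 := by
  have e : ‖D.starProjection X‖ ^ 4 = (‖D.starProjection X‖ ^ 2) ^ 2 := by ring
  simp only [h, e, A.norm_proj, tensorPi, tensorPhi, tensorPsi, A.hForm_eq, inner_repr b,
    A.repr_J₀, A.repr_J₁, A.repr_J₂, A.repr_J₃]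
  ring

end IsAdapted

lemma IsKahlerTensor.holomorphic_smul (h : IsKahlerTensor J R) (c : ℝ) (X : V) :
    R (c • X) (J (c • X)) (J (c • X)) (c • X) = c ^ 4 * R X (J X) (J X) X := by
  rw [map_smul, h.smul₁, h.smul₂, h.smul₃, h.smul₄]
  ring

/-- A Kähler tensor of quasi-constant holomorphic sectional curvature is a combination of the
three basic tensors. -/
lemma IsKahlerTensor.eq_of_quasiConstant (h : IsKahlerTensor J R) (A : IsAdapted J D b)
    {φ : ℝ → ℝ} (hφ : ∀ X : V, ‖X‖ = 1 → R X (J X) (J X) X = φ ‖D.starProjection X‖) :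
    ∃ p q r : ℝ, ∀ X Y Z U, R X Y Z U = p * tensorPi J X Y Z U + q * tensorPhi J D X Y Z U
      + r * tensorPsi J D X Y Z U := by
  set u := b 0 with hu
  set v := b 2 with hv
  set m := mixed J R u v with hm
  set p := R v (J v) (J v) v with hp
  set H := R u (J u) (J u) u with hH
  -- These are the coefficients of `1, s², s⁴` in `H s⁴ + m s² t² + p t⁴` when `t² = 1 - s²`.
  refine ⟨p, m - 2 * p, H - m + p, fun X Y Z U => ?_⟩
  set S : V → V → V → V → ℝ := fun X Y Z U => p * tensorPi J X Y Z U
    + (m - 2 * p) * tensorPhi J D X Y Z U + (H - m + p) * tensorPsi J D X Y Z U with hS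
  have hSK : IsKahlerTensor J S := A.kahler_of_eq _ _ _
  have hol (X : V) (hX : ‖X‖ = 1) : R X (J X) (J X) X = S X (J X) (J X) X := by
    rw [A.holomorphic_eq (R := S) (fun _ _ _ _ => rfl), real_inner_self_eq_norm_sq, hX]
    set s := ‖D.starProjection X‖ with hs
    have hs0 : 0 ≤ s := norm_nonneg _
    have hs1 : s ≤ 1 := hX ▸ D.norm_starProjection_apply_le X
    set t := Real.sqrt (1 - s ^ 2) with ht
    have ht2 : t ^ 2 = 1 - s ^ 2 := Real.sq_sqrt (by nlinarith)
    -- The vectors `s u ± t v` are unit with the same projection length as `X`, so the hypothesis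
    -- gives them the same curvature. Averaging over the sign removes the odd terms.
    have key (ε : ℝ) (hε : ε ^ 2 = 1) : R (s • u + (ε * t) • v) (J (s • u + (ε * t) • v))
        (J (s • u + (ε * t) • v)) (s • u + (ε * t) • v) = R X (J X) (J X) X := by
      have n1 : ‖s • u + (ε * t) • v‖ = 1 := by
        rw [← sq_eq_sq₀ (norm_nonneg _) zero_le_one, ← real_inner_self_eq_norm_sq, inner_repr b]
        simp [hu, hv]
        linear_combination t ^ 2 * hε + ht2
      have n2 : ‖D.starProjection (s • u + (ε * t) • v)‖ = s := by
        rw [← sq_eq_sq₀ (norm_nonneg _) hs0, A.norm_proj]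
        simp [hu, hv]
      rw [hφ _ n1, hφ _ hX, n2]
    have e := h.holomorphic_add_sub A.complex (s • u) (t • v)
    have k1 := key 1 (by norm_num)
    have k2 := key (-1) (by norm_num)
    rw [one_mul] at k1
    rw [neg_one_mul, neg_smul] at k2
    have em : mixed J R (s • u) (t • v) = s ^ 2 * t ^ 2 * m := by
      simp only [hm, mixed, map_smul, h.smul₁, h.smul₂, h.smul₃, h.smul₄]
      ring
    rw [k1, k2, h.holomorphic_smul, h.holomorphic_smul, em] at e
    have t4 : t ^ 4 = (1 - s ^ 2) ^ 2 := by rw [← ht2]; ring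
    rw [t4, ht2] at e
    linear_combination e / 2
  have key := (h.sub hSK).eq_zero_of_holomorphic A.complex (fun X => ?_) X Y Z U
  · exact sub_eq_zero.1 key
  -- Homogeneity of degree four passes from unit vectors to all vectors.
  · rcases eq_or_ne X 0 with rfl | hX
    · have := (h.sub hSK).smul₁ 0 0 (J 0) (J 0) 0
      rwa [zero_smul, zero_mul] at this
    · have e := (h.sub hSK).holomorphic_smul ‖X‖ (‖X‖⁻¹ • X)
      rw [smul_inv_smul₀ (norm_ne_zero_iff.2 hX)] at e
      have n : ‖‖X‖⁻¹ • X‖ = 1 := by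
        rw [norm_smul, norm_inv, norm_norm, inv_mul_cancel₀ (norm_ne_zero_iff.2 hX)]
      rw [e, hol _ n, sub_self, mul_zero]

end
end QCH

/-! ### Negative complex structures and the pointwise converse -/

namespace QCH
section

set_option linter.unusedSectionVars false

variable {V : Type*} [NormedAddCommGroup V] [InnerProductSpace ℝ V] [FiniteDimensional ℝ V]
  {J J' : V →L[ℝ] V} {D : Submodule ℝ V} {b : OrthonormalBasis (Fin 4) ℝ V}
  {R T : V → V → V → V → ℝ}

section Negative

/-- The form `ω` is self-dual for `J`, hence anti-self-dual for `J'`. Writing the star of `J'` by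
`hodgeStar_eq` turns this into `JJ' = J'J - σ/2`. As `JJ'` and `J'J` are adjoint, their diagonal
entries agree and `σ = 0`. -/
lemma IsOrthComplex.trace_and_commute (hJ : IsOrthComplex J) (hJ' : IsOrthComplex J')
    (hv : ∀ X Y Z U, volForm J' X Y Z U = -volForm J X Y Z U)
    (b : OrthonormalBasis (Fin 4) ℝ V) :
    ∑ i, ⟪J (b i), J' (b i)⟫ = 0 ∧ ∀ X, J (J' X) = J' (J X) := by
  have hα (X Y : V) : fundForm J Y X = -fundForm J X Y := by
    change ⟪J Y, X⟫ = -⟪J X, Y⟫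
    rw [hJ.inner_left, real_inner_comm]
  have hs (X Y : V) : hodgeStar J' (fun A B => fundForm J A B) X Y
      = -hodgeStar J (fun A B => fundForm J A B) X Y := by
    simp only [hodgeStar, hv, mul_neg, Finset.sum_neg_distrib]
  have h1 (X Y : V) : hodgeStar J (fun A B => fundForm J A B) X Y = ⟪J X, Y⟫ := by
    rw [hodgeStar_eq hJ _ hα b]
    change (1 / 2) * (∑ i, ⟪J (b i), J (b i)⟫) * ⟪J X, Y⟫ - ⟪J (J X), J Y⟫ = _
    simp only [hJ.orth, b.inner_eq_one]
    simp
    ring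
  set σ := ∑ i, ⟪J (b i), J' (b i)⟫ with hσ
  have h2 (X : V) : J (J' X) = J' (J X) - (σ / 2) • X := by
    have e : -J' (J (J' X)) = J X + (σ / 2) • J' X := by
      refine ext_inner_right ℝ fun Y => ?_
      have e1 := hs X Y
      rw [h1, hodgeStar_eq hJ' _ hα b] at e1
      change (1 / 2) * σ * ⟪J' X, Y⟫ - ⟪J (J' X), J' Y⟫ = _ at e1
      rw [inner_neg_left, hJ'.inner_left, inner_add_left, real_inner_smul_left]
      linarith
    have e2 := congrArg J' e
    rw [map_neg, hJ'.sq, neg_neg, map_add, map_smul, hJ'.sq, smul_neg] at e2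
    rw [e2, sub_eq_add_neg]
  have h3 : σ = 0 := by
    have e1 (i : Fin 4) : ⟪J (J' (b i)), b i⟫ = ⟪J' (J (b i)), b i⟫ - σ / 2 := by
      rw [h2, inner_sub_left, real_inner_smul_left, b.inner_eq_one, mul_one]
    have e2 (i : Fin 4) : ⟪J (J' (b i)), b i⟫ = ⟪J' (J (b i)), b i⟫ := by
      rw [hJ.inner_left, hJ'.inner_left, real_inner_comm, neg_neg]
    linarith [e1 0, e2 0]
  refine ⟨h3, fun X => ?_⟩
  rw [h2, h3, zero_div, zero_smul, sub_zero]

/-- A negative orthogonal complex structure is the opposite of `J` with respect to the kernel of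
`J J' + 1`. -/
lemma IsOrthComplex.negative_structure (hJ : IsOrthComplex J) (hJ' : IsOrthComplex J')
    (hv : ∀ X Y Z U, volForm J' X Y Z U = -volForm J X Y Z U)
    (hV : Module.finrank ℝ V = 4)
    (hD : D = LinearMap.ker ((J ∘L J' + ContinuousLinearMap.id ℝ _).toLinearMap)) :
    (∀ v, D.starProjection v = (1 / 2 : ℝ) • (v - J (J' v))) ∧
    Module.finrank ℝ D = 2 ∧ (∀ v ∈ D, J v ∈ D) ∧ oppositeOf J D = J' ∧
    Dᗮ = LinearMap.ker ((J ∘L J' - ContinuousLinearMap.id ℝ _).toLinearMap) := by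
  let b := (stdOrthonormalBasis ℝ V).reindex (finCongr hV)
  obtain ⟨htr, hc⟩ := hJ.trace_and_commute hJ' hv b
  have mem (v : V) : v ∈ D ↔ J (J' v) = -v := by
    rw [hD, LinearMap.mem_ker]
    exact add_eq_zero_iff_eq_neg
  have sq (v : V) : J (J' (J (J' v))) = v := by
    rw [← hc (J' v), hJ.sq, hJ'.sq, neg_neg]
  have sym (v w : V) : ⟪J (J' v), w⟫ = ⟪v, J (J' w)⟫ := by
    rw [hJ.inner_left, hJ'.inner_left, neg_neg, hc]
  have hsub (v : V) : v - J (J' v) ∈ D := by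
    rw [mem, map_sub, map_sub, sq, neg_sub]
  -- `JJ'` is a symmetric involution, so its `-1` and `+1` eigenspaces are orthogonal complements,
  -- with projection `½(1 - JJ')` onto the first.
  have orth (v : V) : v ∈ Dᗮ ↔ J (J' v) = v := by
    constructor
    · intro h
      have e1 := h _ (hsub v)
      have e2 := sym (v - J (J' v)) v
      rw [(mem _).1 (hsub v), inner_neg_left, e1, neg_zero] at e2
      have e3 : ⟪v - J (J' v), v - J (J' v)⟫ = 0 := by
        rw [inner_sub_right, e1, ← e2, sub_zero]
      exact (sub_eq_zero.1 (inner_self_eq_zero.1 e3)).symm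
    · intro h d hd
      have e := sym d v
      rw [h, (mem d).1 hd, inner_neg_left] at e
      linarith
  have proj (v : V) : D.starProjection v = (1 / 2 : ℝ) • (v - J (J' v)) := by
    refine Submodule.eq_starProjection_of_mem_orthogonal (D.smul_mem _ (hsub v)) ((orth _).2 ?_)
    simp only [map_sub, map_smul, sq]
    module
  refine ⟨proj, ?_, fun v hv => ?_, ?_, ?_⟩
  -- The dimension is the trace of the projection, which is `½ · 4` because `JJ'` has trace zero.
  · have h1 : LinearMap.IsProj D D.starProjection.toLinearMap :=
      ⟨fun v => D.starProjection_apply_mem v,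
        fun v hv => Submodule.starProjection_eq_self_iff.2 hv⟩
    have h2 := h1.trace
    rw [LinearMap.trace_eq_sum_inner _ b] at h2
    have h3 (i : Fin 4) : ⟪b i, D.starProjection (b i)⟫
        = (1 / 2 : ℝ) * (1 + ⟪J (b i), J' (b i)⟫) := by
      rw [proj, real_inner_smul_right, inner_sub_right, b.inner_eq_one, hJ.inner_left]
      ring
    simp only [ContinuousLinearMap.coe_coe, h3, ← Finset.mul_sum, Finset.sum_add_distrib, htr] at h2
    norm_num at h2
    exact_mod_cast h2.symm
  · rw [mem] at hv ⊢
    rw [← hc, hv, map_neg]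
  · ext v
    have e : Dᗮ.starProjection v = v - D.starProjection v := by
      rw [Submodule.starProjection_orthogonal]; rfl
    change J (D.starProjection v - Dᗮ.starProjection v) = J' v
    have e' : D.starProjection v - Dᗮ.starProjection v = -J (J' v) := by
      rw [e, proj]; module
    rw [e', map_neg, hJ.sq, neg_neg]
  · ext v
    rw [orth, LinearMap.mem_ker]
    exact sub_eq_zero.symm

end Negative

lemma formInner_fundForm (hJ' : IsOrthComplex J') (hV : Module.finrank ℝ V = 4) :
    formInner (fun A B => fundForm J' A B) (fun A B => fundForm J' A B) = 2 := by
  have e (v : V) : ∑ j, ⟪J' v, stdOrthonormalBasis ℝ V j⟫ * ⟪J' v, stdOrthonormalBasis ℝ V j⟫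
      = ⟪v, v⟫ := by
    rw [← hJ'.orth v v, ← (stdOrthonormalBasis ℝ V).sum_inner_mul_inner (J' v) (J' v)]
    exact Finset.sum_congr rfl fun j _ => by rw [real_inner_comm (J' v) (stdOrthonormalBasis ℝ V j)]
  change (1 / 2) * ∑ i, ∑ j, ⟪J' (stdOrthonormalBasis ℝ V i), stdOrthonormalBasis ℝ V j⟫
    * ⟪J' (stdOrthonormalBasis ℝ V i), stdOrthonormalBasis ℝ V j⟫ = 2
  simp only [e, OrthonormalBasis.inner_eq_one]
  simp [hV]
  norm_num

/-- With the normalization of `κ` this reads `κ = 6μ`, which identifies `3μ K` with `(κ/2) K`. -/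
lemma formInner_action (hJ' : IsOrthComplex J') (hV : Module.finrank ℝ V = 4) {μ : ℝ}
    (h : fundForm J' ∈ asdEigenspace J T μ) :
    formInner (formAction T (fun A B => fundForm J' A B)) (fun A B => fundForm J' A B)
      = 2 * μ := by
  have e := formInner_fundForm hJ' hV
  have e' : formAction T (fun A B => fundForm J' A B) = fun A B => μ * fundForm J' A B :=
    funext fun A => funext fun B => h.2 A B
  rw [e']
  simp only [formInner, mul_assoc, ← Finset.mul_sum] at e ⊢
  linear_combination μ * e

namespace IsAdapted

lemma hForm_orthogonal (A : IsAdapted J D b) (X Y : V) :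
    hForm Dᗮ X Y = ⟪X, Y⟫ - hForm D X Y := by
  rw [A.hForm_eq, hForm, A.orthProj_eq, A.orthProj_eq, inner_repr b, inner_repr b]
  simp
  ring

lemma scalar_eq (A : IsAdapted J D b) (h : IsKahlerTensor J R) {p q : ℝ}
    (hr : ∀ Y Z, ricciOf R Y Z = p * ⟪Y, Z⟫ + q * hForm D Y Z) : scalarOf R = 4 * p + 2 * q := by
  rw [h.scalarOf_eq b, Fin.sum_univ_four]
  simp only [hr, A.hForm_eq, inner_repr b, repr_basis]
  simp
  ring

/-- Invariance under both structures makes `D` and its complement Ricci-orthogonal; on each of these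
planes a `J`-invariant symmetric form is a multiple of the metric. -/
lemma exists_ricci_eq (A : IsAdapted J D b) (h : IsKahlerTensor J R)
    (hinv : ∀ X Y, ricciOf R (oppositeOf J D X) (oppositeOf J D Y) = ricciOf R X Y) :
    ∃ p q : ℝ, ∀ Y Z, ricciOf R Y Z = p * ⟪Y, Z⟫ + q * hForm D Y Z := by
  set r := h.ricciForm with hr
  have sy (X Y : V) : r X Y = r Y X := h.ricciOf_symm X Y
  have j (X Y : V) : r (J X) (J Y) = r X Y := h.ricciOf_inv A.complex X Y
  have o (X Y : V) : r (oppositeOf J D X) (oppositeOf J D Y) = r X Y := hinv X Y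
  have o0 : oppositeOf J D (b 0) = b 1 := by rw [A.opposite_apply]; simp
  have o1 : oppositeOf J D (b 1) = -b 0 := by rw [A.opposite_apply]; simp
  have o2 : oppositeOf J D (b 2) = -b 3 := by rw [A.opposite_apply]; simp
  have o3 : oppositeOf J D (b 3) = b 2 := by rw [A.opposite_apply]; simp
  have j00 := j (b 0) (b 0)
  have j01 := j (b 0) (b 1)
  have j22 := j (b 2) (b 2)
  have j23 := j (b 2) (b 3)
  have j02 := j (b 0) (b 2)
  have j03 := j (b 0) (b 3)
  have p02 := o (b 0) (b 2)
  have p03 := o (b 0) (b 3)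
  simp only [A.J₀, A.J₁, A.J₂, A.J₃, o0, o2, o3, map_neg] at j00 j01 j22 j23 j02 j03 p02 p03
  have s (i k : Fin 4) := sy (b i) (b k)
  refine ⟨r (b 2) (b 2), r (b 0) (b 0) - r (b 2) (b 2), fun Y Z => ?_⟩
  change r Y Z = _
  have z01 : r (b 0) (b 1) = 0 := by linarith [s 0 1]
  have z02 : r (b 0) (b 2) = 0 := by linarith
  have z03 : r (b 0) (b 3) = 0 := by linarith
  have z12 : r (b 1) (b 2) = 0 := by linarith
  have z13 : r (b 1) (b 3) = 0 := by linarith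
  have z23 : r (b 2) (b 3) = 0 := by linarith [s 2 3]
  rw [bilin_eq_repr b r Y Z]
  simp only [Fin.sum_univ_four, s 1 0, s 2 0, s 3 0, s 2 1, s 3 1, s 3 2, z01, z02, z03, z12, z13,
    z23, j00, j22, A.hForm_eq, inner_repr b]
  ring

lemma weylMinusOf_weyl (A : IsAdapted J D b) (h : IsKahlerTensor J R) {p q : ℝ}
    (hr : ∀ Y Z, ricciOf R Y Z = p * ⟪Y, Z⟫ + q * hForm D Y Z) :
    IsKahlerWeylTensor J (weylMinusOf J R) := by
  have e : weylMinusOf J R = _ := funext fun X => funext fun Y => funext fun Z => funext fun U =>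
    A.weylMinusOf_eq h hr X Y Z U
  rw [e]
  refine ⟨h.sub ((A.tensorPi_kahler.smul _).add (A.tensorPhi_kahler.smul q)), fun Y Z => ?_⟩
  have e1 := A.tensorPi_ricci Y Z
  have e2 := A.tensorPhi_ricci Y Z
  have e3 := hr Y Z
  simp only [ricciOf] at e1 e2 e3 ⊢
  simp only [Finset.sum_sub_distrib, Finset.sum_add_distrib, ← Finset.mul_sum, e1, e2, e3]
  ring

/-- The structure of the curvature tensor of a Kähler surface at a point where the Ricci tensor is
invariant under the opposite complex structure. -/
lemma converse (A : IsAdapted J D b) (h : IsKahlerTensor J R)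
    (hinv : ∀ X Y, ricciOf R (oppositeOf J D X) (oppositeOf J D Y) = ricciOf R X Y)
    {κ : ℝ} (hκ : κ = 3 * formInner (formAction (weylMinusOf J R)
      (fun A B => fundForm (oppositeOf J D) A B)) (fun A B => fundForm (oppositeOf J D) A B)) :
    ((IsDegenerate J (weylMinusOf J R) ∧
        IsSimpleEigenform J (weylMinusOf J R) (fundForm (oppositeOf J D))) ↔
      ∀ X Y Z U, weylMinusOf J R X Y Z U = κ / 2 * tensorK J D X Y Z U) ∧
    ∃ δ : ℝ, (∀ X Y, ricciZeroOf R X Y = δ * (hForm D X Y - hForm Dᗮ X Y)) ∧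
      ∀ X Y Z U, R X Y Z U = weylMinusOf J R X Y Z U
        + (scalarOf R / 6 - δ) * tensorPi J X Y Z U + 2 * δ * tensorPhi J D X Y Z U := by
  have hV : Module.finrank ℝ V = 4 := by simpa using Module.finrank_eq_card_basis b.toBasis
  obtain ⟨p, q, hr⟩ := A.exists_ricci_eq h hinv
  have hW := A.weylMinusOf_weyl h hr
  -- From `Ric = p g + q h` and `τ = 4p + 2q` one gets `Ric₀ = q h - (q/2) g`, so `δ = q/2`.
  refine ⟨⟨fun hd X Y Z U => ?_, fun hK => ?_⟩, q / 2, fun X Y => ?_, fun X Y Z U => ?_⟩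
  · obtain ⟨μ, hμ, e⟩ := hW.eq_tensorK A hd.1 hd.2
    rw [e, hκ, formInner_action A.opposite_complex hV hμ]
    ring
  · have e : weylMinusOf J R = fun X Y Z U => κ / 2 * tensorK J D X Y Z U :=
      funext fun X => funext fun Y => funext fun Z => funext fun U => hK X Y Z U
    rw [e]
    exact ⟨A.isDegenerate_tensorK _, A.isSimpleEigenform_tensorK _⟩
  · rw [ricciZeroOf, hr, A.scalar_eq h hr, A.hForm_orthogonal]
    ring
  · rw [A.weylMinusOf_eq h hr, A.scalar_eq h hr]
    ring

end IsAdapted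
end
end QCH

/-! ### Smooth frames and smoothness of coefficients -/

namespace QCH
section
open Filter
open scoped Topology

set_option linter.unusedSectionVars false

variable {M : Type*} [TopologicalSpace M] [ChartedSpace E4 M] [IsManifold (𝓡 4) ∞ M]

/-- In a trivialization, `A` is the finite sum of `⟪b i, ·⟫` times the image of the local frame
field `s i`, so smoothness of these images is enough. -/
lemma isSmoothEndo_of_smoothNear
    {A : ∀ x : M, TangentSpace (𝓡 4) x →L[ℝ] TangentSpace (𝓡 4) x}
    (h : ∀ (x : M) (X : ∀ x : M, TangentSpace (𝓡 4) x), SmoothNear X x →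
      SmoothNear (fun y => A y (X y)) x) : IsSmoothEndo A := by
  intro x
  rw [contMDiffAt_hom_bundle]
  refine ⟨contMDiffAt_id, ?_⟩
  let t := trivializationAt E4 (TangentSpace (𝓡 4) (M := M)) x
  have hx : x ∈ t.baseSet := FiberBundle.mem_baseSet_trivializationAt' x
  let b := EuclideanSpace.basisFun (Fin 4) ℝ
  let s := t.localFrame b.toBasis
  have hbs : ∀ᶠ y in 𝓝 x, y ∈ t.baseSet := t.open_baseSet.mem_nhds hx
  have hs (i) : SmoothNear (s i) x := by
    filter_upwards [hbs] with y hy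
    exact contMDiffAt_localFrame_of_mem ∞ t b.toBasis i hy
  have hc (i) : ContMDiffAt (𝓡 4) 𝓘(ℝ, E4) ∞ (fun y => (t ⟨y, A y (s i y)⟩).2) x :=
    (Bundle.contMDiffAt_section _).1 (h x _ (hs i)).at
  have hsum : ContMDiffAt (𝓡 4) 𝓘(ℝ, E4 →L[ℝ] E4) ∞
      (fun y => ∑ i, ContinuousLinearMap.smulRightL ℝ E4 E4 (innerSL ℝ (b i))
        (t ⟨y, A y (s i y)⟩).2) x :=
    contMDiffAt_finsetSum fun i _ =>
      (ContinuousLinearMap.smulRightL ℝ E4 E4 (innerSL ℝ (b i))).contMDiff.contMDiffAt.comp x (hc i)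
  refine hsum.congr_of_eventuallyEq ?_
  filter_upwards [hbs] with y hy
  ext1 v
  simp only [_root_.sum_apply, ContinuousLinearMap.smulRightL_apply_apply,
    ContinuousLinearMap.smulRight_apply, innerSL_apply_apply]
  have e (i) : (t ⟨y, A y (s i y)⟩).2 = ContinuousLinearMap.inCoordinates E4
      (TangentSpace (𝓡 4) (M := M)) E4 (TangentSpace (𝓡 4) (M := M)) x y x y (A y) (b i) := by
    have e1 : s i y = t.symm y (b i) := by
      simp [s, hy, Trivialization.basisAt]
    rw [ContinuousLinearMap.inCoordinates]
    simp only [ContinuousLinearMap.coe_comp, Function.comp_apply]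
    rw [Trivialization.continuousLinearMapAt_apply, Trivialization.coe_linearMapAt_of_mem _ hy, e1,
      Trivialization.symmL_apply _ hy]
  simp only [e]
  conv_lhs => rw [← b.sum_repr' v]
  rw [map_sum]
  simp only [map_smul]

variable [RiemannianBundle (fun x : M => TangentSpace (𝓡 4) x)]
  [IsContMDiffRiemannianBundle (𝓡 4) ∞ E4 (fun x : M => TangentSpace (𝓡 4) x)]
  {J J' : ∀ x : M, TangentSpace (𝓡 4) x →L[ℝ] TangentSpace (𝓡 4) x}
  {D : ∀ x : M, Submodule ℝ (TangentSpace (𝓡 4) x)}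
  {X : ∀ x : M, TangentSpace (𝓡 4) x} {x : M}

lemma IsAlmostHermitian.orthComplex (hJ : IsAlmostHermitian J) (x : M) : IsOrthComplex (J x) :=
  ⟨hJ.sq x, hJ.orthogonal x⟩

/-- The symmetries of the curvature tensor of a Kähler surface. -/
lemma IsKahler.riemann_kahler (hJ : IsKahler J) (x : M) : IsKahlerTensor (J x) (riemann x) := by
  have sn (v : TangentSpace (𝓡 4) x) := smoothNear_extend v
  have ev (v : TangentSpace (𝓡 4) x) : FiberBundle.extend E4 v x = v := by simp
  have eq (X Y Z U : TangentSpace (𝓡 4) x) : riemann x X Y Z U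
      = ⟪curvatureField (FiberBundle.extend E4 X) (FiberBundle.extend E4 Y)
        (FiberBundle.extend E4 Z) x, U⟫ := rfl
  constructor
  · intro X X' Y Z U
    have e := riemann_apply ((sn X).add (sn X')) (sn Y) (sn Z) U
    rw [curvatureField_add_first (sn X) (sn X') (sn Y) (sn Z), inner_add_left] at e
    simp only [ev] at e
    exact e
  · intro c X Y Z U
    have e := riemann_apply ((sn X).smul (FunSmoothNear.const c)) (sn Y) (sn Z) U
    rw [curvatureField_smul_first (FunSmoothNear.const c) (sn X) (sn Y) (sn Z),
      real_inner_smul_left] at e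
    simp only [ev] at e
    exact e
  · intro X Y Z U
    rw [eq, eq, curvatureField_swap (sn Y) (sn X) (sn Z), inner_neg_left]
  · intro X Y Z U
    have e := inner_curvatureField_antisymm (sn X) (sn Y) (sn U) (sn Z)
    rw [ev, ev, real_inner_comm] at e
    rw [eq, eq, real_inner_comm, e, real_inner_comm]
  · intro X Y Z U
    rw [eq, eq, eq, ← inner_add_left, ← inner_add_left, curvatureField_bianchi (sn X) (sn Y) (sn Z),
      inner_zero_left]
  · intro X Y Z U
    have e := riemann_apply (sn X) (sn Y) ((sn Z).endo hJ.smooth) (J x U)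
    rw [curvatureField_complex hJ (sn X) (sn Y) (sn Z), hJ.orthogonal] at e
    simp only [ev] at e
    exact e

lemma SmoothNear.normalize (h : SmoothNear X x) (h0 : X x ≠ 0) :
    SmoothNear (fun y => (Real.sqrt ⟪X y, X y⟫)⁻¹ • X y) x ∧
      ∀ᶠ y in 𝓝 x, ‖(Real.sqrt ⟪X y, X y⟫)⁻¹ • X y‖ = 1 := by
  have h1 : ⟪X x, X x⟫ ≠ 0 := inner_self_ne_zero.2 h0
  have hi := h.inner h
  refine ⟨SmoothNear.smul ((hi.sqrt h1).inv ?_) h, ?_⟩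
  · rw [← norm_eq_sqrt_real_inner]
    exact norm_ne_zero_iff.2 h0
  · filter_upwards [hi.at.continuousAt.eventually_ne h1] with y hy
    have hy : X y ≠ 0 := inner_self_ne_zero.1 hy
    rw [← norm_eq_sqrt_real_inner, norm_smul, norm_inv, norm_norm,
      inv_mul_cancel₀ (norm_ne_zero_iff.2 hy)]

lemma starProjection_eq_of_unit {V : Type*} [NormedAddCommGroup V] [InnerProductSpace ℝ V]
    [FiniteDimensional ℝ V] {J : V →L[ℝ] V} {D : Submodule ℝ V} (hJ : IsOrthComplex J)
    (hV : Module.finrank ℝ V = 4) (hD : ∀ v ∈ D, J v ∈ D) (h2 : Module.finrank ℝ D = 2) {u : V}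
    (hu : u ∈ D) (hu1 : ‖u‖ = 1) (w : V) :
    D.starProjection w = ⟪u, w⟫ • u + ⟪J u, w⟫ • J u := by
  obtain ⟨v, hv, hv1⟩ := exists_unit_mem (D := Dᗮ)
    (by have := D.finrank_add_finrank_orthogonal; omega)
  obtain ⟨b, A, h0, h1, -⟩ := exists_adapted_of_unit hJ hV hD hu hv hu1 hv1
  rw [A.proj_eq, b.repr_apply_apply, b.repr_apply_apply, h0, h1]

/-- A smooth distribution has local smooth adapted frames `u, Ju, v, Jv`. -/
lemma IsInvariantDistribution.exists_frame (hD : IsInvariantDistribution J D)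
    (hJ : IsAlmostHermitian J) (x : M) :
    ∃ u v : ∀ x : M, TangentSpace (𝓡 4) x, SmoothNear u x ∧ SmoothNear v x ∧
      ∀ᶠ y in 𝓝 x, ∃ b : OrthonormalBasis (Fin 4) ℝ (TangentSpace (𝓡 4) y),
        IsAdapted (J y) (D y) b ∧ b 0 = u y ∧ b 1 = J y (u y) ∧ b 2 = v y ∧ b 3 = J y (v y) := by
  obtain ⟨u₀, hu₀, hu1⟩ := exists_unit_mem (D := D x) (by rw [hD.finrank_eq]; norm_num)
  obtain ⟨v₀, hv₀, hv1⟩ := exists_unit_mem (D := (D x)ᗮ) (by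
    have := (D x).finrank_add_finrank_orthogonal
    rw [finrank_tangentSpace, hD.finrank_eq] at this
    omega)
  obtain ⟨U, X, hU, hxU, hXx, hXD, hX⟩ := hD.smooth x u₀ hu₀
  have hXs : SmoothNear X x := by
    filter_upwards [hU.mem_nhds hxU] with y hy
    exact hX.contMDiffAt (hU.mem_nhds hy)
  obtain ⟨hu, hun⟩ := hXs.normalize (by rw [hXx]; exact norm_ne_zero_iff.1 (by rw [hu1]; norm_num))
  set u : ∀ x : M, TangentSpace (𝓡 4) x := fun y => (Real.sqrt ⟪X y, X y⟫)⁻¹ • X y with hu_def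
  have huD : ∀ᶠ y in 𝓝 x, u y ∈ D y := by
    filter_upwards [hU.mem_nhds hxU] with y hy
    exact (D y).smul_mem _ (hXD y hy)
  let w : ∀ x : M, TangentSpace (𝓡 4) x := FiberBundle.extend E4 v₀
  have hw : SmoothNear w x := smoothNear_extend v₀
  -- Smooth sections are given only for `D`. A section of the complement arises from an extension of
  -- `v₀` by subtracting its projection on `D`, written in the smooth basis `u, Ju`; it equals `v₀`
  -- at `x`, so it can be normalized.
  let z : ∀ x : M, TangentSpace (𝓡 4) x := fun y =>
    w y - (⟪u y, w y⟫ • u y + ⟪J y (u y), w y⟫ • J y (u y))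
  have hJu := hu.endo hJ.smooth
  have hz : SmoothNear z x := hw.sub ((hu.smul (hu.inner hw)).add (hJu.smul (hJu.inner hw)))
  have hzD : ∀ᶠ y in 𝓝 x, z y = w y - (D y).starProjection (w y) := by
    filter_upwards [hun, huD] with y h1 h2
    rw [starProjection_eq_of_unit (hJ.orthComplex y) (finrank_tangentSpace y) (hD.invariant y)
      (hD.finrank_eq y) h2 h1]
  have hzx : z x ≠ 0 := by
    have e : w x = v₀ := by simp [w]
    rw [hzD.self_of_nhds, e, (Submodule.starProjection_apply_eq_zero_iff _).2 hv₀, sub_zero]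
    exact norm_ne_zero_iff.1 (by rw [hv1]; norm_num)
  obtain ⟨hv, hvn⟩ := hz.normalize hzx
  refine ⟨u, _, hu, hv, ?_⟩
  filter_upwards [hun, huD, hzD, hvn] with y h1 h2 h3 h4
  refine exists_adapted_of_unit (hJ.orthComplex y) (finrank_tangentSpace y) (hD.invariant y) h2
    (Submodule.smul_mem _ _ ?_) h1 h4
  rw [h3]
  exact Submodule.sub_starProjection_mem_orthogonal _

lemma IsInvariantDistribution.opposite_negative (hD : IsInvariantDistribution J D)
    (hJ : IsAlmostHermitian J) : IsNegative J (fun x => oppositeOf (J x) (D x)) where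
  smooth := by
    refine isSmoothEndo_of_smoothNear fun x X hX => ?_
    obtain ⟨u, v, hu, hv, h⟩ := hD.exists_frame hJ x
    have hJu := hu.endo hJ.smooth
    have hJv := hv.endo hJ.smooth
    -- This is the expansion `opposite_apply` in the frame `u, Ju, v, Jv`.
    refine ((((hJu.smul (hu.inner hX)).sub (hu.smul (hJu.inner hX))).sub
      (hJv.smul (hv.inner hX))).add (hv.smul (hJv.inner hX))).congr ?_
    filter_upwards [h] with y hy
    obtain ⟨b, A, h0, h1, h2, h3⟩ := hy
    rw [A.opposite_apply]
    simp only [b.repr_apply_apply, h0, h1, h2, h3]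
    rfl
  sq x v := by
    obtain ⟨b, A⟩ := exists_adapted (hJ.orthComplex x) (finrank_tangentSpace x) (hD.invariant x)
      (hD.finrank_eq x)
    exact A.opposite_complex.sq v
  orthogonal x v w := by
    obtain ⟨b, A⟩ := exists_adapted (hJ.orthComplex x) (finrank_tangentSpace x) (hD.invariant x)
      (hD.finrank_eq x)
    exact A.opposite_complex.orth v w
  opposite x X Y Z U := by
    obtain ⟨b, A⟩ := exists_adapted (hJ.orthComplex x) (finrank_tangentSpace x) (hD.invariant x)
      (hD.finrank_eq x)
    exact A.opposite_volForm X Y Z U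

/-- The coefficients of the curvature tensor of a surface of quasi-constant holomorphic sectional
curvature are smooth. -/
lemma IsInvariantDistribution.smooth_coefficients (hD : IsInvariantDistribution J D)
    (hJ : IsAlmostHermitian J) {p q r : M → ℝ}
    (h : ∀ (x : M) (X Y Z U : TangentSpace (𝓡 4) x), riemann x X Y Z U =
      p x * tensorPi (J x) X Y Z U + q x * tensorPhi (J x) (D x) X Y Z U
        + r x * tensorPsi (J x) (D x) X Y Z U) (x : M) :
    FunSmoothNear p x ∧ FunSmoothNear q x ∧ FunSmoothNear r x := by
  obtain ⟨u, v, hu, hv, hb⟩ := hD.exists_frame hJ x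
  have hol {X : ∀ x : M, TangentSpace (𝓡 4) x} (hX : SmoothNear X x) :
      FunSmoothNear (fun y => riemann y (X y) (J y (X y)) (J y (X y)) (X y)) x :=
    riemann_smooth hX (hX.endo hJ.smooth) (hX.endo hJ.smooth) hX
  have hp : FunSmoothNear p x := by
    refine (hol hv).congr ?_
    filter_upwards [hb] with y ⟨b, A, h0, h1, h2, h3⟩
    rw [A.holomorphic_eq (h y), ← h2, show ‖(D y).starProjection (b 2)‖ ^ 4
      = (‖(D y).starProjection (b 2)‖ ^ 2) ^ 2 by ring, A.norm_proj]
    simp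
  have hq : FunSmoothNear q x := by
    -- The holomorphic curvature is `4p + 2q + r` at `u + v`, `p + q + r` at `u` and `p` at `v`; the
    -- remaining coefficients follow by elimination.
    refine (((hol (hu.add hv)).sub (hol hu)).sub
      ((FunSmoothNear.const 3).mul hp)).congr ?_
    filter_upwards [hb] with y ⟨b, A, h0, h1, h2, h3⟩
    rw [A.holomorphic_eq (h y), A.holomorphic_eq (h y), ← h0, ← h2,
      show ‖(D y).starProjection (b 0 + b 2)‖ ^ 4
        = (‖(D y).starProjection (b 0 + b 2)‖ ^ 2) ^ 2 by ring,
      show ‖(D y).starProjection (b 0)‖ ^ 4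
        = (‖(D y).starProjection (b 0)‖ ^ 2) ^ 2 by ring, A.norm_proj, A.norm_proj,
      inner_repr b, inner_repr b]
    simp
    ring
  refine ⟨hp, hq, (((hol hu).sub hp).sub hq).congr ?_⟩
  filter_upwards [hb] with y ⟨b, A, h0, h1, h2, h3⟩
  rw [A.holomorphic_eq (h y), ← h0, show ‖(D y).starProjection (b 0)‖ ^ 4
      = (‖(D y).starProjection (b 0)‖ ^ 2) ^ 2 by ring, A.norm_proj]
  simp
  ring

lemma IsNegative.structure_at (hJ' : IsNegative J J') (hJ : IsAlmostHermitian J) (x : M) :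
    (∀ v, (kerPlus J J' x).starProjection v = (1 / 2 : ℝ) • (v - J x (J' x v))) ∧
    Module.finrank ℝ (kerPlus J J' x) = 2 ∧ (∀ v ∈ kerPlus J J' x, J x v ∈ kerPlus J J' x) ∧
    oppositeOf (J x) (kerPlus J J' x) = J' x ∧ (kerPlus J J' x)ᗮ = kerMinus J J' x :=
  (hJ.orthComplex x).negative_structure (hJ'.orthComplex x) (hJ'.opposite x)
    (finrank_tangentSpace x) (D := kerPlus J J' x) rfl

lemma IsNegative.invariantDistribution (hJ' : IsNegative J J') (hJ : IsAlmostHermitian J) :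
    IsInvariantDistribution J (kerPlus J J') where
  finrank_eq x := (hJ'.structure_at hJ x).2.1
  invariant x := (hJ'.structure_at hJ x).2.2.1
  smooth x v hv := by
    let w : ∀ x : M, TangentSpace (𝓡 4) x := FiberBundle.extend E4 v
    have hw : SmoothNear w x := smoothNear_extend v
    -- The smooth projection `½(1 - JJ')` turns any smooth extension of `v` into a section of the
    -- distribution, and it fixes `v`.
    have hs : SmoothNear (fun y => (1 / 2 : ℝ) • (w y - J y (J' y (w y)))) x :=
      (hw.sub ((hw.endo hJ'.smooth).endo hJ.smooth)).smul (FunSmoothNear.const _)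
    obtain ⟨U, hU, hUo, hxU⟩ := eventually_nhds_iff.1 hs
    refine ⟨U, fun y => (1 / 2 : ℝ) • (w y - J y (J' y (w y))), hUo, hxU, ?_, fun y _ => ?_,
      fun y hy => (hU y hy).contMDiffWithinAt⟩
    · have e : w x = v := by simp [w]
      simp only [e]
      rw [← (hJ'.structure_at hJ x).1]
      exact Submodule.starProjection_eq_self_iff.2 hv
    · beta_reduce
      rw [← (hJ'.structure_at hJ y).1]
      exact Submodule.starProjection_apply_mem _ _

end
end QCH

end

/-! ### Assembly of both directions -/

theorem theorem1 {M : Type*} [TopologicalSpace M] [T2Space M] [SecondCountableTopology M]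
    [ChartedSpace QCH.E4 M] [IsManifold (𝓡 4) ∞ M]
    [RiemannianBundle (fun x : M => TangentSpace (𝓡 4) x)]
    [IsContMDiffRiemannianBundle (𝓡 4) ∞ QCH.E4 (fun x : M => TangentSpace (𝓡 4) x)]
    (J : ∀ x : M, TangentSpace (𝓡 4) x →L[ℝ] TangentSpace (𝓡 4) x) (hJ : QCH.IsKahler J) :
    -- a QCH Kähler surface
    (∀ D : ∀ x : M, Submodule ℝ (TangentSpace (𝓡 4) x), QCH.IsQCH J D →
      (∃ a b c : M → ℝ,
        ContMDiff (𝓡 4) 𝓘(ℝ, ℝ) ∞ a ∧ ContMDiff (𝓡 4) 𝓘(ℝ, ℝ) ∞ b ∧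
        ContMDiff (𝓡 4) 𝓘(ℝ, ℝ) ∞ c ∧
        (∀ (x : M) (X Y Z U : TangentSpace (𝓡 4) x), QCH.riemann x X Y Z U =
          a x * QCH.tensorPi (J x) X Y Z U + b x * QCH.tensorPhi (J x) (D x) X Y Z U
            + c x * QCH.tensorPsi (J x) (D x) X Y Z U) ∧
        (∀ (x : M) (X Y Z U : TangentSpace (𝓡 4) x), QCH.weylMinus J x X Y Z U =
          c x * QCH.tensorK (J x) (D x) X Y Z U)) ∧
      QCH.IsNegative J (fun x => QCH.oppositeOf (J x) (D x)) ∧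
      (∀ x, QCH.IsDegenerate (J x) (QCH.weylMinus J x)) ∧
      (∀ x, QCH.IsSimpleEigenform (J x) (QCH.weylMinus J x)
        (QCH.fundForm (QCH.oppositeOf (J x) (D x)))) ∧
      QCH.PreservesRicci (fun x => QCH.oppositeOf (J x) (D x))) ∧
    -- conversely, a negative almost complex structure preserving the Ricci tensor
    (∀ J' : ∀ x : M, TangentSpace (𝓡 4) x →L[ℝ] TangentSpace (𝓡 4) x,
      QCH.IsNegative J J' → QCH.PreservesRicci J' →
      ((∀ x, QCH.IsDegenerate (J x) (QCH.weylMinus J x) ∧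
          QCH.IsSimpleEigenform (J x) (QCH.weylMinus J x) (QCH.fundForm (J' x))) ↔
        (∀ (x : M) (X Y Z U : TangentSpace (𝓡 4) x), QCH.weylMinus J x X Y Z U =
          QCH.conformalScalar J J' x / 2 *
            QCH.tensorK (J x) (QCH.kerPlus J J' x) X Y Z U)) ∧
      ((∀ x, QCH.IsDegenerate (J x) (QCH.weylMinus J x) ∧
          QCH.IsSimpleEigenform (J x) (QCH.weylMinus J x) (QCH.fundForm (J' x))) →
        (∀ x, (QCH.kerPlus J J' x)ᗮ = QCH.kerMinus J J' x) ∧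
        QCH.IsQCH J (QCH.kerPlus J J') ∧
        ContMDiff (𝓡 4) 𝓘(ℝ, ℝ) ∞ (QCH.scalarCurvature (M := M)) ∧
        ContMDiff (𝓡 4) 𝓘(ℝ, ℝ) ∞ (QCH.conformalScalar J J') ∧
        ∃ δ : M → ℝ, ContMDiff (𝓡 4) 𝓘(ℝ, ℝ) ∞ δ ∧
          (∀ (x : M) (X Y : TangentSpace (𝓡 4) x),
            QCH.ricciZeroOf (QCH.riemann x) X Y =
              δ x * (QCH.hForm (QCH.kerPlus J J' x) X Y
                - QCH.hForm (QCH.kerMinus J J' x) X Y)) ∧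
          (∀ (x : M) (X Y Z U : TangentSpace (𝓡 4) x), QCH.riemann x X Y Z U =
            (QCH.scalarCurvature x / 6 - δ x + QCH.conformalScalar J J' x / 12)
                * QCH.tensorPi (J x) X Y Z U
              + (2 * δ x - QCH.conformalScalar J J' x / 2)
                * QCH.tensorPhi (J x) (QCH.kerPlus J J' x) X Y Z U
              + QCH.conformalScalar J J' x / 2
                * QCH.tensorPsi (J x) (QCH.kerPlus J J' x) X Y Z U))) := by
  refine ⟨fun D hQ => ?_, fun J' hJ' hR => ?_⟩
  · obtain ⟨φ, hφ⟩ := hQ.holomorphic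
    have hA (x : M) := QCH.exists_adapted (hJ.orthComplex x) (QCH.finrank_tangentSpace x)
      (hQ.invariant x) (hQ.finrank_eq x)
    choose b A using hA
    have hex (x : M) := (hJ.riemann_kahler x).eq_of_quasiConstant (A x) (hφ x)
    choose p q r h using hex
    have hs (x : M) := hQ.toIsInvariantDistribution.smooth_coefficients hJ.toIsAlmostHermitian h x
    have hW (x : M) : QCH.weylMinus J x = fun X Y Z U => r x * QCH.tensorK (J x) (D x) X Y Z U := by
      funext X Y Z U
      exact (A x).weylMinusOf_eq_tensorK (h x) X Y Z U
    refine ⟨⟨p, q, r, fun x => (hs x).1.at, fun x => (hs x).2.1.at, fun x => (hs x).2.2.at, h,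
      fun x X Y Z U => by rw [hW]⟩, hQ.toIsInvariantDistribution.opposite_negative
        hJ.toIsAlmostHermitian, fun x => ?_, fun x => ?_, fun x X Y => ?_⟩
    · rw [hW]
      exact (A x).isDegenerate_tensorK _
    · rw [hW]
      exact (A x).isSimpleEigenform_tensorK _
    · rw [(A x).ricci_eq (h x), (A x).ricci_eq (h x), (A x).opposite_complex.orth, (A x).hForm_opposite]
  · have hJh := hJ.toIsAlmostHermitian
    have hD := hJ'.invariantDistribution hJh
    have hA (x : M) := QCH.exists_adapted (hJ.orthComplex x) (QCH.finrank_tangentSpace x)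
      (hD.invariant x) (hD.finrank_eq x)
    have hop (x : M) : QCH.oppositeOf (J x) (QCH.kerPlus J J' x) = J' x :=
      (hJ'.structure_at hJh x).2.2.2.1
    have horth (x : M) : (QCH.kerPlus J J' x)ᗮ = QCH.kerMinus J J' x :=
      (hJ'.structure_at hJh x).2.2.2.2
    choose b A using hA
    -- The pointwise converse concerns `oppositeOf`; for the kernel distribution this structure is
    -- `J'` itself.
    have hc (x : M) := (A x).converse (hJ.riemann_kahler x) (by rw [hop]; exact hR x)
      (κ := QCH.conformalScalar J J' x) (by rw [hop]; rfl)
    simp only [hop, horth] at hc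
    have hiff := forall_congr' fun x => (hc x).1
    refine ⟨hiff, fun hdeg => ⟨horth, ?_⟩⟩
    have hK := hiff.1 hdeg
    choose δ hδ hδR using fun x => (hc x).2
    have hRf (x : M) (X Y Z U : TangentSpace (𝓡 4) x) : QCH.riemann x X Y Z U =
        (QCH.scalarCurvature x / 6 - δ x + QCH.conformalScalar J J' x / 12)
            * QCH.tensorPi (J x) X Y Z U
          + (2 * δ x - QCH.conformalScalar J J' x / 2)
            * QCH.tensorPhi (J x) (QCH.kerPlus J J' x) X Y Z U
          + QCH.conformalScalar J J' x / 2
            * QCH.tensorPsi (J x) (QCH.kerPlus J J' x) X Y Z U := by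
      rw [hδR x X Y Z U]
      rw [hK x X Y Z U, QCH.tensorK, QCH.scalarCurvature]
      ring
    -- `δ` was chosen point by point. Regularity comes from the coefficients `a, b, c` of `Π, Φ, Ψ`,
    -- through `κ = 2c`, `δ = (b + c)/2` and `τ = 6(a + δ - κ/12)`.
    have hs (x : M) := hD.smooth_coefficients hJh hRf x
    have hκ (x : M) : QCH.FunSmoothNear (QCH.conformalScalar J J') x :=
      ((QCH.FunSmoothNear.const 2).mul (hs x).2.2).congr (Filter.Eventually.of_forall fun y => by
        ring)
    have hδs (x : M) : QCH.FunSmoothNear δ x :=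
      ((QCH.FunSmoothNear.const (1 / 2)).mul ((hs x).2.1.add (hs x).2.2)).congr
        (Filter.Eventually.of_forall fun y => by ring)
    have hτ (x : M) : QCH.FunSmoothNear (QCH.scalarCurvature (M := M)) x :=
      ((QCH.FunSmoothNear.const 6).mul (((hs x).1.add (hδs x)).sub
        ((QCH.FunSmoothNear.const (1 / 12)).mul (hκ x)))).congr
        (Filter.Eventually.of_forall fun y => by ring)
    -- The function witnessing QCH is `holomorphic_eq` on unit vectors, as a polynomial in the
    -- projection length.
    refine ⟨⟨hD, fun x t => (QCH.scalarCurvature x / 6 - δ x + QCH.conformalScalar J J' x / 12)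
      + (2 * δ x - QCH.conformalScalar J J' x / 2) * t ^ 2
      + QCH.conformalScalar J J' x / 2 * t ^ 4, fun x X hX => ?_⟩, fun x => (hτ x).at,
      fun x => (hκ x).at, δ, fun x => (hδs x).at, hδ, hRf⟩
    rw [(A x).holomorphic_eq (hRf x), real_inner_self_eq_norm_sq, hX]
    ring
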